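/- Notation. $\mathbb{H}$ is the upper half-plane. $\Gamma_1(n)\subset SL_2(\mathbb{Z})$ ($n\geqslant 1$) is the group of matrices congruent to $\left(\begin{smallmatrix}1&\ast\\0&1\end{smallmatrix}\right)$ modulo $n$. For $\Gamma$ equal to $SL_2(\mathbb{Z})$ or $\Gamma_1(n)$ and $w\in\mathbb{Z}$, a quasi-modular form of weight $w$ for $\Gamma$ is a holomorphic function $f:\mathbb{H}\to\mathbb{C}$ for which there are $p\geqslant 0$ and holomorphic functions $f_0=f,f_1,\dots,f_p$ on $\mathbb{H}$ such that, for all $\left(\begin{smallmatrix}a&b\\c&d\end{smallmatrix}\right)\in\Gamma$ and $\tau\in\mathbb{H}$, $$(c\tau+d)^{-w}f\left(\frac{a\tau+b}{c\tau+d}\right)=\sum_{i=0}^p f_i(\tau)\left(\frac{c}{c\tau+d}\right)^i .$$ One may or may not require in addition that $f_0,\dots,f_p$ have moderate growth, i.e. $|f_i(\tau)|\leqslant C\left((1+|\tau|^2)/\Im\tau\right)^M$ for some $C,M$ (holomorphy at the cusps); the theorem below holds with either convention, used throughout. Let $\mathrm{QMod}_w(\Gamma)$ be the set of these forms, and $\mathrm{QMod}_{\leqslant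 w}(\Gamma)$ the set of finite sums of quasi-modular forms for $\Gamma$ of weights at most $w$. Let $\wp(u;\tau)$ be the Weierstrass function of the lattice $\mathbb{Z}+\mathbb{Z}\tau$, $\wp^{(s)}$ its $s$-th derivative in $u$, and $G_2,G_4,G_6$ the Eisenstein series of $SL_2(\mathbb{Z})$. Fix an integer $N\geqslant 0$. * $\mathscr{J}_N$ is the $\mathbb{C}$-algebra of functions of $(z_1,\dots,z_N;\tau)$ generated by $G_2(\tau),G_4(\tau),G_6(\tau)$ and the $\wp^{(s)}(z_i-z_j;\tau)$ with $i\neq j$ and $s\geqslant 0$; $G_k$ has weight $k$ and $\wp^{(s)}(z_i-z_j;\tau)$ has weight $s+2$. * $\mathscr{J}_N(\Gamma_1(n))$ is the $\mathbb{C}$-algebra generated by the quasi-modular forms for $\Gamma_1(n)$, with their weights, and the shifts $\wp^{(s)}(z_i-z_j-k\tau;n\tau)$ with $i\neq j$, $s\geqslant 0$ and $k\in\mathbb{Z}$, which have weight $s+2$. $\mathscr{J}_N^{(w)}$ and $\mathscr{J}_N^{(w)}(\Gamma_1(n))$ are their graded pieces of weight $w\in\mathbb{Z}$, spanned by the products of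 generators of total weight $w$. Take $n=1$ in the case of $\mathscr{J}_N$. For $\tau\in\mathbb{H}$ put $R_\tau=\mathbb{R}/n\Im\tau\,\mathbb{Z}$, and let $\Delta_\tau\subset R_\tau^N$ be the union of the diagonals $\alpha_i-\alpha_j\equiv k\Im\tau \bmod n\Im\tau$ ($i\neq j$, $k\in\mathbb{Z}$). Scaling by $\Im\tau$ identifies $(\mathbb{R}/n\mathbb{Z})^N$ with $R_\tau^N$, and so the connected components $U_\Sigma=U_\Sigma(\tau)$ of $R_\tau^N\setminus\Delta_\tau$ are indexed by a set of labels $\Sigma$ that does not depend on $\tau$. For $\alpha\in U_\Sigma(\tau)$ let $\mathsf{T}_\alpha=\{(x_1+i\alpha_1,\dots,x_N+i\alpha_N) : x\in(\mathbb{R}/\mathbb{Z})^N\}$ and $$[f]_\Sigma(\tau)=\int_{\mathsf{T}_\alpha}f(z_1,\dots,z_N;\tau)\,\mathrm{d}z_1\cdots\mathrm{d}z_N .$$ Theorem. For $f$ in $\mathscr{J}_N^{(w)}$ or in $\mathscr{J}_N^{(w)}(\Gamma_1(n))$ and every label $\Sigma$, this integral converges and does not depend on the choice of $\alpha\in U_\Sigma(\tau)$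 (nor of a real lift of $\alpha$). Moreover: 1. If $f\in\mathscr{J}_N^{(w)}$, then $[f]_\Sigma\in\mathrm{QMod}_{\leqslant w}(SL_2(\mathbb{Z}))$. 2. If $f\in\mathscr{J}_N^{(w)}(\Gamma_1(n))$, then $[f]_\Sigma\in\mathrm{QMod}_{\leqslant w}(\Gamma_1(n))$. -/

import Mathlib

open scoped UpperHalfPlane MatrixGroups Manifold

noncomputable section

namespace QuasiJacobi

/-! ### Quasi-modular forms -/

/-- The holomorphic functions on the upper half-plane. -/
def holomorphicFunctions : Set (ℍ → ℂ) :=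
  {g | MDifferentiable 𝓘(ℂ) 𝓘(ℂ) g}

/-- The holomorphic functions on the upper half-plane of moderate growth. For a form on a
congruence subgroup this growth condition is holomorphy at all cusps. -/
def moderateHolomorphicFunctions : Set (ℍ → ℂ) :=
  {g | MDifferentiable 𝓘(ℂ) 𝓘(ℂ) g ∧
    ∃ (C : ℝ) (M : ℕ), ∀ τ : ℍ, ‖g τ‖ ≤ C * ((1 + ‖(τ : ℂ)‖ ^ 2) / τ.im) ^ M}

/-- `f` is a quasi-modular form of weight `w` for `Γ` (of some depth `p`), the associated functions
`f = g 0, g 1, …, g p` lying in the class `𝒪`: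
`(cτ+d)^(-w) f((aτ+b)/(cτ+d)) = ∑_{i ≤ p} g i τ (c/(cτ+d))^i`. -/
def IsQuasiModular (𝒪 : Set (ℍ → ℂ)) (Γ : Subgroup SL(2, ℤ)) (w : ℤ) (f : ℍ → ℂ) : Prop :=
  ∃ (p : ℕ) (g : ℕ → ℍ → ℂ), g 0 = f ∧ (∀ i ≤ p, g i ∈ 𝒪) ∧
    ∀ γ ∈ Γ, ∀ τ : ℍ,
      ((γ 1 0 : ℂ) * τ + (γ 1 1 : ℂ)) ^ (-w) * f (γ • τ) =
        ∑ i ∈ Finset.range (p + 1),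
          g i τ * ((γ 1 0 : ℂ) / ((γ 1 0 : ℂ) * τ + (γ 1 1 : ℂ))) ^ i

/-- `QMod_{≤ w}(Γ)`: finite sums of quasi-modular forms for `Γ` of weights at most `w`. -/
def QModLE (𝒪 : Set (ℍ → ℂ)) (Γ : Subgroup SL(2, ℤ)) (w : ℤ) : Submodule ℂ (ℍ → ℂ) :=
  Submodule.span ℂ {f | ∃ w' ≤ w, IsQuasiModular 𝒪 Γ w' f}

/-! ### Weierstrass functions and Eisenstein series of the lattice `⟨1, τ⟩` -/

/-- The pair of periods `(1, τ)`. -/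
def periodPair (τ : ℍ) : PeriodPair where
  ω₁ := 1
  ω₂ := τ
  indep := by
    rw [LinearIndependent.pair_iff]
    intro s t h
    have him := congrArg Complex.im h
    have hre := congrArg Complex.re h
    simp at him hre
    have ht : t = 0 := him.resolve_right τ.im_ne_zero
    subst ht
    simpa using hre

/-- The point `nτ` of the upper half-plane. -/
def natMul (n : ℕ) [NeZero n] (τ : ℍ) : ℍ :=
  ⟨(n : ℂ) * τ, by
    have hn : (0 : ℝ) < n := Nat.cast_pos.mpr (NeZero.pos n)
    simpa using mul_pos hn τ.im_pos⟩

/-- `℘^{(s)}(u; τ)`, the `s`-th derivative in `u` of the Weierstrass function of `⟨1, τ⟩`. -/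
def wp (s : ℕ) (u : ℂ) (τ : ℍ) : ℂ :=
  iteratedDeriv s (periodPair τ).weierstrassP u

/-! ### The graded rings of multivariable quasi-Jacobi forms -/

/-- The weight `w` piece of the `ℂ`-algebra generated by the functions `f` with `gen k f`, such an
`f` having weight `k`: the linear span of the products of generators of total weight `w`. -/
def gradedPiece {N : ℕ} (gen : ℤ → ((Fin N → ℂ) → ℍ → ℂ) → Prop) (w : ℤ) :
    Submodule ℂ ((Fin N → ℂ) → ℍ → ℂ) :=
  Submodule.span ℂ {f | ∃ l : List (ℤ × ((Fin N → ℂ) → ℍ → ℂ)),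
    (∀ x ∈ l, gen x.1 x.2) ∧ (l.map Prod.fst).sum = w ∧ (l.map Prod.snd).prod = f}

/-- The generators `G₂, G₄, G₆` and `℘^{(s)}(z_i - z_j; τ)`, with their weights. The Eisenstein
series are the lattice sums; other normalizations generate the same `ℂ`-algebra. -/
inductive LevelOneGen (N : ℕ) : ℤ → ((Fin N → ℂ) → ℍ → ℂ) → Prop
  | G2 : LevelOneGen N 2 (fun _ τ => EisensteinSeries.G2 τ)
  | G4 : LevelOneGen N 4 (fun _ τ => (periodPair τ).G 4)
  | G6 : LevelOneGen N 6 (fun _ τ => (periodPair τ).G 6)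
  | wp (i j : Fin N) (hij : i ≠ j) (s : ℕ) :
      LevelOneGen N (s + 2) (fun z τ => wp s (z i - z j) τ)

/-- The generators of the ring for `Γ₁(n)`: the quasi-modular forms for `Γ₁(n)` and the shifts
`℘^{(s)}(z_i - z_j - kτ; nτ)`, with their weights. -/
inductive Gamma1Gen (𝒪 : Set (ℍ → ℂ)) (n : ℕ) [NeZero n] (N : ℕ) :
    ℤ → ((Fin N → ℂ) → ℍ → ℂ) → Prop
  | qmod (w : ℤ) (h : ℍ → ℂ) (hh : IsQuasiModular 𝒪 (CongruenceSubgroup.Gamma1 n) w h) :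
      Gamma1Gen 𝒪 n N w (fun _ τ => h τ)
  | wp (i j : Fin N) (hij : i ≠ j) (s : ℕ) (k : ℤ) :
      Gamma1Gen 𝒪 n N (s + 2) (fun z τ => wp s (z i - z j - k * τ) (natMul n τ))

/-- The weight `w` piece of the ring of `N`-variable Jacobi forms for `ℤ² ⋊ SL₂(ℤ)`. -/
def levelOneRing (N : ℕ) (w : ℤ) : Submodule ℂ ((Fin N → ℂ) → ℍ → ℂ) :=
  gradedPiece (LevelOneGen N) w

/-- The weight `w` piece of the ring of `N`-variable quasi-Jacobi forms for
`(ℤ ⊕ nℤ) ⋊ Γ₁(n)`. -/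
def gamma1Ring (𝒪 : Set (ℍ → ℂ)) (n : ℕ) [NeZero n] (N : ℕ) (w : ℤ) :
    Submodule ℂ ((Fin N → ℂ) → ℍ → ℂ) :=
  gradedPiece (Gamma1Gen 𝒪 n N) w

/-! ### Periods over real torus fibers -/

/-- The complement of the diagonals `x_i - x_j ≡ k mod n` (`k ∈ ℤ`, `i ≠ j`) in `(ℝ/nℤ)^N`. Scaling
by `Im τ` identifies it with the complement of the diagonals in `(ℝ/⟨n Im τ⟩)^N`, for each `τ`. -/
abbrev DiagonalComplement (n N : ℕ) : Type :=
  {β : Fin N → AddCircle (n : ℝ) //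
    ∀ i j, i ≠ j → ∀ k : ℤ, β i - β j ≠ ((k : ℝ) : AddCircle (n : ℝ))}

/-- The real lifts `α` of the points of the component `U_S` of the complement of the diagonals in
`(ℝ/⟨n Im τ⟩)^N`. -/
def chamber {n N : ℕ} (S : ConnectedComponents (DiagonalComplement n N)) (τ : ℍ) :
    Set (Fin N → ℝ) :=
  {α | ∃ β : DiagonalComplement n N, ConnectedComponents.mk β = S ∧
    ∀ i, β.1 i = ((α i / τ.im : ℝ) : AddCircle (n : ℝ))}

/-- The restriction of `f(·; τ)` to the torus `T_α = {x + iα : x ∈ (ℝ/ℤ)^N}`. -/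
def onTorus {N : ℕ} (f : (Fin N → ℂ) → ℍ → ℂ) (τ : ℍ) (α : Fin N → ℝ) (x : Fin N → ℝ) : ℂ :=
  f (fun i => (x i : ℂ) + (α i : ℂ) * Complex.I) τ

/-- The period `∫_{T_α} f(z₁, …, z_N; τ) dz₁ ⋯ dz_N`. -/
def period {N : ℕ} (f : (Fin N → ℂ) → ℍ → ℂ) (τ : ℍ) (α : Fin N → ℝ) : ℂ :=
  ∫ x in Set.Icc (0 : Fin N → ℝ) 1, onTorus f τ α x

/-- `F` is the function `[f]_S`: for every `τ` and every `α` in the component `U_S`, the integral of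
`f` over `T_α` converges and its value is `F τ`. -/
def IsPeriodFunction {n N : ℕ} (f : (Fin N → ℂ) → ℍ → ℂ)
    (S : ConnectedComponents (DiagonalComplement n N)) (F : ℍ → ℂ) : Prop :=
  ∀ τ : ℍ, ∀ α ∈ chamber S τ,
    MeasureTheory.IntegrableOn (onTorus f τ α) (Set.Icc (0 : Fin N → ℝ) 1) ∧
      period f τ α = F τ

end QuasiJacobi

end

noncomputable section

namespace QuasiJacobi

open Complex Filter Topology

/-! Everything is expressed through Z = θ'/θ (`zfun`) for the lattice ℤ + ℤT. It has simple poles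
with residue 1 at the lattice points, period 1, and satisfies Z(u + T) = Z(u) − 2πi. Its derivatives
are elliptic, and ℘ is −Z' plus a quasi-modular form of weight 2. Off the diagonals f is therefore
equal to an element of a larger ring `zRing`, generated by the quasi-modular forms and the functions
Z^{(s)}(z_i − z_j − kτ; nτ) of weight s + 1.

The first variable can be integrated out inside this ring. Under z_0 ↦ z_0 + nτ each generator
changes by a constant, so every element is a polynomial in Z(z_0 − z_1; nτ) with elliptic
coefficients, and summation of powers gives f = g − g(z_0 + nτ) with g of weight one higher
(`exists_antidifference`). Hence the integral of f over a line is the difference of the integrals of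
g over the two boundary lines of a strip, that is, 2πi times the sum of the residues of g at the
points z_j + kτ of the strip (`exists_integral_sub_eq`). A residue is the coefficient of u^{-1}, so
its weight is one lower than that of g. It lies again in the ring, in one variable less
(`exists_hasLaurent`): expanding at z_j + kτ produces only generators in the remaining variables,
the Laurent coefficients of Z at the origin, and the values Z^{(s)}(kτ; nτ). Once at most one
variable is left there are no differences z_i − z_j, and a quasi-modular form remains
(`exists_integral_eq`).

The transformation laws of the Laurent coefficients and of the values at kτ follow from that of Z
(`zfun_transform`), which is an application of Liouville's theorem; their moderate growth is read
off from Lambert series. Weights are only bounded by w because the translation constant of Z has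
weight 0 while Z has weight 1.

This argument fixes the integer parts κ of the height differences divided by Im τ. The passage to
connected components (`exists_isPeriodFunction`) uses that f is elliptic and that the period is
locally constant in the heights. -/

/-! ### The exponential and the one-sided cotangent sum -/

/-- `e(u) = exp(2πiu)`. -/
def expTwoPi (u : ℂ) : ℂ := cexp (2 * Real.pi * I * u)

lemma expTwoPi_add (u v : ℂ) : expTwoPi (u + v) = expTwoPi u * expTwoPi v := by
  simp only [expTwoPi, mul_add, Complex.exp_add]

lemma expTwoPi_neg (u : ℂ) : expTwoPi (-u) = (expTwoPi u)⁻¹ := by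
  simp only [expTwoPi, mul_neg, Complex.exp_neg]

lemma expTwoPi_ne_zero (u : ℂ) : expTwoPi u ≠ 0 := Complex.exp_ne_zero _

lemma expTwoPi_zero : expTwoPi 0 = 1 := by simp [expTwoPi]

lemma expTwoPi_nat_mul (m : ℕ) (u : ℂ) : expTwoPi (m * u) = expTwoPi u ^ m := by
  simp only [expTwoPi, ← Complex.exp_nat_mul]
  ring_nf

lemma expTwoPi_int (l : ℤ) : expTwoPi l = 1 := by
  rw [expTwoPi, Complex.exp_eq_one_iff]
  exact ⟨l, by ring⟩

lemma expTwoPi_eq_one_iff {u : ℂ} : expTwoPi u = 1 ↔ ∃ l : ℤ, u = l := by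
  rw [expTwoPi, Complex.exp_eq_one_iff]
  have h : (2 * Real.pi * I : ℂ) ≠ 0 := Complex.two_pi_I_ne_zero
  refine exists_congr fun l ↦ ⟨fun e ↦ ?_, fun e ↦ by rw [e]; ring⟩
  exact mul_left_cancel₀ h (by rw [e]; ring)

lemma expTwoPi_add_one (u : ℂ) : expTwoPi (u + 1) = expTwoPi u := by
  have := expTwoPi_int 1
  rw [expTwoPi_add]
  simp_all

lemma norm_expTwoPi (u : ℂ) : ‖expTwoPi u‖ = Real.exp (-(2 * Real.pi * u.im)) := by
  rw [expTwoPi, Complex.norm_exp]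
  congr 1
  simp

lemma differentiable_expTwoPi : Differentiable ℂ expTwoPi := by
  unfold expTwoPi
  fun_prop

lemma hasDerivAt_expTwoPi (u : ℂ) : HasDerivAt expTwoPi (2 * Real.pi * I * expTwoPi u) u := by
  have := ((hasDerivAt_id u).const_mul (2 * Real.pi * I : ℂ)).cexp
  rw [mul_one] at this
  rw [mul_comm (2 * Real.pi * I : ℂ)]
  exact this

/-- `π cot(πu) + πi`, in terms of `e(u)`. -/
def cotPlus (u : ℂ) : ℂ := -(2 * Real.pi * I) * (expTwoPi u / (1 - expTwoPi u))

lemma cotPlus_add_one (u : ℂ) : cotPlus (u + 1) = cotPlus u := by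
  simp only [cotPlus, expTwoPi_add_one]

/-- The cotangent is odd, so only twice the added constant πi survives. This 2πi becomes the
quasi-period of `zfun`. -/
lemma cotPlus_add_neg {u : ℂ} (hu : expTwoPi u ≠ 1) :
    cotPlus u + cotPlus (-u) = 2 * Real.pi * I := by
  have h0 := expTwoPi_ne_zero u
  have h1 : 1 - expTwoPi u ≠ 0 := sub_ne_zero.mpr (Ne.symm hu)
  have h2 : expTwoPi u - 1 ≠ 0 := sub_ne_zero.mpr hu
  have h3 : 1 - (expTwoPi u)⁻¹ = (expTwoPi u - 1) / expTwoPi u := by field_simp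
  simp only [cotPlus, expTwoPi_neg, h3]
  rw [show 1 - expTwoPi u = -(expTwoPi u - 1) by ring]
  field_simp
  ring

lemma differentiableAt_cotPlus {u : ℂ} (hu : expTwoPi u ≠ 1) : DifferentiableAt ℂ cotPlus u := by
  unfold cotPlus
  have := differentiable_expTwoPi u
  exact (this.div ((differentiableAt_const _).sub this) (sub_ne_zero.mpr (Ne.symm hu))).const_mul _

lemma norm_cotPlus_le {u : ℂ} (hu : ‖expTwoPi u‖ ≤ 1 / 2) :
    ‖cotPlus u‖ ≤ 4 * Real.pi * ‖expTwoPi u‖ := by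
  have h1 : 1 / 2 ≤ ‖1 - expTwoPi u‖ := by
    have := norm_sub_norm_le (1 : ℂ) (expTwoPi u)
    rw [norm_one] at this
    linarith
  have h2 : ‖cotPlus u‖ = 2 * Real.pi * (‖expTwoPi u‖ / ‖1 - expTwoPi u‖) := by
    simp [cotPlus, abs_of_pos Real.pi_pos]
  rw [h2]
  have h3 : ‖expTwoPi u‖ / ‖1 - expTwoPi u‖ ≤ ‖expTwoPi u‖ / (1 / 2) := by gcongr
  nlinarith [Real.pi_pos]

lemma norm_expTwoPi_add_mul (T : ℍ) (u : ℂ) (m : ℕ) :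
    ‖expTwoPi (u + m * T)‖ = ‖expTwoPi u‖ * ‖expTwoPi T‖ ^ m := by
  rw [expTwoPi_add, norm_mul, expTwoPi_nat_mul, norm_pow]

lemma norm_expTwoPi_lt_one (T : ℍ) : ‖expTwoPi T‖ < 1 := by
  rw [norm_expTwoPi]
  have := T.im_pos
  have h : 0 < (T : ℂ).im := this
  exact Real.exp_lt_one_iff.mpr (by have := Real.pi_pos; nlinarith [mul_pos this h])

/-- On a half-plane `Im u > -B` the terms of the one-sided cotangent sum are eventually dominated
by a geometric series. -/
lemma exists_bound_cotPlus (T : ℍ) (B : ℝ) :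
    ∃ M : ℕ, ∀ m : ℕ, ∀ u : ℂ, -B < u.im →
      ‖expTwoPi (u + (m + M : ℕ) * T)‖ ≤ 1 / 2 ∧
      ‖cotPlus (u + (m + M : ℕ) * T)‖ ≤ 2 * Real.pi * ‖expTwoPi T‖ ^ m := by
  have hr := norm_expTwoPi_lt_one T
  have hr0 := norm_nonneg (expTwoPi T)
  have hlim : Tendsto (fun m : ℕ ↦ Real.exp (2 * Real.pi * B) * ‖expTwoPi T‖ ^ m) atTop (𝓝 0) := by
    simpa using (tendsto_pow_atTop_nhds_zero_of_lt_one hr0 hr).const_mul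
      (Real.exp (2 * Real.pi * B))
  -- Skipping `M` rows absorbs the constant exp(2πB), which bounds |e(u)| on the half-plane.
  obtain ⟨M, hM⟩ := ((hlim.eventually (gt_mem_nhds (show (0 : ℝ) < 1 / 2 by norm_num)))).exists
  refine ⟨M, fun m u hu ↦ ?_⟩
  have h1 : ‖expTwoPi u‖ ≤ Real.exp (2 * Real.pi * B) := by
    rw [norm_expTwoPi]
    apply Real.exp_le_exp.mpr
    nlinarith [Real.pi_pos]
  have h2 : ‖expTwoPi (u + (m + M : ℕ) * T)‖ ≤ 1 / 2 * ‖expTwoPi T‖ ^ m := by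
    rw [norm_expTwoPi_add_mul, pow_add]
    calc _ ≤ Real.exp (2 * Real.pi * B) * (‖expTwoPi T‖ ^ m * ‖expTwoPi T‖ ^ M) := by gcongr
      _ = (Real.exp (2 * Real.pi * B) * ‖expTwoPi T‖ ^ M) * ‖expTwoPi T‖ ^ m := by ring
      _ ≤ _ := by gcongr
  have h3 : ‖expTwoPi (u + (m + M : ℕ) * T)‖ ≤ 1 / 2 :=
    h2.trans (by nlinarith [pow_le_one₀ (n := m) hr0 hr.le])
  refine ⟨h3, (norm_cotPlus_le h3).trans ?_⟩
  nlinarith [Real.pi_pos]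

lemma summable_cotPlus (T : ℍ) (u : ℂ) : Summable fun m : ℕ ↦ cotPlus (u + m * T) := by
  obtain ⟨M, hM⟩ := exists_bound_cotPlus T (-u.im + 1)
  rw [← summable_nat_add_iff M]
  refine .of_norm_bounded ((summable_geometric_of_lt_one (norm_nonneg _)
    (norm_expTwoPi_lt_one T)).mul_left (2 * Real.pi)) fun m ↦ ?_
  exact (hM m u (by linarith)).2

/-- The sum of `π cot(π(u + mT)) + πi` over `m ≥ 0`. -/
def cotSum (T : ℍ) (u : ℂ) : ℂ := ∑' m : ℕ, cotPlus (u + m * T)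

lemma cotSum_eq_add (T : ℍ) (u : ℂ) : cotSum T u = cotPlus u + cotSum T (u + T) := by
  rw [cotSum, (summable_cotPlus T u).tsum_eq_zero_add, cotSum]
  congr 1
  · simp
  · refine tsum_congr fun m ↦ ?_
    congr 1
    push_cast
    ring

lemma cotSum_add_one (T : ℍ) (u : ℂ) : cotSum T (u + 1) = cotSum T u := by
  refine tsum_congr fun m ↦ ?_
  rw [add_right_comm, cotPlus_add_one]

/-- On a half-plane around u only finitely many terms can have poles, and the hypothesis keeps u
away from these; the tail converges uniformly by comparison with a geometric series. -/
lemma differentiableAt_cotSum (T : ℍ) {u : ℂ} (hu : ∀ m : ℕ, expTwoPi (u + m * T) ≠ 1) :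
    DifferentiableAt ℂ (cotSum T) u := by
  obtain ⟨M, hM⟩ := exists_bound_cotPlus T (-u.im + 1)
  have heq : cotSum T = fun v ↦ ∑ m ∈ Finset.range M, cotPlus (v + m * T) +
      ∑' m : ℕ, cotPlus (v + (m + M : ℕ) * T) := by
    funext v
    exact ((summable_cotPlus T v).sum_add_tsum_nat_add M).symm
  rw [heq]
  have hshift : ∀ (v w : ℂ), expTwoPi (v + w) ≠ 1 →
      DifferentiableAt ℂ (fun v ↦ cotPlus (v + w)) v := fun v w h ↦
    DifferentiableAt.comp (g := cotPlus) v (differentiableAt_cotPlus h) (by fun_prop)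
  refine DifferentiableAt.add (DifferentiableAt.fun_sum fun m _ ↦ hshift _ _ (hu m)) ?_
  have hopen : IsOpen {v : ℂ | -(-u.im + 1) < v.im} := isOpen_lt continuous_const continuous_im
  refine (differentiableOn_tsum_of_summable_norm ((summable_geometric_of_lt_one (norm_nonneg _)
    (norm_expTwoPi_lt_one T)).mul_left (2 * Real.pi)) (fun m v hv ↦ ?_) hopen
      (fun m v hv ↦ (hM m v hv).2)).differentiableAt (hopen.mem_nhds (by simp))
  refine (hshift _ _ fun h ↦ ?_).differentiableWithinAt
  have := (hM m v hv).1
  rw [h, norm_one] at this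
  norm_num at this

/-! ### The lattice -/

/-- The lattice `ℤ + ℤT`, as a set. -/
def latt (T : ℍ) : Set ℂ := {u | ∃ m l : ℤ, u = m * T + l}

lemma latt_eq (T : ℍ) : latt T = (periodPair T).lattice := by
  ext u
  simp only [latt, Set.mem_ofPred_eq, SetLike.mem_coe, PeriodPair.mem_lattice, periodPair]
  constructor
  · rintro ⟨m, l, rfl⟩
    exact ⟨l, m, by ring⟩
  · rintro ⟨l, m, rfl⟩
    exact ⟨m, l, by ring⟩

lemma isOpen_compl_latt (T : ℍ) : IsOpen (latt T)ᶜ := by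
  rw [latt_eq]
  exact (periodPair T).isClosed_lattice.isOpen_compl

lemma eventually_notMem_latt (T : ℍ) (x : ℂ) : ∀ᶠ u in 𝓝[≠] x, u ∉ latt T := by
  have := (periodPair T).compl_lattice_sdiff_singleton_mem_nhds x
  rw [← latt_eq] at this
  filter_upwards [nhdsWithin_le_nhds this, self_mem_nhdsWithin] with u hu hne h
  exact hu ⟨h, hne⟩

lemma zero_mem_latt (T : ℍ) : (0 : ℂ) ∈ latt T := ⟨0, 0, by simp⟩

lemma add_mem_latt_iff (T : ℍ) {u v : ℂ} (hv : v ∈ latt T) : u + v ∈ latt T ↔ u ∈ latt T := by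
  rw [latt_eq] at *
  exact Submodule.add_mem_iff_left _ hv

lemma neg_mem_latt_iff (T : ℍ) {u : ℂ} : -u ∈ latt T ↔ u ∈ latt T := by
  rw [latt_eq]
  exact Submodule.neg_mem_iff _

lemma one_mem_latt (T : ℍ) : (1 : ℂ) ∈ latt T := ⟨0, 1, by simp⟩

lemma self_mem_latt (T : ℍ) : (T : ℂ) ∈ latt T := ⟨1, 0, by simp⟩

lemma expTwoPi_ne_one_of_notMem {T : ℍ} {u : ℂ} (hu : u ∉ latt T) (m : ℤ) :
    expTwoPi (u + m * T) ≠ 1 := by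
  intro h
  obtain ⟨l, hl⟩ := expTwoPi_eq_one_iff.mp h
  exact hu ⟨-m, l, by push_cast; linear_combination hl⟩

lemma im_mem_latt {T : ℍ} {m l : ℤ} : ((m : ℂ) * T + l).im = m * T.im := by simp

/-- A point of the strip `|Im u| < Im T` that lies in the lattice is an integer. -/
lemma notMem_latt_of_im {T : ℍ} {u : ℂ} (k : ℤ) (h1 : k * T.im < u.im)
    (h2 : u.im < (k + 1) * T.im) : u ∉ latt T := by
  rintro ⟨m, l, rfl⟩
  rw [im_mem_latt] at h1 h2
  have h3 := lt_of_mul_lt_mul_right h1 T.im_pos.le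
  have h4 := lt_of_mul_lt_mul_right h2 T.im_pos.le
  norm_cast at h3 h4
  omega

/-! ### The quasi-periodic function `Z` -/

/-- The logarithmic derivative of the odd Jacobi theta function: the Eisenstein summation of
`1 / (u + ω)` over the lattice `ℤ + ℤT`. -/
def zfun (T : ℍ) (u : ℂ) : ℂ :=
  -- Both one-sided sums contain the row m = 0 and together count it as 2π cot(πu). The last term,
  -- half of `cotPlus u - cotPlus (-u)`, removes the extra π cot(πu).
  cotSum T u - cotSum T (-u) - (cotPlus u - cotPlus (-u)) / 2

lemma zfun_neg (T : ℍ) (u : ℂ) : zfun T (-u) = -zfun T u := by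
  simp only [zfun, neg_neg]
  ring

lemma zfun_add_one (T : ℍ) (u : ℂ) : zfun T (u + 1) = zfun T u := by
  have h1 : cotSum T (-(u + 1)) = cotSum T (-u) := by
    rw [← cotSum_add_one]
    ring_nf
  have h2 : cotPlus (-(u + 1)) = cotPlus (-u) := by
    rw [← cotPlus_add_one]
    ring_nf
  simp only [zfun, h1, h2, cotSum_add_one, cotPlus_add_one]

/-- Translation by T moves one cotangent from the sum in u to the sum in −u. The cotangents
themselves cancel, and the normalizing constants πi do not. -/
lemma zfun_add_period (T : ℍ) {u : ℂ} (hu : u ∉ latt T) :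
    zfun T (u + T) = zfun T u - 2 * Real.pi * I := by
  have h0 := cotPlus_add_neg (by simpa using expTwoPi_ne_one_of_notMem hu 0)
  have h1 := cotPlus_add_neg (by simpa using expTwoPi_ne_one_of_notMem hu 1)
  have h2 := cotSum_eq_add T u
  have h3 := cotSum_eq_add T (-(u + T))
  rw [show -(u + T) + T = -u by ring] at h3
  simp only [zfun, h2, h3]
  linear_combination (-1 / 2) * h0 - (1 / 2) * h1

lemma zfun_add_int (T : ℍ) (u : ℂ) (l : ℤ) : zfun T (u + l) = zfun T u := by
  have : Function.Periodic (zfun T) 1 := zfun_add_one T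
  simpa using this.int_mul l u

lemma zfun_add_int_mul (T : ℍ) {u : ℂ} (hu : u ∉ latt T) (m : ℤ) :
    zfun T (u + m * T) = zfun T u - 2 * Real.pi * I * m := by
  have key : ∀ m : ℤ, zfun T (u + (m + 1 : ℤ) * T) = zfun T (u + m * T) - 2 * Real.pi * I := by
    intro m
    rw [← zfun_add_period T (u := u + m * T)]
    · congr 1
      push_cast
      ring
    · rwa [add_mem_latt_iff T ⟨m, 0, by simp⟩]
  induction m using Int.induction_on with
  | zero => simp
  | succ i hi => rw [key, hi]; push_cast; ring
  | pred i hi =>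
    have := key (-i - 1)
    rw [sub_add_cancel, hi] at this
    push_cast at this ⊢
    linear_combination -this

lemma analyticAt_zfun (T : ℍ) {u : ℂ} (hu : u ∉ latt T) : AnalyticAt ℂ (zfun T) u := by
  have hd : DifferentiableOn ℂ (zfun T) (latt T)ᶜ := by
    intro v hv
    have hv' : -v ∉ latt T := by rwa [neg_mem_latt_iff]
    have h1 : DifferentiableAt ℂ (cotSum T) v := differentiableAt_cotSum T fun m ↦ by
      simpa using expTwoPi_ne_one_of_notMem hv m
    have h2 : DifferentiableAt ℂ (cotSum T) (-v) := differentiableAt_cotSum T fun m ↦ by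
      simpa using expTwoPi_ne_one_of_notMem hv' m
    have h3 : DifferentiableAt ℂ cotPlus v := differentiableAt_cotPlus (by
      simpa using expTwoPi_ne_one_of_notMem hv 0)
    have h4 : DifferentiableAt ℂ cotPlus (-v) := differentiableAt_cotPlus (by
      simpa using expTwoPi_ne_one_of_notMem hv' 0)
    have h5 : DifferentiableAt ℂ (fun v ↦ cotSum T (-v)) v := h2.comp v differentiableAt_id.neg
    have h6 : DifferentiableAt ℂ (fun v ↦ cotPlus (-v)) v := h4.comp v differentiableAt_id.neg
    exact ((h1.sub h5).sub ((h3.sub h6).div_const 2)).differentiableWithinAt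
  exact hd.analyticAt ((isOpen_compl_latt T).mem_nhds hu)

/-! ### Behaviour at the origin -/

/-- The analytic function `u (π cot(πu) + πi)` near the origin. -/
def cotNumerator (u : ℂ) : ℂ := 2 * Real.pi * I * expTwoPi u / dslope expTwoPi 0 u

lemma dslope_expTwoPi_zero : dslope expTwoPi 0 0 = 2 * Real.pi * I := by
  rw [dslope_same, (hasDerivAt_expTwoPi 0).deriv, expTwoPi_zero, mul_one]

lemma analyticAt_expTwoPi (u : ℂ) : AnalyticAt ℂ expTwoPi u :=
  differentiable_expTwoPi.analyticAt u

lemma analyticAt_dslope {f : ℂ → ℂ} {a : ℂ} (hf : AnalyticAt ℂ f a) :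
    AnalyticAt ℂ (dslope f a) a := by
  obtain ⟨s, hs, hd⟩ := hf.eventually_analyticAt.exists_mem
  have hd' : DifferentiableOn ℂ f s := fun x hx ↦ (hd x hx).differentiableAt.differentiableWithinAt
  exact ((Complex.differentiableOn_dslope hs).mpr hd').analyticAt hs

lemma analyticAt_cotNumerator : AnalyticAt ℂ cotNumerator 0 := by
  refine AnalyticAt.div ((analyticAt_const).mul (analyticAt_expTwoPi 0))
    (analyticAt_dslope (analyticAt_expTwoPi 0)) ?_
  rw [dslope_expTwoPi_zero]
  exact Complex.two_pi_I_ne_zero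

lemma cotNumerator_zero : cotNumerator 0 = 1 := by
  rw [cotNumerator, dslope_expTwoPi_zero, expTwoPi_zero, mul_one,
    div_self Complex.two_pi_I_ne_zero]

lemma cotPlus_eq_cotNumerator {u : ℂ} (hu : u ≠ 0) : cotPlus u = cotNumerator u / u := by
  rw [cotPlus, cotNumerator, dslope_of_ne _ hu, slope_def_field, expTwoPi_zero, sub_zero,
    ← neg_sub (expTwoPi u) 1]
  field_simp

/-- The regular part of `Z` at the origin, without the terms depending on the lattice. -/
def cotRegular (u : ℂ) : ℂ := dslope cotNumerator 0 u - Real.pi * I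

lemma cotPlus_eq_inv_add {u : ℂ} (hu : u ≠ 0) :
    cotPlus u = u⁻¹ + dslope cotNumerator 0 u := by
  rw [cotPlus_eq_cotNumerator hu, dslope_of_ne _ hu, slope_def_field, cotNumerator_zero]
  field_simp
  ring

/-- The regular part `Z(u) - 1/u` of `Z` at the origin. -/
def zreg (T : ℍ) (u : ℂ) : ℂ := cotRegular u + (cotSum T (T + u) - cotSum T (T - u))

lemma analyticAt_cotSum {T : ℍ} {u : ℂ} (hu : 0 < u.im) : AnalyticAt ℂ (cotSum T) u := by
  have hopen : IsOpen {v : ℂ | 0 < v.im} := isOpen_lt continuous_const continuous_im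
  refine DifferentiableOn.analyticAt (s := {v : ℂ | 0 < v.im}) (fun v hv ↦ ?_) (hopen.mem_nhds hu)
  refine (differentiableAt_cotSum T fun m h ↦ ?_).differentiableWithinAt
  obtain ⟨l, hl⟩ := expTwoPi_eq_one_iff.mp h
  have him := congrArg Complex.im hl
  simp only [add_im, mul_im, natCast_re, natCast_im, zero_mul, add_zero, intCast_im] at him
  have h1 : 0 ≤ (m : ℝ) * (T : ℂ).im := mul_nonneg (Nat.cast_nonneg _) T.im_pos.le
  have h2 : 0 < v.im := hv
  linarith

lemma analyticAt_cotRegular : AnalyticAt ℂ cotRegular 0 :=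
  (analyticAt_dslope analyticAt_cotNumerator).sub analyticAt_const

lemma analyticAt_cotSum_add (T : ℍ) : AnalyticAt ℂ (fun u ↦ cotSum T (T + u)) 0 :=
  AnalyticAt.fun_comp_of_eq (analyticAt_cotSum T.im_pos) (by fun_prop) (by simp)

lemma analyticAt_cotSum_sub (T : ℍ) : AnalyticAt ℂ (fun u ↦ cotSum T (T - u)) 0 :=
  AnalyticAt.fun_comp_of_eq (analyticAt_cotSum T.im_pos) (by fun_prop) (by simp)

lemma analyticAt_zreg (T : ℍ) : AnalyticAt ℂ (zreg T) 0 :=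
  analyticAt_cotRegular.add ((analyticAt_cotSum_add T).sub (analyticAt_cotSum_sub T))

lemma zfun_eq_inv_add_zreg (T : ℍ) {u : ℂ} (hu : u ∉ latt T) : zfun T u = u⁻¹ + zreg T u := by
  have hu0 : u ≠ 0 := fun h ↦ hu (h ▸ zero_mem_latt T)
  have h0 := cotPlus_add_neg (by simpa using expTwoPi_ne_one_of_notMem hu 0)
  have h1 := cotPlus_eq_inv_add hu0
  have h2 := cotSum_eq_add T u
  have h3 := cotSum_eq_add T (-u)
  rw [zfun, zreg, cotRegular, h2, h3, show -u + (T : ℂ) = T - u by ring,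
    show u + (T : ℂ) = T + u by ring]
  linear_combination h1 - (1 / 2) * h0

/-- For 0 < Im u < Im T both u and T − u lie in the upper half-plane, where `cotSum` is a Lambert
series; this form is the source of the growth estimates. -/
lemma zfun_eq_cotSum {T : ℍ} {u : ℂ} (hu : u ∉ latt T) :
    zfun T u = cotSum T u - cotSum T (T - u) - Real.pi * I := by
  have h0 := cotPlus_add_neg (by simpa using expTwoPi_ne_one_of_notMem hu 0)
  have h3 := cotSum_eq_add T (-u)
  rw [zfun, h3, show -u + (T : ℂ) = T - u by ring]
  linear_combination (-1 / 2) * h0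

/-! ### Doubly periodic functions without poles are constant -/

/-- A function that is doubly periodic and holomorphic off the lattice, with a removable
singularity at the origin, is constant. -/
lemma eq_const_of_doublyPeriodic {T : ℍ} {F ψ : ℂ → ℂ}
    (hd : ∀ u ∉ latt T, DifferentiableAt ℂ F u) (h1 : ∀ u ∉ latt T, F (u + 1) = F u)
    (hT : ∀ u ∉ latt T, F (u + T) = F u) (hψ : AnalyticAt ℂ ψ 0) (hF : F =ᶠ[𝓝[≠] 0] ψ)
    {u : ℂ} (hu : u ∉ latt T) : F u = ψ 0 := by
  classical
  -- The values of `F` at lattice points are arbitrary. Replacing all of them by the limit ψ 0 gives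
  -- an entire function with the full lattice of periods, bounded by its values on one
  -- parallelogram, so Liouville's theorem applies.
  let G : ℂ → ℂ := fun u ↦ if u ∈ latt T then ψ 0 else F u
  have hG1 : Function.Periodic G 1 := fun v ↦ by
    simp only [G, add_mem_latt_iff T (one_mem_latt T)]
    split_ifs with h
    · rfl
    · exact h1 v h
  have hGT : Function.Periodic G T := fun v ↦ by
    simp only [G, add_mem_latt_iff T (self_mem_latt T)]
    split_ifs with h
    · rfl
    · exact hT v h
  have hGl : ∀ m l : ℤ, Function.Periodic G (m * T + l) := fun m l ↦
    (hGT.int_mul m).add_period (by simpa using hG1.int_mul l)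
  have hG0 : DifferentiableAt ℂ G 0 := by
    refine hψ.differentiableAt.congr_of_eventuallyEq ?_
    have : G =ᶠ[𝓝[≠] 0] ψ := by
      filter_upwards [hF, eventually_notMem_latt T 0] with v hv hl
      simp only [G, hl, if_false, hv]
    have h0 : G 0 = ψ 0 := by simp only [G, zero_mem_latt, if_true]
    exact eventually_nhdsWithin_iff.mp this |>.mono fun v hv ↦ by
      by_cases h : v = 0
      · rw [h, h0]
      · exact hv h
  have hGd : Differentiable ℂ G := fun v ↦ by
    by_cases hv : v ∈ latt T
    · obtain ⟨m, l, rfl⟩ := hv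
      have : G = fun x ↦ G (x - (m * T + l)) := by
        funext x
        rw [(hGl m l).sub_eq]
      rw [this]
      refine DifferentiableAt.comp (g := G) _ ?_ (by fun_prop)
      simpa using hG0
    · refine (hd v hv).congr_of_eventuallyEq ?_
      filter_upwards [(isOpen_compl_latt T).mem_nhds hv] with x hx
      simp only [G, show x ∉ latt T from hx, if_false]
  have hb : Bornology.IsBounded (Set.range G) := by
    have hK : IsCompact ((fun p : ℝ × ℝ ↦ G (p.1 * T + p.2)) '' (Set.Icc 0 1 ×ˢ Set.Icc 0 1)) := by
      refine (isCompact_Icc.prod isCompact_Icc).image ?_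
      exact hGd.continuous.comp (by fun_prop)
    refine hK.isBounded.subset ?_
    rintro _ ⟨v, rfl⟩
    have him : (T : ℂ).im ≠ 0 := T.im_ne_zero
    let s : ℝ := v.im / (T : ℂ).im
    let t : ℝ := v.re - s * (T : ℂ).re
    have hv : v = s * T + t := by
      apply Complex.ext
      · simp [t]
      · simpa [s] using (div_mul_cancel₀ v.im him).symm
    refine ⟨(Int.fract s, Int.fract t), ⟨⟨Int.fract_nonneg _, (Int.fract_lt_one _).le⟩,
      ⟨Int.fract_nonneg _, (Int.fract_lt_one _).le⟩⟩, ?_⟩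
    have := hGl (-⌊s⌋) (-⌊t⌋) v
    simp only
    rw [← this]
    congr 1
    rw [hv, Int.fract, Int.fract]
    push_cast
    ring
  have := hGd.apply_eq_apply_of_bounded hb u 0
  simpa [G, hu, zero_mem_latt] using this

/-! ### Derivatives of `Z` -/

lemma iteratedDeriv_comp_mul_left (s : ℕ) (f : ℂ → ℂ) (c u : ℂ) :
    iteratedDeriv s (fun x ↦ f (c * x)) u = c ^ s * iteratedDeriv s f (c * u) := by
  induction s generalizing u with
  | zero => simp
  | succ s ih =>
    rw [iteratedDeriv_succ, iteratedDeriv_succ, funext ih, deriv_const_mul_field,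
      deriv_comp_mul_left, smul_eq_mul, pow_succ]
    ring

lemma iteratedDeriv_iteratedDeriv (k s : ℕ) (f : ℂ → ℂ) :
    iteratedDeriv k (iteratedDeriv s f) = iteratedDeriv (k + s) f := by
  simp only [iteratedDeriv_eq_iterate, Function.iterate_add_apply]

lemma analyticAt_iteratedDeriv {f : ℂ → ℂ} {u : ℂ} (hf : AnalyticAt ℂ f u) (s : ℕ) :
    AnalyticAt ℂ (iteratedDeriv s f) u := by
  rw [iteratedDeriv_eq_iterate]
  exact hf.iterated_deriv s

/-- The `s`-th derivative of `Z`. -/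
def zder (s : ℕ) (T : ℍ) (u : ℂ) : ℂ := iteratedDeriv s (zfun T) u

/-- The `s`-th derivative at the origin of the regular part of `Z`. -/
def zregder (s : ℕ) (T : ℍ) : ℂ := iteratedDeriv s (zreg T) 0

lemma analyticAt_zder (s : ℕ) {T : ℍ} {u : ℂ} (hu : u ∉ latt T) : AnalyticAt ℂ (zder s T) u :=
  analyticAt_iteratedDeriv (analyticAt_zfun T hu) s

lemma iteratedDeriv_zder (k s : ℕ) (T : ℍ) (u : ℂ) :
    iteratedDeriv k (zder s T) u = zder (k + s) T u :=
  congrFun (iteratedDeriv_iteratedDeriv k s (zfun T)) u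

lemma zder_neg (s : ℕ) (T : ℍ) (u : ℂ) : zder s T (-u) = (-1) ^ (s + 1) * zder s T u := by
  have h := iteratedDeriv_comp_neg s (zfun T) u
  rw [show (fun x ↦ zfun T (-x)) = fun x ↦ -zfun T x from funext (zfun_neg T),
    iteratedDeriv_fun_neg, smul_eq_mul] at h
  have h1 : ((-1 : ℂ) ^ s) * (-1) ^ s = 1 := by rw [← mul_pow]; simp
  simp only [zder]
  rw [pow_succ]
  linear_combination (-(-1 : ℂ) ^ s) * h - iteratedDeriv s (zfun T) (-u) * h1

lemma zder_add_int (s : ℕ) (T : ℍ) (u : ℂ) (l : ℤ) : zder s T (u + l) = zder s T u := by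
  have := congrFun (iteratedDeriv_comp_add_const (f := zfun T) (n := s) (s := (l : ℂ))) u
  rw [funext fun u ↦ zfun_add_int T u l] at this
  exact this.symm

lemma iteratedDeriv_fun_const' (s : ℕ) (c u : ℂ) :
    iteratedDeriv s (fun _ : ℂ ↦ c) u = if s = 0 then c else 0 := by
  rw [iteratedDeriv_const]

lemma zder_add_int_mul (s : ℕ) (T : ℍ) {u : ℂ} (hu : u ∉ latt T) (m : ℤ) :
    zder s T (u + m * T) = zder s T u - if s = 0 then 2 * Real.pi * I * m else 0 := by
  have h0 := congrFun (iteratedDeriv_comp_add_const (f := zfun T) (n := s) (s := (m * T : ℂ))) u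
  have h1 : (fun u ↦ zfun T (u + m * T)) =ᶠ[𝓝 u] fun u ↦ zfun T u - 2 * Real.pi * I * m := by
    filter_upwards [(isOpen_compl_latt T).mem_nhds hu] with v hv
    exact zfun_add_int_mul T hv m
  rw [h1.iteratedDeriv_eq s] at h0
  rw [zder, ← h0, zder, ← iteratedDeriv_fun_const']
  exact iteratedDeriv_sub (analyticAt_zfun T hu).contDiffAt contDiffAt_const

/-! ### The modular transformation -/

lemma mem_latt_of_div_mem {T T' : ℍ} {a b c d : ℤ} (hj : (c * T + d : ℂ) ≠ 0)
    (hT' : (T' : ℂ) = (a * T + b) / (c * T + d)) {u : ℂ}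
    (hu : (c * T + d : ℂ)⁻¹ * u ∈ latt T') : u ∈ latt T := by
  obtain ⟨m, l, h⟩ := hu
  refine ⟨m * a + l * c, m * b + l * d, ?_⟩
  rw [hT'] at h
  field_simp at h
  push_cast
  linear_combination h

/-- The difference `D` of the two sides is doubly periodic: 1/j = −cT' + a and T/j = dT' − b, so the
quasi-periods of Z at T' are compensated by those of jZ and by the linear term. The polar parts j/u
cancel, so `D` is constant, and being odd it vanishes. -/
lemma zfun_transform {T T' : ℍ} {a b c d : ℤ} (hdet : a * d - b * c = 1)
    (hj : (c * T + d : ℂ) ≠ 0) (hT' : (T' : ℂ) = (a * T + b) / (c * T + d)) {u : ℂ}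
    (hu : u ∉ latt T) :
    zfun T' ((c * T + d : ℂ)⁻¹ * u) = (c * T + d) * zfun T u + 2 * Real.pi * I * c * u := by
  set j : ℂ := c * T + d with hjdef
  have hdet' : (a : ℂ) * d - b * c = 1 := by exact_mod_cast hdet
  have hTj : (T' : ℂ) * j = a * T + b := by rw [hT']; field_simp
  let D : ℂ → ℂ := fun u ↦ zfun T' (j⁻¹ * u) - j * zfun T u - 2 * Real.pi * I * c * u
  let ψ : ℂ → ℂ := fun u ↦ zreg T' (j⁻¹ * u) - j * zreg T u - 2 * Real.pi * I * c * u
  have hmem : ∀ {v}, v ∉ latt T → j⁻¹ * v ∉ latt T' := fun hv h ↦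
    hv (mem_latt_of_div_mem hj hT' h)
  have hconst : ∀ v ∉ latt T, D v = ψ 0 := by
    intro v hv
    refine eq_const_of_doublyPeriodic (T := T) (F := D) (ψ := ψ) ?_ ?_ ?_ ?_ ?_ hv
    · intro v hv
      have h1 := (analyticAt_zfun T' (hmem hv)).differentiableAt
      have h2 := (analyticAt_zfun T hv).differentiableAt
      have h3 : DifferentiableAt ℂ (fun v ↦ zfun T' (j⁻¹ * v)) v :=
        DifferentiableAt.comp (g := zfun T') v h1 (by fun_prop)
      exact (h3.sub (h2.const_mul j)).sub (by fun_prop)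
    · intro v hv
      have h1 : j⁻¹ * (v + 1) = j⁻¹ * v + (-c : ℤ) * T' + a := by
        field_simp
        push_cast
        linear_combination c * hTj - hdet' - a * hjdef
      simp only [D]
      rw [h1, zfun_add_int, zfun_add_int_mul T' (hmem hv), zfun_add_one]
      push_cast
      ring
    · intro v hv
      have h1 : j⁻¹ * (v + T) = j⁻¹ * v + (d : ℤ) * T' + (-b : ℤ) := by
        field_simp
        push_cast
        linear_combination -d * hTj - T * hdet' + b * hjdef
      simp only [D]
      rw [h1, zfun_add_int, zfun_add_int_mul T' (hmem hv), zfun_add_period T hv]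
      linear_combination 2 * Real.pi * I * hjdef
    · have h1 : AnalyticAt ℂ (fun v ↦ zreg T' (j⁻¹ * v)) 0 :=
        AnalyticAt.fun_comp_of_eq (analyticAt_zreg T') (by fun_prop) (by simp)
      exact (h1.sub (analyticAt_const.mul (analyticAt_zreg T))).sub (by fun_prop)
    · filter_upwards [eventually_notMem_latt T 0] with v hv
      simp only [D, ψ]
      have hv0 : v ≠ 0 := fun h ↦ hv (h ▸ zero_mem_latt T)
      rw [zfun_eq_inv_add_zreg T' (hmem hv), zfun_eq_inv_add_zreg T hv]
      field_simp
      ring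
  have h1 := hconst u hu
  have h2 := hconst (-u) (by rwa [neg_mem_latt_iff])
  have h3 : D (-u) = -D u := by
    simp only [D, mul_neg, zfun_neg]
    ring
  have h4 : D u = 0 := by linear_combination (h1 - h2 + h3) / 2
  linear_combination h4

/-- Removing the common polar part j/u from `zfun_transform` leaves two functions analytic at 0,
which agree at 0 too by continuity. In this form the law can be differentiated at the origin and
yields that of the Laurent coefficients. -/
lemma zreg_transform {T T' : ℍ} {a b c d : ℤ} (hdet : a * d - b * c = 1)
    (hj : (c * T + d : ℂ) ≠ 0) (hT' : (T' : ℂ) = (a * T + b) / (c * T + d)) :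
    (fun u ↦ zreg T' ((c * T + d : ℂ)⁻¹ * u)) =ᶠ[𝓝 0]
      fun u ↦ (c * T + d) * zreg T u + 2 * Real.pi * I * c * u := by
  have hc : AnalyticAt ℂ (fun u ↦ zreg T' ((c * T + d : ℂ)⁻¹ * u)) 0 :=
    AnalyticAt.fun_comp_of_eq (analyticAt_zreg T') (by fun_prop) (by simp)
  have hc' : AnalyticAt ℂ
      (fun u : ℂ ↦ ((c * T + d) * zreg T u + 2 * Real.pi * I * c * u : ℂ)) 0 :=
    (analyticAt_const.mul (analyticAt_zreg T)).add (by fun_prop)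
  refine (ContinuousAt.eventuallyEq_nhds_iff_eventuallyEq_nhdsNE hc.continuousAt
    hc'.continuousAt).mp ?_
  filter_upwards [eventually_notMem_latt T 0] with v hv
  have hv0 : v ≠ 0 := fun h ↦ hv (h ▸ zero_mem_latt T)
  have h := zfun_transform hdet hj hT' hv
  rw [zfun_eq_inv_add_zreg T' fun h ↦ hv (mem_latt_of_div_mem hj hT' h),
    zfun_eq_inv_add_zreg T hv, mul_inv, inv_inv] at h
  linear_combination h

/-- The `s`-th derivative of the linear function `2πi c u`. -/
lemma iteratedDeriv_mul_linear (s : ℕ) (j κ u : ℂ) {f : ℂ → ℂ} (hf : AnalyticAt ℂ f u) :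
    iteratedDeriv s (fun u ↦ j * f u + κ * u) u =
      j * iteratedDeriv s f u + if s = 0 then κ * u else if s = 1 then κ else 0 := by
  have h1 : AnalyticAt ℂ (fun u ↦ j * f u) u := analyticAt_const.mul hf
  have h2 : AnalyticAt ℂ (fun u ↦ κ * u) u := by fun_prop
  have := iteratedDeriv_add (n := s) h1.contDiffAt h2.contDiffAt
  rw [show (fun u ↦ j * f u + κ * u) = (fun u ↦ j * f u) + fun u ↦ κ * u from rfl, this,
    iteratedDeriv_const_mul_field, iteratedDeriv_const_mul_field, iteratedDeriv_fun_id]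
  split_ifs <;> simp

lemma zder_transform (s : ℕ) {T T' : ℍ} {a b c d : ℤ} (hdet : a * d - b * c = 1)
    (hj : (c * T + d : ℂ) ≠ 0) (hT' : (T' : ℂ) = (a * T + b) / (c * T + d)) {u : ℂ}
    (hu : u ∉ latt T) :
    zder s T' ((c * T + d : ℂ)⁻¹ * u) = (c * T + d) ^ s * ((c * T + d) * zder s T u +
      if s = 0 then 2 * Real.pi * I * c * u else if s = 1 then 2 * Real.pi * I * c else 0) := by
  have h : (fun u ↦ zfun T' ((c * T + d : ℂ)⁻¹ * u)) =ᶠ[𝓝 u]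
      fun u ↦ (c * T + d) * zfun T u + 2 * Real.pi * I * c * u := by
    filter_upwards [(isOpen_compl_latt T).mem_nhds hu] with v hv
    exact zfun_transform hdet hj hT' hv
  have h1 := h.iteratedDeriv_eq s
  rw [iteratedDeriv_comp_mul_left, iteratedDeriv_mul_linear s _ _ _ (analyticAt_zfun T hu)] at h1
  rw [zder, zder, ← h1, ← mul_assoc, ← mul_pow, mul_inv_cancel₀ hj, one_pow, one_mul]

lemma zregder_transform (s : ℕ) {T T' : ℍ} {a b c d : ℤ} (hdet : a * d - b * c = 1)
    (hj : (c * T + d : ℂ) ≠ 0) (hT' : (T' : ℂ) = (a * T + b) / (c * T + d)) :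
    zregder s T' = (c * T + d) ^ s * ((c * T + d) * zregder s T +
      if s = 1 then 2 * Real.pi * I * c else 0) := by
  have h1 := (zreg_transform hdet hj hT').iteratedDeriv_eq s
  rw [iteratedDeriv_comp_mul_left, iteratedDeriv_mul_linear s _ _ _ (analyticAt_zreg T), mul_zero,
    mul_zero] at h1
  have h2 : (if s = 0 then (0 : ℂ) else if s = 1 then 2 * Real.pi * I * c else 0) =
      if s = 1 then 2 * Real.pi * I * c else 0 := by
    split_ifs with h0 h1 <;> simp_all
  rw [h2] at h1
  rw [zregder, zregder, ← h1, ← mul_assoc, ← mul_pow, mul_inv_cancel₀ hj, one_pow, one_mul]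

/-! ### The Weierstrass function -/

lemma weierstrassP_add_deriv_zfun (T : ℍ) :
    (fun u ↦ (periodPair T).weierstrassP u + deriv (zfun T) u) =ᶠ[𝓝[≠] 0]
      fun u ↦ (periodPair T).weierstrassPExcept 0 u + deriv (zreg T) u := by
  have hz : ∀ᶠ u in 𝓝[≠] (0 : ℂ), AnalyticAt ℂ (zreg T) u :=
    nhdsWithin_le_nhds (analyticAt_zreg T).eventually_analyticAt
  filter_upwards [eventually_notMem_latt T 0, hz] with u hu hz
  have hu0 : u ≠ 0 := fun h ↦ hu (h ▸ zero_mem_latt T)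
  have h1 : zfun T =ᶠ[𝓝 u] fun u ↦ u⁻¹ + zreg T u := by
    filter_upwards [(isOpen_compl_latt T).mem_nhds hu] with v hv using zfun_eq_inv_add_zreg T hv
  have h2 := (periodPair T).weierstrassPExcept_add 0 u
  rw [h1.deriv_eq, deriv_fun_add (differentiableAt_inv hu0) hz.differentiableAt, deriv_inv, ← h2]
  simp

lemma analyticAt_weierstrassPExcept_add (T : ℍ) :
    AnalyticAt ℂ (fun u ↦ (periodPair T).weierstrassPExcept 0 u + deriv (zreg T) u) 0 :=
  ((periodPair T).analyticAt_weierstrassPExcept 0).add (analyticAt_zreg T).deriv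

/-- Both ℘ and Z' are elliptic and their double poles cancel, so the sum is constant. The constant
is the value at the origin, where `weierstrassPExcept 0` vanishes and the derivative of `zreg`
remains. -/
lemma weierstrassP_eq (T : ℍ) {u : ℂ} (hu : u ∉ latt T) :
    (periodPair T).weierstrassP u + deriv (zfun T) u = zregder 1 T := by
  have hper : ∀ v ∈ latt T, ∀ u, (periodPair T).weierstrassP (u + v) =
      (periodPair T).weierstrassP u := fun v hv u ↦ by
    rw [latt_eq] at hv
    exact (periodPair T).weierstrassP_add_coe u ⟨v, hv⟩
  have hder := fun u ↦ zder_add_int 1 T u 1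
  simp only [zder, iteratedDeriv_one, Int.cast_one] at hder
  refine (eq_const_of_doublyPeriodic (fun v hv ↦ ?_) (fun v _ ↦ ?_) (fun v hv ↦ ?_)
    (analyticAt_weierstrassPExcept_add T) (weierstrassP_add_deriv_zfun T) hu).trans ?_
  · refine DifferentiableAt.add ?_ (analyticAt_zfun T hv).deriv.differentiableAt
    refine (periodPair T).differentiableOn_weierstrassP.differentiableAt ?_
    rw [← latt_eq]
    exact (isOpen_compl_latt T).mem_nhds hv
  · rw [hper 1 (one_mem_latt T), hder]
  · have := zder_add_int_mul 1 T hv 1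
    simp only [zder, iteratedDeriv_one, Int.cast_one, one_mul] at this
    rw [hper T (self_mem_latt T), this]
    simp
  · simp [zregder]

lemma wp_eq (s : ℕ) (T : ℍ) {u : ℂ} (hu : u ∉ latt T) :
    wp s u T = -zder (s + 1) T u + if s = 0 then zregder 1 T else 0 := by
  have h : (periodPair T).weierstrassP =ᶠ[𝓝 u] fun v ↦ zregder 1 T - deriv (zfun T) v := by
    filter_upwards [(isOpen_compl_latt T).mem_nhds hu] with v hv
    exact eq_sub_of_add_eq (weierstrassP_eq T hv)
  have h1 : iteratedDeriv s (fun v ↦ zregder 1 T - deriv (zfun T) v) u =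
      (if s = 0 then zregder 1 T else 0) - iteratedDeriv s (deriv (zfun T)) u := by
    rw [← iteratedDeriv_fun_const']
    exact iteratedDeriv_sub contDiffAt_const (analyticAt_zfun T hu).deriv.contDiffAt
  rw [wp, h.iteratedDeriv_eq s, h1, zder, iteratedDeriv_succ']
  ring

/-- The Laurent coefficients of `Z` at the origin are Eisenstein series. -/
lemma G_eq_zregder (s : ℕ) (hs : s ≠ 0) (T : ℍ) :
    (periodPair T).G (s + 2) = -((s + 1).factorial : ℂ)⁻¹ * zregder (s + 1) T := by
  have h : (fun u ↦ (periodPair T).weierstrassPExcept 0 u + deriv (zreg T) u) =ᶠ[𝓝 0]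
      fun _ ↦ zregder 1 T := by
    refine (ContinuousAt.eventuallyEq_nhds_iff_eventuallyEq_nhdsNE
      (analyticAt_weierstrassPExcept_add T).continuousAt continuousAt_const).mp ?_
    filter_upwards [weierstrassP_add_deriv_zfun T, eventually_notMem_latt T 0] with v hv hl
    rw [← hv, weierstrassP_eq T hl]
  have h1 := h.iteratedDeriv_eq s
  have h2 : iteratedDeriv s (fun u ↦ (periodPair T).weierstrassPExcept 0 u + deriv (zreg T) u) 0 =
      iteratedDeriv s ((periodPair T).weierstrassPExcept 0) 0 +
        iteratedDeriv s (deriv (zreg T)) 0 :=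
    iteratedDeriv_add ((periodPair T).analyticAt_weierstrassPExcept 0).contDiffAt
      (analyticAt_zreg T).deriv.contDiffAt
  rw [h2, iteratedDeriv_fun_const', if_neg hs, PeriodPair.iteratedDeriv_weierstrassPExcept_self,
    if_neg hs, PeriodPair.sumInvPow_zero, ← iteratedDeriv_succ'] at h1
  have h3 : ((s + 1).factorial : ℂ) ≠ 0 := by exact_mod_cast (s + 1).factorial_ne_zero
  rw [zregder]
  field_simp
  linear_combination h1

/-! ### The classes of holomorphic functions -/

/-- The two classes of holomorphic functions used to define quasi-modular forms. -/
def IsFormClass (𝒪 : Set (ℍ → ℂ)) : Prop :=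
  𝒪 = holomorphicFunctions ∨ 𝒪 = moderateHolomorphicFunctions

/-- The function that bounds the growth of moderate functions is at least one. -/
lemma one_le_growth (τ : ℍ) : 1 ≤ (1 + ‖(τ : ℂ)‖ ^ 2) / τ.im := by
  rw [one_le_div τ.im_pos]
  have h : τ.im ≤ ‖(τ : ℂ)‖ := (le_abs_self _).trans (Complex.abs_im_le_norm (τ : ℂ))
  nlinarith [sq_nonneg (‖(τ : ℂ)‖ - 1), norm_nonneg (τ : ℂ)]

lemma inv_im_le_growth (τ : ℍ) : τ.im⁻¹ ≤ (1 + ‖(τ : ℂ)‖ ^ 2) / τ.im := by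
  rw [inv_eq_one_div]
  have := τ.im_pos
  gcongr
  nlinarith [norm_nonneg (τ : ℂ)]

namespace IsFormClass

variable {𝒪 : Set (ℍ → ℂ)}

lemma of_moderate (h𝒪 : IsFormClass 𝒪) {f : ℍ → ℂ} (hf : f ∈ moderateHolomorphicFunctions) :
    f ∈ 𝒪 := by
  rcases h𝒪 with rfl | rfl
  · exact hf.1
  · exact hf

lemma const (h𝒪 : IsFormClass 𝒪) (c : ℂ) : (fun _ ↦ c) ∈ 𝒪 :=
  h𝒪.of_moderate ⟨mdifferentiable_const, ‖c‖, 0, fun τ ↦ by simp⟩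

lemma add (h𝒪 : IsFormClass 𝒪) {f g : ℍ → ℂ} (hf : f ∈ 𝒪) (hg : g ∈ 𝒪) :
    (fun τ ↦ f τ + g τ) ∈ 𝒪 := by
  rcases h𝒪 with rfl | rfl
  · exact MDifferentiable.add hf hg
  · obtain ⟨hf, C, M, hC⟩ := hf
    obtain ⟨hg, C', M', hC'⟩ := hg
    refine ⟨MDifferentiable.add hf hg, |C| + |C'|, M + M', fun τ ↦ ?_⟩
    have h1 := one_le_growth τ
    have h0 : 0 ≤ (1 + ‖(τ : ℂ)‖ ^ 2) / τ.im := zero_le_one.trans h1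
    refine (norm_add_le _ _).trans ?_
    rw [add_mul]
    refine add_le_add ((hC τ).trans ?_) ((hC' τ).trans ?_)
    · exact mul_le_mul (le_abs_self C) (pow_le_pow_right₀ h1 (by omega)) (pow_nonneg h0 _)
        (abs_nonneg C)
    · exact mul_le_mul (le_abs_self C') (pow_le_pow_right₀ h1 (by omega)) (pow_nonneg h0 _)
        (abs_nonneg C')

lemma mul (h𝒪 : IsFormClass 𝒪) {f g : ℍ → ℂ} (hf : f ∈ 𝒪) (hg : g ∈ 𝒪) :
    (fun τ ↦ f τ * g τ) ∈ 𝒪 := by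
  rcases h𝒪 with rfl | rfl
  · exact MDifferentiable.mul hf hg
  · obtain ⟨hf, C, M, hC⟩ := hf
    obtain ⟨hg, C', M', hC'⟩ := hg
    refine ⟨MDifferentiable.mul hf hg, C * C', M + M', fun τ ↦ ?_⟩
    rw [norm_mul, pow_add, mul_mul_mul_comm]
    exact mul_le_mul (hC τ) (hC' τ) (norm_nonneg _) ((norm_nonneg _).trans (hC τ))

lemma sum (h𝒪 : IsFormClass 𝒪) {ι : Type*} (s : Finset ι) {f : ι → ℍ → ℂ}
    (hf : ∀ i ∈ s, f i ∈ 𝒪) : (fun τ ↦ ∑ i ∈ s, f i τ) ∈ 𝒪 := by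
  classical
  induction s using Finset.induction_on with
  | empty => simpa using h𝒪.const 0
  | insert a s ha ih =>
    simp only [Finset.sum_insert ha]
    exact h𝒪.add (hf a (Finset.mem_insert_self a s))
      (ih fun i hi ↦ hf i (Finset.mem_insert_of_mem hi))

end IsFormClass

/-- A series of entire functions whose terms are bounded on `Im z ≥ y` by the terms of a convergent
series divided by a power of `y` defines a function of moderate growth. -/
lemma tsum_mem_moderate {ι : Type*} {f : ι → ℂ → ℂ} {a : ι → ℝ} (ha : Summable a) (s : ℕ)
    (hf : ∀ i, Differentiable ℂ (f i))
    (hb : ∀ i (y : ℝ) (z : ℂ), 0 < y → y ≤ z.im → ‖f i z‖ ≤ a i / y ^ s) :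
    (fun τ : ℍ ↦ ∑' i, f i τ) ∈ moderateHolomorphicFunctions := by
  refine ⟨?_, |∑' i, a i|, s, fun τ ↦ ?_⟩
  · rw [UpperHalfPlane.mdifferentiable_iff]
    have hd : DifferentiableOn ℂ (fun z ↦ ∑' i, f i z) {z : ℂ | 0 < z.im} := by
      intro z hz
      have hz' : 0 < z.im := hz
      have hopen : IsOpen {v : ℂ | z.im / 2 < v.im} := isOpen_lt continuous_const continuous_im
      refine ((differentiableOn_tsum_of_summable_norm (ha.div_const ((z.im / 2) ^ s))
        (fun i ↦ (hf i).differentiableOn) hopen fun i w hw ↦ ?_).differentiableAt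
          (hopen.mem_nhds ?_)).differentiableWithinAt
      · exact hb i _ w (half_pos hz') (le_of_lt hw)
      · exact half_lt_self hz'
    refine hd.congr fun z hz ↦ ?_
    simp [UpperHalfPlane.ofComplex_apply_of_im_pos hz]
  · have hle := fun i ↦ hb i τ.im τ τ.im_pos le_rfl
    have h1 : ‖∑' i, f i τ‖ ≤ (∑' i, a i) / τ.im ^ s := by
      rw [← tsum_div_const]
      exact tsum_of_norm_bounded (ha.div_const _).hasSum hle
    refine h1.trans ?_
    rw [div_eq_mul_inv, ← inv_pow]
    have h2 := inv_im_le_growth τ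
    have h3 := inv_nonneg.mpr τ.im_pos.le
    exact mul_le_mul (le_abs_self _) (pow_le_pow_left₀ h3 h2 s) (pow_nonneg h3 s) (abs_nonneg _)

/-- Exponential decay dominates polynomial growth, with an explicit dependence on `y`. -/
lemma pow_mul_exp_le (s : ℕ) {a b y : ℝ} (ha : 1 ≤ a) (hb : 1 ≤ b) (hy : 0 < y) :
    a ^ s * Real.exp (-(2 * Real.pi * (a * b * y))) ≤
      (s + 2).factorial * ((a ^ 2)⁻¹ * (b ^ 2)⁻¹) / y ^ (s + 2) := by
  have ha0 : 0 < a := by linarith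
  have hb0 : 0 < b := by linarith
  have hx : 0 ≤ a * b * y := by positivity
  -- The exponent s + 2 beats a^s by a factor a^{-2} and leaves at least b^{-2}, so the bound is
  -- summable over two indices.
  have h1 := Real.pow_div_factorial_le_exp (a * b * y) hx (s + 2)
  have h2 : Real.exp (a * b * y) ≤ Real.exp (2 * Real.pi * (a * b * y)) :=
    Real.exp_le_exp.mpr (by nlinarith [Real.pi_gt_three])
  have h3 : 0 < (a * b * y) ^ (s + 2) / ((s + 2).factorial : ℝ) := by positivity
  have h4 : Real.exp (-(2 * Real.pi * (a * b * y))) ≤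
      (s + 2).factorial / (a * b * y) ^ (s + 2) := by
    rw [Real.exp_neg, ← inv_div]
    exact inv_anti₀ h3 (h1.trans h2)
  calc a ^ s * Real.exp (-(2 * Real.pi * (a * b * y)))
      ≤ a ^ s * ((s + 2).factorial / (a * b * y) ^ (s + 2)) := by gcongr
    _ = (s + 2).factorial * ((a ^ 2)⁻¹ * (b ^ (s + 2))⁻¹) / y ^ (s + 2) := by
      rw [mul_pow, mul_pow, pow_add a]
      field_simp
    _ ≤ _ := by
      gcongr
      · omega

/-! ### Lambert series -/

/-- The terms of the double series `∑ d^s e(d(u + mT))` over `m ≥ 0`, `d ≥ 1`. -/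
def lambertTerm (s : ℕ) (T u : ℂ) (p : ℕ × ℕ) : ℂ :=
  ((p.2 : ℂ) + 1) ^ s * expTwoPi ((p.2 + 1) * (u + p.1 * T))

lemma summable_lambert_bound (s : ℕ) : Summable fun p : ℕ × ℕ ↦
    ((s + 2).factorial : ℝ) * ((((p.2 : ℝ) + 1) ^ 2)⁻¹ * (((p.1 : ℝ) + 1) ^ 2)⁻¹) := by
  have h : Summable fun m : ℕ ↦ (((m : ℝ) + 1) ^ 2)⁻¹ := by
    have := (summable_nat_add_iff 1).mpr (Real.summable_nat_pow_inv.mpr one_lt_two)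
    exact_mod_cast this
  refine Summable.mul_left _ ?_
  refine (h.mul_of_nonneg h (fun _ ↦ by positivity) (fun _ ↦ by positivity)).congr fun p ↦ ?_
  simp only [mul_comm]

lemma norm_lambertTerm_le (s : ℕ) {T u : ℂ} {y : ℝ} (hy : 0 < y) (hT : y ≤ T.im) (hu : y ≤ u.im)
    (p : ℕ × ℕ) : ‖lambertTerm s T u p‖ ≤
      (s + 2).factorial * ((((p.2 : ℝ) + 1) ^ 2)⁻¹ * (((p.1 : ℝ) + 1) ^ 2)⁻¹) / y ^ (s + 2) := by
  refine le_trans ?_ (pow_mul_exp_le s (a := p.2 + 1) (b := p.1 + 1)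
    (by linarith [Nat.cast_nonneg (α := ℝ) p.2]) (by linarith [Nat.cast_nonneg (α := ℝ) p.1]) hy)
  rw [lambertTerm, norm_mul, norm_pow, norm_expTwoPi]
  have h1 : ‖(p.2 : ℂ) + 1‖ = (p.2 : ℝ) + 1 := by
    exact_mod_cast Complex.norm_natCast (p.2 + 1)
  have h2 : (((p.2 : ℂ) + 1) * (u + p.1 * T)).im = (p.2 + 1) * (u.im + p.1 * T.im) := by
    simp
  rw [h1, h2]
  gcongr ?_ * ?_
  apply Real.exp_le_exp.mpr
  have h3 : ((p.1 : ℝ) + 1) * y ≤ u.im + p.1 * T.im := by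
    nlinarith [mul_le_mul_of_nonneg_left hT (Nat.cast_nonneg (α := ℝ) p.1)]
  have h4 := mul_le_mul_of_nonneg_left h3 (show (0 : ℝ) ≤ p.2 + 1 by positivity)
  nlinarith [Real.pi_pos, mul_le_mul_of_nonneg_left h4 (show 0 ≤ 2 * Real.pi by positivity)]

lemma summable_lambertTerm (s : ℕ) {T u : ℂ} (hT : 0 < T.im) (hu : 0 < u.im) :
    Summable (lambertTerm s T u) := by
  refine .of_norm_bounded ((summable_lambert_bound s).div_const (min T.im u.im ^ (s + 2)))
    fun p ↦ ?_
  exact norm_lambertTerm_le s (lt_min hT hu) (min_le_left _ _) (min_le_right _ _) p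

/-- The double series `∑ d^s e(d(u + mT))` over `m ≥ 0`, `d ≥ 1`. -/
def lambert (s : ℕ) (T u : ℂ) : ℂ := ∑' p, lambertTerm s T u p

lemma hasDerivAt_lambertTerm (s : ℕ) (T u : ℂ) (p : ℕ × ℕ) :
    HasDerivAt (fun u ↦ lambertTerm s T u p) (2 * Real.pi * I * lambertTerm (s + 1) T u p) u := by
  have h1 : HasDerivAt (fun u : ℂ ↦ ((p.2 : ℂ) + 1) * (u + p.1 * T)) ((p.2 : ℂ) + 1) u := by
    simpa using ((hasDerivAt_id u).add_const (p.1 * T : ℂ)).const_mul ((p.2 : ℂ) + 1)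
  have h2 := ((hasDerivAt_expTwoPi _).comp u h1).const_mul (((p.2 : ℂ) + 1) ^ s)
  refine h2.congr_deriv ?_
  rw [lambertTerm, pow_succ]
  ring

lemma deriv_lambert (s : ℕ) {T u : ℂ} (hT : 0 < T.im) (hu : 0 < u.im) :
    deriv (lambert s T) u = 2 * Real.pi * I * lambert (s + 1) T u := by
  have hy : 0 < min T.im (u.im / 2) := lt_min hT (half_pos hu)
  have hopen : IsOpen {v : ℂ | u.im / 2 < v.im} := isOpen_lt continuous_const continuous_im
  have h := hasSum_deriv_of_summable_norm (F := fun p u ↦ lambertTerm s T u p)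
    (z := u) ((summable_lambert_bound s).div_const
      (min T.im (u.im / 2) ^ (s + 2))) (U := {v : ℂ | u.im / 2 < v.im})
    (fun p v _ ↦ (hasDerivAt_lambertTerm s T v p).differentiableAt.differentiableWithinAt)
    hopen (fun p v hv ↦ norm_lambertTerm_le s hy (min_le_left _ _)
      ((min_le_right _ _).trans (le_of_lt hv)) p) (half_lt_self hu)
  simp only [(hasDerivAt_lambertTerm s T u _).deriv] at h
  exact h.unique ((summable_lambertTerm (s + 1) hT hu).hasSum.mul_left _)

lemma cotPlus_eq_tsum {u : ℂ} (hu : ‖expTwoPi u‖ < 1) :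
    cotPlus u = ∑' d : ℕ, -(2 * Real.pi * I) * expTwoPi ((d + 1) * u) := by
  have h : ∀ d : ℕ, expTwoPi ((d + 1) * u) = expTwoPi u * expTwoPi u ^ d := fun d ↦ by
    rw [← pow_succ', ← expTwoPi_nat_mul]
    push_cast
    rfl
  simp only [h]
  rw [tsum_mul_left, tsum_mul_left, tsum_geometric_of_norm_lt_one hu, cotPlus, div_eq_mul_inv]

lemma cotSum_eq_lambert {T : ℍ} {u : ℂ} (hu : 0 < u.im) :
    cotSum T u = -(2 * Real.pi * I) * lambert 0 T u := by
  have hs := summable_lambertTerm 0 T.im_pos hu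
  rw [lambert, ← tsum_mul_left, (hs.mul_left _).tsum_prod, cotSum]
  refine tsum_congr fun m ↦ ?_
  have hpos : 0 < (u + m * T).im := by
    simp only [add_im, mul_im, natCast_re, natCast_im, zero_mul, add_zero]
    have := mul_nonneg (Nat.cast_nonneg (α := ℝ) m) T.im_pos.le
    exact add_pos_of_pos_of_nonneg hu this
  rw [cotPlus_eq_tsum (norm_expTwoPi_lt_one ⟨_, hpos⟩)]
  simp [lambertTerm]

lemma iteratedDeriv_cotSum (s : ℕ) {T : ℍ} {u : ℂ} (hu : 0 < u.im) :
    iteratedDeriv s (cotSum T) u =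
      -(2 * Real.pi * I) * (2 * Real.pi * I) ^ s * lambert s T u := by
  induction s generalizing u with
  | zero => simpa using cotSum_eq_lambert hu
  | succ s ih =>
    have hopen : IsOpen {v : ℂ | 0 < v.im} := isOpen_lt continuous_const continuous_im
    have h : iteratedDeriv s (cotSum T) =ᶠ[𝓝 u]
        fun u ↦ -(2 * Real.pi * I) * (2 * Real.pi * I) ^ s * lambert s T u := by
      filter_upwards [hopen.mem_nhds hu] with v hv using ih hv
    rw [iteratedDeriv_succ, h.deriv_eq, deriv_const_mul_field, deriv_lambert s T.im_pos hu,
      pow_succ]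
    ring

lemma natMul_coe (n : ℕ) [NeZero n] (τ : ℍ) : ((natMul n τ : ℍ) : ℂ) = n * τ := rfl

lemma natMul_im (n : ℕ) [NeZero n] (τ : ℍ) : (natMul n τ).im = n * τ.im := by
  change ((n : ℂ) * τ).im = _
  simp

lemma lambert_mem_moderate (s n k : ℕ) [NeZero n] (hk : k ≠ 0) :
    (fun τ : ℍ ↦ lambert s (natMul n τ) (k * τ)) ∈ moderateHolomorphicFunctions := by
  refine tsum_mem_moderate (f := fun p z ↦ lambertTerm s (n * z) (k * z) p)
    (summable_lambert_bound s) (s + 2) (fun p ↦ ?_) fun p y z hy hz ↦ ?_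
  · unfold lambertTerm
    have := differentiable_expTwoPi
    fun_prop
  · have him : ∀ m : ℕ, m ≠ 0 → y ≤ ((m : ℂ) * z).im := fun m hm ↦ by
      have : (1 : ℝ) ≤ m := by exact_mod_cast Nat.one_le_iff_ne_zero.mpr hm
      simp only [mul_im, natCast_re, natCast_im, zero_mul, add_zero]
      nlinarith
    exact norm_lambertTerm_le s hy (him n (NeZero.ne n)) (him k hk) p

/-- The derivatives of the one-sided cotangent sum at multiples of `τ` have moderate growth. -/
lemma IsFormClass.iteratedDeriv_cotSum_mem {𝒪 : Set (ℍ → ℂ)} (h𝒪 : IsFormClass 𝒪) (s n k : ℕ)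
    [NeZero n] (hk : k ≠ 0) :
    (fun τ : ℍ ↦ iteratedDeriv s (cotSum (natMul n τ)) (k * τ)) ∈ 𝒪 := by
  have h : (fun τ : ℍ ↦ iteratedDeriv s (cotSum (natMul n τ)) (k * τ)) = fun τ : ℍ ↦
      -(2 * Real.pi * I) * (2 * Real.pi * I) ^ s * lambert s (natMul n τ) (k * τ) := by
    funext τ
    refine iteratedDeriv_cotSum s ?_
    have : (0 : ℝ) < k := by exact_mod_cast Nat.pos_of_ne_zero hk
    simpa using mul_pos this τ.im_pos
  rw [h]
  exact h𝒪.mul (h𝒪.const _) (h𝒪.of_moderate (lambert_mem_moderate s n k hk))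

lemma iteratedDeriv_const_sub' (s : ℕ) (f : ℂ → ℂ) (a u : ℂ) :
    iteratedDeriv s (fun x ↦ f (a - x)) u = (-1) ^ s * iteratedDeriv s f (a - u) := by
  have := congrFun (iteratedDeriv_comp_const_sub (f := f) (n := s) (s := a)) u
  simpa using this

lemma zregder_eq (s : ℕ) (T : ℍ) : zregder s T = iteratedDeriv s cotRegular 0 +
    (1 - (-1) ^ s) * iteratedDeriv s (cotSum T) T := by
  have h1 := (analyticAt_cotSum_add T).contDiffAt (n := s)
  have h2 := (analyticAt_cotSum_sub T).contDiffAt (n := s)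
  have h3 := congrFun (iteratedDeriv_comp_const_add (f := cotSum T) (n := s) (s := (T : ℂ))) 0
  have h4 := iteratedDeriv_const_sub' s (cotSum T) T 0
  have h5 : iteratedDeriv s (zreg T) 0 = iteratedDeriv s cotRegular 0 +
      (iteratedDeriv s (fun u ↦ cotSum T (T + u)) 0 -
        iteratedDeriv s (fun u ↦ cotSum T (T - u)) 0) := by
    rw [← iteratedDeriv_fun_sub h1 h2]
    exact iteratedDeriv_add analyticAt_cotRegular.contDiffAt (h1.sub h2)
  rw [zregder, h5, h3, h4, add_zero, sub_zero]
  ring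

lemma zder_eq_cotSum (s : ℕ) {T : ℍ} {u : ℂ} (h0 : 0 < u.im) (h1 : u.im < T.im) :
    zder s T u = iteratedDeriv s (cotSum T) u - (-1) ^ s * iteratedDeriv s (cotSum T) (T - u) -
      if s = 0 then Real.pi * I else 0 := by
  have hu : u ∉ latt T := notMem_latt_of_im 0 (by simpa using h0) (by simpa using h1)
  have h : zfun T =ᶠ[𝓝 u] fun v ↦ (cotSum T v - cotSum T (T - v)) - Real.pi * I := by
    filter_upwards [(isOpen_compl_latt T).mem_nhds hu] with v hv using zfun_eq_cotSum hv
  have ha : AnalyticAt ℂ (cotSum T) u := analyticAt_cotSum h0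
  have hb : AnalyticAt ℂ (fun v ↦ cotSum T (T - v)) u :=
    AnalyticAt.fun_comp_of_eq (analyticAt_cotSum (u := T - u)
      (by simpa using h1)) (by fun_prop) rfl
  rw [zder, h.iteratedDeriv_eq s, iteratedDeriv_fun_sub (ha.fun_sub hb).contDiffAt contDiffAt_const,
    iteratedDeriv_fun_sub ha.contDiffAt hb.contDiffAt, iteratedDeriv_fun_const',
    iteratedDeriv_const_sub']

lemma IsFormClass.zregder_mem {𝒪 : Set (ℍ → ℂ)} (h𝒪 : IsFormClass 𝒪) (s n : ℕ) [NeZero n] :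
    (fun τ : ℍ ↦ zregder s (natMul n τ)) ∈ 𝒪 := by
  simp only [zregder_eq]
  exact h𝒪.add (h𝒪.const _) (h𝒪.mul (h𝒪.const _)
    (h𝒪.iteratedDeriv_cotSum_mem s n n (NeZero.ne n)))

/-- For 0 < k < n both kτ and nτ − kτ = (n − k)τ lie in the upper half-plane, so the value is a
combination of two Lambert series and a constant. -/
lemma IsFormClass.zder_mem {𝒪 : Set (ℍ → ℂ)} (h𝒪 : IsFormClass 𝒪) (s n k : ℕ) [NeZero n]
    (hk : k ≠ 0) (hkn : k < n) : (fun τ : ℍ ↦ zder s (natMul n τ) (k * τ)) ∈ 𝒪 := by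
  have hk0 : (0 : ℝ) < k := by exact_mod_cast Nat.pos_of_ne_zero hk
  have hkn' : (k : ℝ) < n := by exact_mod_cast hkn
  have h : (fun τ : ℍ ↦ zder s (natMul n τ) (k * τ)) = fun τ : ℍ ↦
      (iteratedDeriv s (cotSum (natMul n τ)) (k * τ) +
        -(-1) ^ s * iteratedDeriv s (cotSum (natMul n τ)) ((n - k : ℕ) * τ)) +
      -if s = 0 then Real.pi * I else 0 := by
    funext τ
    rw [zder_eq_cotSum s (u := k * τ)]
    · rw [natMul_coe, Nat.cast_sub hkn.le, sub_mul]
      ring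
    · simpa using mul_pos hk0 τ.im_pos
    · rw [natMul_im]
      simpa using mul_lt_mul_of_pos_right hkn' τ.im_pos
  rw [h]
  refine h𝒪.add (h𝒪.add (h𝒪.iteratedDeriv_cotSum_mem s n k hk) ?_) (h𝒪.const _)
  exact h𝒪.mul (h𝒪.const _) (h𝒪.iteratedDeriv_cotSum_mem s n (n - k) (by omega))

/-! ### Quasi-modular forms -/

section QuasiModular

variable {𝒪 : Set (ℍ → ℂ)} {Γ : Subgroup SL(2, ℤ)}

lemma cocycle_ne_zero (γ : SL(2, ℤ)) (τ : ℍ) : ((γ 1 0 : ℂ) * τ + (γ 1 1 : ℂ)) ≠ 0 := by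
  rw [← ModularGroup.denom_apply]
  exact UpperHalfPlane.denom_ne_zero (γ : GL (Fin 2) ℝ) τ

lemma coe_smul_eq (γ : SL(2, ℤ)) (τ : ℍ) : ((γ • τ : ℍ) : ℂ) =
    ((γ 0 0 : ℂ) * τ + (γ 0 1 : ℂ)) / ((γ 1 0 : ℂ) * τ + (γ 1 1 : ℂ)) := by
  rw [UpperHalfPlane.coe_specialLinearGroup_apply]
  simp

/-- A function whose transformation law involves `c / (cτ+d)` to the first power at most. -/
lemma isQuasiModular_of_transform (h𝒪 : IsFormClass 𝒪) {w : ℤ} {f : ℍ → ℂ} (κ : ℂ) (hf : f ∈ 𝒪)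
    (h : ∀ γ ∈ Γ, ∀ τ : ℍ, ((γ 1 0 : ℂ) * τ + (γ 1 1 : ℂ)) ^ (-w) * f (γ • τ) =
      f τ + κ * ((γ 1 0 : ℂ) / ((γ 1 0 : ℂ) * τ + (γ 1 1 : ℂ)))) :
    IsQuasiModular 𝒪 Γ w f := by
  refine ⟨1, fun i ↦ if i = 0 then f else fun _ ↦ κ, by simp, fun i _ ↦ ?_, fun γ hγ τ ↦ ?_⟩
  · dsimp only
    split_ifs
    · exact hf
    · exact h𝒪.const κ
  · rw [h γ hγ τ]
    simp [Finset.sum_range_succ]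

lemma isQuasiModular_const (h𝒪 : IsFormClass 𝒪) (c : ℂ) : IsQuasiModular 𝒪 Γ 0 fun _ ↦ c :=
  isQuasiModular_of_transform h𝒪 0 (h𝒪.const c) fun γ _ τ ↦ by simp

/-- The associated functions at τ are the coefficients of a polynomial whose value at c/(cτ + d) is
the transformed form. Multiplying forms multiplies these polynomials. -/
lemma IsQuasiModular.mul (h𝒪 : IsFormClass 𝒪) {a b : ℤ} {f g : ℍ → ℂ}
    (hf : IsQuasiModular 𝒪 Γ a f) (hg : IsQuasiModular 𝒪 Γ b g) :
    IsQuasiModular 𝒪 Γ (a + b) (f * g) := by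
  obtain ⟨p, f', rfl, hf1, hf2⟩ := hf
  obtain ⟨q, g', rfl, hg1, hg2⟩ := hg
  let P : ℕ → (ℕ → ℍ → ℂ) → ℍ → Polynomial ℂ := fun p f τ ↦
    ∑ i ∈ Finset.range (p + 1), Polynomial.C (f i τ) * Polynomial.X ^ i
  have hcoeff : ∀ p f τ i, (P p f τ).coeff i = if i ∈ Finset.range (p + 1) then f i τ else 0 := by
    intro p f τ i
    simp [P, Polynomial.finsetSum_coeff, Polynomial.coeff_C_mul, Polynomial.coeff_X_pow]
  have heval : ∀ p f τ x, (P p f τ).eval x = ∑ i ∈ Finset.range (p + 1), f i τ * x ^ i := by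
    intro p f τ x
    simp [P, Polynomial.eval_finsetSum]
  have hdeg : ∀ p f τ, (P p f τ).natDegree ≤ p := by
    intro p f τ
    rw [Polynomial.natDegree_le_iff_coeff_eq_zero]
    intro N hN
    rw [hcoeff, if_neg (by simpa using hN)]
  have hmem : ∀ p f, (∀ i ≤ p, f i ∈ 𝒪) → ∀ i, (fun τ ↦ (P p f τ).coeff i) ∈ 𝒪 := by
    intro p f hf i
    simp only [hcoeff]
    split_ifs with h
    · exact hf i (by simpa [Nat.lt_succ_iff] using h)
    · exact h𝒪.const 0
  refine ⟨p + q, fun i τ ↦ (P p f' τ * P q g' τ).coeff i, ?_, fun i _ ↦ ?_, fun γ hγ τ ↦ ?_⟩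
  · funext τ
    simp [Polynomial.mul_coeff_zero, hcoeff]
  · simp only [Polynomial.coeff_mul]
    exact h𝒪.sum _ fun x _ ↦ h𝒪.mul (hmem p f' hf1 x.1) (hmem q g' hg1 x.2)
  · rw [← Polynomial.eval_eq_sum_range' (n := p + q + 1), Polynomial.eval_mul, heval, heval,
      ← hf2 γ hγ τ, ← hg2 γ hγ τ, neg_add, zpow_add₀ (cocycle_ne_zero γ τ), Pi.mul_apply]
    · ring
    · refine Nat.lt_succ_of_le (Polynomial.natDegree_mul_le.trans ?_)
      exact add_le_add (hdeg p f' τ) (hdeg q g' τ)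

lemma QModLE.mono {a b : ℤ} (hab : a ≤ b) : QModLE 𝒪 Γ a ≤ QModLE 𝒪 Γ b :=
  Submodule.span_mono fun _ ⟨w, hw, h⟩ ↦ ⟨w, hw.trans hab, h⟩

lemma IsQuasiModular.mem_QModLE {w : ℤ} {f : ℍ → ℂ} (h : IsQuasiModular 𝒪 Γ w f) :
    f ∈ QModLE 𝒪 Γ w :=
  Submodule.subset_span ⟨w, le_rfl, h⟩

lemma const_mem_QModLE (h𝒪 : IsFormClass 𝒪) (c : ℂ) : (fun _ ↦ c) ∈ QModLE 𝒪 Γ 0 :=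
  (isQuasiModular_const h𝒪 c).mem_QModLE

lemma mul_mem_QModLE (h𝒪 : IsFormClass 𝒪) {a b : ℤ} {f g : ℍ → ℂ} (hf : f ∈ QModLE 𝒪 Γ a)
    (hg : g ∈ QModLE 𝒪 Γ b) : f * g ∈ QModLE 𝒪 Γ (a + b) := by
  have h : QModLE 𝒪 Γ a * QModLE 𝒪 Γ b ≤ QModLE 𝒪 Γ (a + b) := by
    rw [QModLE, QModLE, Submodule.span_mul_span, Submodule.span_le]
    rintro _ ⟨f, ⟨v, hv, hf⟩, g, ⟨w, hw, hg⟩, rfl⟩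
    exact Submodule.subset_span ⟨v + w, add_le_add hv hw, hf.mul h𝒪 hg⟩
  exact h (Submodule.mul_mem_mul hf hg)

end QuasiModular

/-! ### Level structure -/

/-- For `γ ∈ Γ₁(n)` the action on `nτ`, and its integrality properties. -/
lemma natMul_smul {n : ℕ} [NeZero n] {γ : SL(2, ℤ)} (hγ : γ ∈ CongruenceSubgroup.Gamma1 n) :
    ∃ a' c' : ℤ, γ 0 0 = 1 + n * a' ∧ γ 1 0 = n * c' ∧
      γ 0 0 * γ 1 1 - (n * γ 0 1) * c' = 1 ∧ ∀ τ : ℍ,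
        (c' * natMul n τ + γ 1 1 : ℂ) = (γ 1 0 : ℂ) * τ + (γ 1 1 : ℂ) ∧
        ((natMul n (γ • τ) : ℍ) : ℂ) = ((γ 0 0 : ℤ) * natMul n τ + (n * γ 0 1 : ℤ)) /
          (c' * natMul n τ + γ 1 1) := by
  obtain ⟨ha, -, hc⟩ := (CongruenceSubgroup.Gamma1_mem n γ).mp hγ
  obtain ⟨c', hc'⟩ := (ZMod.intCast_zmod_eq_zero_iff_dvd _ _).mp hc
  have ha0 : ((γ 0 0 - 1 : ℤ) : ZMod n) = 0 := by push_cast; rw [ha, sub_self]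
  obtain ⟨a', ha'⟩ := (ZMod.intCast_zmod_eq_zero_iff_dvd _ _).mp ha0
  have hdet := Matrix.det_fin_two γ.1
  rw [γ.2] at hdet
  have hcocycle : ∀ τ : ℍ, (c' * natMul n τ + γ 1 1 : ℂ) = (γ 1 0 : ℂ) * τ + (γ 1 1 : ℂ) := by
    intro τ
    rw [natMul_coe, hc']
    push_cast
    ring
  refine ⟨a', c', by linarith, hc', ?_, fun τ ↦ ⟨hcocycle τ, ?_⟩⟩
  · rw [hc'] at hdet
    linarith
  · rw [hcocycle, natMul_coe, coe_smul_eq, natMul_coe]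
    push_cast
    ring

section Level

variable {𝒪 : Set (ℍ → ℂ)} (n : ℕ) [NeZero n]

lemma zpow_neg_mul_pow {j : ℂ} (hj : j ≠ 0) (s : ℕ) (x y : ℂ) :
    j ^ (-((s : ℤ) + 1)) * (j ^ s * (j * x + y)) = x + y / j := by
  rw [zpow_neg, ← Nat.cast_succ, zpow_natCast, pow_succ]
  field_simp

lemma isQuasiModular_zregder (h𝒪 : IsFormClass 𝒪) (s : ℕ) :
    IsQuasiModular 𝒪 (CongruenceSubgroup.Gamma1 n) (s + 1) fun τ ↦ zregder s (natMul n τ) := by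
  -- γ acts on nτ through the matrix with rows (a, nb) and (c/n, d), so the anomaly 2πi·(c/n) of the
  -- case s = 1 is (2πi/n)·c.
  refine isQuasiModular_of_transform h𝒪 (if s = 1 then 2 * Real.pi * I / n else 0)
    (h𝒪.zregder_mem s n) fun γ hγ τ ↦ ?_
  obtain ⟨a', c', -, hc, hdet, h⟩ := natMul_smul hγ
  obtain ⟨hj, hT⟩ := h τ
  have hj0 := cocycle_ne_zero γ τ
  rw [zregder_transform s hdet (by rwa [hj]) hT, hj, zpow_neg_mul_pow hj0, hc]
  have hn : (n : ℂ) ≠ 0 := Nat.cast_ne_zero.mpr (NeZero.ne n)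
  split_ifs
  · push_cast
    field_simp
  · ring

lemma zregder_mem_QModLE (h𝒪 : IsFormClass 𝒪) (s : ℕ) :
    (fun τ ↦ zregder s (natMul n τ)) ∈ QModLE 𝒪 (CongruenceSubgroup.Gamma1 n) (s + 1) :=
  (isQuasiModular_zregder n h𝒪 s).mem_QModLE

variable {n} in
lemma mul_notMem_latt {k : ℤ} (hk : ¬ (n : ℤ) ∣ k) (τ : ℍ) : (k * τ : ℂ) ∉ latt (natMul n τ) := by
  rintro ⟨m, l, h⟩
  have him := congrArg Complex.im h
  rw [im_mem_latt, natMul_im] at him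
  have h1 : ((k : ℝ) - m * n) * τ.im = 0 := by
    simp only [mul_im, intCast_re, intCast_im, zero_mul, add_zero] at him
    rw [UpperHalfPlane.coe_im] at him
    linarith
  have h2 := (mul_eq_zero.mp h1).resolve_right τ.im_ne_zero
  apply hk
  refine ⟨m, ?_⟩
  have : (k : ℝ) = n * m := by linarith
  exact_mod_cast this

variable {n} in
lemma IsFormClass.zder_int_mem (h𝒪 : IsFormClass 𝒪) (s : ℕ) {k : ℤ} (hk : ¬ (n : ℤ) ∣ k) :
    (fun τ : ℍ ↦ zder s (natMul n τ) (k * τ)) ∈ 𝒪 := by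
  have hn : (0 : ℤ) < n := by exact_mod_cast NeZero.pos n
  obtain ⟨r, hr⟩ := Int.eq_ofNat_of_zero_le (Int.emod_nonneg k hn.ne')
  have hr0 : r ≠ 0 := by
    rintro rfl
    exact hk (Int.dvd_of_emod_eq_zero hr)
  have hrn : r < n := by
    have := Int.emod_lt_of_pos k hn
    omega
  have hkr : k = r + n * (k / n) := by
    rw [← hr]
    exact (Int.emod_add_mul_ediv k n).symm
  have hrd : ¬ (n : ℤ) ∣ (r : ℤ) := fun h ↦ by
    have := Int.le_of_dvd (by omega) h
    omega
  have h : (fun τ : ℍ ↦ zder s (natMul n τ) (k * τ)) = fun τ : ℍ ↦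
      zder s (natMul n τ) (r * τ) + -(if s = 0 then 2 * Real.pi * I * (k / n : ℤ) else 0) := by
    funext τ
    have := zder_add_int_mul s (natMul n τ) (mul_notMem_latt hrd τ) (k / n)
    rw [← sub_eq_add_neg]
    simp only [Int.cast_natCast] at this
    rw [← this]
    congr 1
    conv_lhs => rw [hkr]
    rw [natMul_coe]
    push_cast
    ring
  rw [h]
  exact h𝒪.add (h𝒪.zder_mem s n r hr0 hrn) (h𝒪.const _)

variable {n} in
-- Since a = 1 + na', the point k·γτ is 1/(cτ + d) times kτ plus an element of ℤ + ℤnτ: the torsion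
-- point is preserved. For s = 0 the translation and the linear term of `zfun_transform` leave
-- constants, which the summand 2πik/n absorbs. It is the value at u = kτ, T = nτ of 2πi Im u / Im
-- T, the correction that makes Z doubly periodic.
lemma isQuasiModular_zder (h𝒪 : IsFormClass 𝒪) (s : ℕ) {k : ℤ} (hk : ¬ (n : ℤ) ∣ k) :
    IsQuasiModular 𝒪 (CongruenceSubgroup.Gamma1 n) (s + 1) fun τ ↦
      zder s (natMul n τ) (k * τ) + if s = 0 then 2 * Real.pi * I * k / n else 0 := by
  refine isQuasiModular_of_transform h𝒪 (if s = 1 then 2 * Real.pi * I / n else 0)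
    (h𝒪.add (h𝒪.zder_int_mem s hk) (h𝒪.const _)) fun γ hγ τ ↦ ?_
  obtain ⟨a', c', ha, hc, hdet, h⟩ := natMul_smul hγ
  obtain ⟨hj, hT⟩ := h τ
  have hj0 := cocycle_ne_zero γ τ
  have hn : (n : ℂ) ≠ 0 := Nat.cast_ne_zero.mpr (NeZero.ne n)
  have hu := mul_notMem_latt hk τ
  have hmem : ((k * a' : ℤ) * natMul n τ + (k * γ 0 1 : ℤ) : ℂ) ∈ latt (natMul n τ) := ⟨_, _, rfl⟩
  have hv : (k * τ + ((k * a' : ℤ) * natMul n τ + (k * γ 0 1 : ℤ)) : ℂ) ∉ latt (natMul n τ) := by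
    rwa [add_mem_latt_iff _ hmem]
  have hcoe : (k * (γ • τ : ℍ) : ℂ) = (c' * natMul n τ + γ 1 1 : ℂ)⁻¹ *
      (k * τ + ((k * a' : ℤ) * natMul n τ + (k * γ 0 1 : ℤ))) := by
    rw [hj, coe_smul_eq, natMul_coe, ha]
    push_cast
    field_simp
    ring
  have hz : zder s (natMul n τ) (k * τ + ((k * a' : ℤ) * natMul n τ + (k * γ 0 1 : ℤ))) =
      zder s (natMul n τ) (k * τ) - if s = 0 then 2 * Real.pi * I * (k * a' : ℤ) else 0 := by
    rw [← add_assoc, zder_add_int, zder_add_int_mul s _ hu]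
  rw [hcoe, zder_transform s hdet (by rwa [hj]) hT hv, hz, hj]
  rcases s with _ | s
  · simp only [if_true, pow_zero, one_mul, Nat.cast_zero, zero_add, zero_ne_one, if_false, zero_mul,
      add_zero, zpow_neg_one]
    have ha1 : (γ 0 0 : ℂ) = 1 + n * a' := by exact_mod_cast congrArg (Int.cast : ℤ → ℂ) ha
    have hc1 : (γ 1 0 : ℂ) = n * c' := by exact_mod_cast congrArg (Int.cast : ℤ → ℂ) hc
    have hdet1 : (γ 0 0 : ℂ) * γ 1 1 - (n * γ 0 1) * c' = 1 := by exact_mod_cast hdet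
    rw [ha1] at hdet1
    rw [hc1] at hj0 ⊢
    rw [natMul_coe]
    push_cast
    field_simp
    linear_combination -(2 * Real.pi * I * k) * hdet1
  · have h1 : ∀ x y : ℂ, (if s + 1 = 0 then x else y) = y := fun x y ↦ if_neg (by omega)
    simp only [h1, sub_zero, add_zero]
    rw [zpow_neg_mul_pow hj0, hc]
    split_ifs
    · push_cast
      field_simp
    · ring

variable {n} in
-- For s = 0 the value is a form of weight 1 minus a constant of weight 0, so only a bound on the
-- weight is available.
lemma zder_mem_QModLE (h𝒪 : IsFormClass 𝒪) (s : ℕ) {k : ℤ} (hk : ¬ (n : ℤ) ∣ k) :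
    (fun τ : ℍ ↦ zder s (natMul n τ) (k * τ)) ∈
      QModLE 𝒪 (CongruenceSubgroup.Gamma1 n) (s + 1) := by
  have h := (isQuasiModular_zder h𝒪 s hk).mem_QModLE
  have h0 : (fun _ : ℍ ↦ (if s = 0 then 2 * Real.pi * I * k / n else 0 : ℂ)) ∈
      QModLE 𝒪 (CongruenceSubgroup.Gamma1 n) (s + 1) :=
    QModLE.mono (by omega) (const_mem_QModLE h𝒪 _)
  convert Submodule.sub_mem _ h h0 using 1
  funext τ
  simp

end Level

/-! ### The Eisenstein series of level one -/

section LevelOne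

variable {𝒪 : Set (ℍ → ℂ)}

lemma gamma1_one : CongruenceSubgroup.Gamma1 1 = ⊤ := by
  ext γ
  simp only [CongruenceSubgroup.Gamma1_mem, Subgroup.mem_top, iff_true]
  exact ⟨Subsingleton.elim _ _, Subsingleton.elim _ _, Subsingleton.elim _ _⟩

lemma natMul_one (τ : ℍ) : natMul 1 τ = τ := by
  apply UpperHalfPlane.ext
  rw [natMul_coe]
  simp

lemma isQuasiModular_G (h𝒪 : IsFormClass 𝒪) (s : ℕ) (hs : s ≠ 0) :
    IsQuasiModular 𝒪 (CongruenceSubgroup.Gamma1 1) (s + 2) fun τ ↦ (periodPair τ).G (s + 2) := by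
  have h := (isQuasiModular_const (Γ := CongruenceSubgroup.Gamma1 1) h𝒪
    (-((s + 1).factorial : ℂ)⁻¹)).mul h𝒪 (isQuasiModular_zregder 1 h𝒪 (s + 1))
  convert h using 1
  · push_cast
    ring
  · funext τ
    rw [Pi.mul_apply, natMul_one, G_eq_zregder s hs]

lemma G2_mem_moderate : EisensteinSeries.G2 ∈ moderateHolomorphicFunctions := by
  have h : EisensteinSeries.G2 = fun τ : ℍ ↦ 2 * riemannZeta 2 + -(8 * Real.pi ^ 2) *
      ∑' d : ℕ+, (ArithmeticFunction.sigma 1 d : ℂ) * expTwoPi (d * τ) := by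
    funext τ
    rw [EisensteinSeries.G2_eq_tsum_cexp, sub_eq_add_neg, neg_mul]
    simp only [expTwoPi_nat_mul]
    simp [expTwoPi]
  have hsum : Summable fun d : ℕ+ ↦ ((2 + 2).factorial : ℝ) * (((d : ℝ) ^ 2)⁻¹ * (1 ^ 2)⁻¹) := by
    refine Summable.mul_left _ (Summable.mul_right _ ?_)
    exact (Real.summable_nat_pow_inv.mpr one_lt_two).comp_injective PNat.coe_injective
  have hclass : IsFormClass moderateHolomorphicFunctions := Or.inr rfl
  rw [h]
  refine hclass.add (hclass.const _) (hclass.mul (hclass.const _) ?_)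
  refine tsum_mem_moderate hsum (f := fun (d : ℕ+) z ↦
    (ArithmeticFunction.sigma 1 d : ℂ) * expTwoPi (d * z)) (2 + 2) (fun d ↦ ?_)
    fun d y z hy hz ↦ ?_
  · exact (differentiable_expTwoPi.comp (differentiable_id.const_mul _)).const_mul _
  · have hd : (1 : ℝ) ≤ (d : ℕ) := by exact_mod_cast d.pos
    -- The exponent 2 comes from σ₁(d) ≤ d²; there is a single summation index, whence b = 1.
    refine le_trans ?_ (pow_mul_exp_le 2 hd le_rfl hy)
    rw [norm_mul, norm_expTwoPi, Complex.norm_natCast]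
    have h1 : ((ArithmeticFunction.sigma 1 d : ℕ) : ℝ) ≤ ((d : ℕ) : ℝ) ^ 2 := by
      exact_mod_cast ArithmeticFunction.sigma_le_pow_succ 1 d
    have h2 : ((d : ℂ) * z).im = (d : ℕ) * z.im := by simp
    rw [h2, mul_one]
    gcongr

lemma isQuasiModular_G2 (h𝒪 : IsFormClass 𝒪) (Γ : Subgroup SL(2, ℤ)) :
    IsQuasiModular 𝒪 Γ 2 EisensteinSeries.G2 := by
  refine isQuasiModular_of_transform h𝒪 (-(2 * Real.pi * I)) (h𝒪.of_moderate G2_mem_moderate)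
    fun γ _ τ ↦ ?_
  have h := congrFun (EisensteinSeries.G2_slash_action γ) τ
  rw [ModularForm.SL_slash_apply, Pi.sub_apply, EisensteinSeries.D2,
    ModularGroup.denom_apply] at h
  rw [mul_comm, h]
  ring

end LevelOne

/-! ### The ring generated by `Z` -/

/-- The generators of the ring of quasi-periodic functions: the quasi-modular forms for `Γ₁(n)` and
the functions `Z^{(s)}(z_i - z_j - kτ; nτ)`, with their weights. -/
inductive ZGen (𝒪 : Set (ℍ → ℂ)) (n : ℕ) [NeZero n] (N : ℕ) :
    ℤ → ((Fin N → ℂ) → ℍ → ℂ) → Prop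
  | qmod (w : ℤ) (h : ℍ → ℂ) (hh : IsQuasiModular 𝒪 (CongruenceSubgroup.Gamma1 n) w h) :
      ZGen 𝒪 n N w (fun _ τ => h τ)
  | z (i j : Fin N) (hij : i ≠ j) (s : ℕ) (k : ℤ) :
      ZGen 𝒪 n N (s + 1) (fun z τ => zder s (natMul n τ) (z i - z j - k * τ))

/-- The span of the products of generators of total weight at most `w`. -/
def zRing (𝒪 : Set (ℍ → ℂ)) (n : ℕ) [NeZero n] (N : ℕ) (w : ℤ) :
    Submodule ℂ ((Fin N → ℂ) → ℍ → ℂ) :=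
  Submodule.span ℂ {f | ∃ l : List (ℤ × ((Fin N → ℂ) → ℍ → ℂ)),
    (∀ x ∈ l, ZGen 𝒪 n N x.1 x.2) ∧ (l.map Prod.fst).sum ≤ w ∧ (l.map Prod.snd).prod = f}

section ZRing

variable {𝒪 : Set (ℍ → ℂ)} {n : ℕ} [NeZero n] {N : ℕ}

lemma zRing_mono {a b : ℤ} (hab : a ≤ b) : zRing 𝒪 n N a ≤ zRing 𝒪 n N b :=
  Submodule.span_mono fun _ ⟨l, h1, h2, h3⟩ ↦ ⟨l, h1, h2.trans hab, h3⟩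

lemma mul_mem_zRing {a b : ℤ} {f g : (Fin N → ℂ) → ℍ → ℂ} (hf : f ∈ zRing 𝒪 n N a)
    (hg : g ∈ zRing 𝒪 n N b) : f * g ∈ zRing 𝒪 n N (a + b) := by
  have h : zRing 𝒪 n N a * zRing 𝒪 n N b ≤ zRing 𝒪 n N (a + b) := by
    rw [zRing, zRing, Submodule.span_mul_span, Submodule.span_le]
    rintro _ ⟨_, ⟨l, h1, h2, rfl⟩, _, ⟨l', h1', h2', rfl⟩, rfl⟩
    refine Submodule.subset_span ⟨l ++ l', fun x hx ↦ ?_, ?_, ?_⟩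
    · exact (List.mem_append.mp hx).elim (h1 x) (h1' x)
    · simpa using add_le_add h2 h2'
    · simp
  exact h (Submodule.mul_mem_mul hf hg)

lemma one_mem_zRing : (1 : (Fin N → ℂ) → ℍ → ℂ) ∈ zRing 𝒪 n N 0 :=
  Submodule.subset_span ⟨[], by simp, by simp, by simp⟩

lemma const_mem_zRing (c : ℂ) : (fun _ _ ↦ c : (Fin N → ℂ) → ℍ → ℂ) ∈ zRing 𝒪 n N 0 := by
  have := Submodule.smul_mem _ c (one_mem_zRing (𝒪 := 𝒪) (n := n) (N := N))
  convert this using 1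
  funext z τ
  simp

lemma ZGen.mem {w : ℤ} {f : (Fin N → ℂ) → ℍ → ℂ} (h : ZGen 𝒪 n N w f) : f ∈ zRing 𝒪 n N w :=
  Submodule.subset_span ⟨[(w, f)], by simpa using h, by simp, by simp⟩

lemma pow_mem_zRing {a : ℤ} {f : (Fin N → ℂ) → ℍ → ℂ} (hf : f ∈ zRing 𝒪 n N a) (k : ℕ) :
    f ^ k ∈ zRing 𝒪 n N (k * a) := by
  induction k with
  | zero => simpa using one_mem_zRing
  | succ k ih =>
    rw [pow_succ]
    have := mul_mem_zRing ih hf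
    rwa [show (k : ℤ) * a + a = ((k + 1 : ℕ) : ℤ) * a by push_cast; ring] at this

lemma mem_zRing_of_mem_QModLE {w : ℤ} {h : ℍ → ℂ}
    (hh : h ∈ QModLE 𝒪 (CongruenceSubgroup.Gamma1 n) w) :
    (fun _ τ ↦ h τ : (Fin N → ℂ) → ℍ → ℂ) ∈ zRing 𝒪 n N w := by
  induction hh using Submodule.span_induction with
  | mem f hf =>
    obtain ⟨w', hw', hf⟩ := hf
    exact zRing_mono hw' (ZGen.qmod w' f hf).mem
  | zero => exact Submodule.zero_mem _
  | add f g _ _ hf hg => exact Submodule.add_mem _ hf hg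
  | smul c f _ hf => exact Submodule.smul_mem _ c hf

/-- Induction over the ring: a property that is linear and stable under multiplication by
generators holds for all elements. -/
theorem zRing_induction {P : ℤ → ((Fin N → ℂ) → ℍ → ℂ) → Prop} (one : P 0 1)
    (zero : ∀ w, P w 0) (add : ∀ w f g, P w f → P w g → P w (f + g))
    (smul : ∀ w (c : ℂ) f, P w f → P w (c • f)) (mono : ∀ a b f, a ≤ b → P a f → P b f)
    (gen_mul : ∀ a g, ZGen 𝒪 n N a g → ∀ b f, P b f → P (a + b) (g * f))
    {w : ℤ} {f : (Fin N → ℂ) → ℍ → ℂ} (hf : f ∈ zRing 𝒪 n N w) : P w f := by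
  induction hf using Submodule.span_induction with
  | mem f hf =>
    obtain ⟨l, h1, h2, rfl⟩ := hf
    refine mono _ _ _ h2 ?_
    clear h2
    induction l with
    | nil => simpa using one
    | cons x l ih =>
      simp only [List.map_cons, List.sum_cons, List.prod_cons]
      exact gen_mul _ _ (h1 x (by simp)) _ _ (ih fun y hy ↦ h1 y (by simp [hy]))
  | zero => exact zero w
  | add f g _ _ hf hg => exact add w f g hf hg
  | smul c f _ hf => exact smul w c f hf

end ZRing

/-! ### Points off the diagonals -/

/-- The points of `ℂ^N` whose differences do not lie in the lattice `ℤ + ℤτ`. -/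
def OffDiagonal {N : ℕ} (z : Fin N → ℂ) (τ : ℍ) : Prop :=
  ∀ i j, i ≠ j → z i - z j ∉ latt τ

lemma latt_natMul_subset (n : ℕ) [NeZero n] (τ : ℍ) : latt (natMul n τ) ⊆ latt τ := by
  rintro _ ⟨m, l, rfl⟩
  exact ⟨m * n, l, by rw [natMul_coe]; push_cast; ring⟩

lemma int_mul_mem_latt (k : ℤ) (τ : ℍ) : (k * τ : ℂ) ∈ latt τ := ⟨k, 0, by simp⟩

lemma sub_int_mul_notMem {n : ℕ} [NeZero n] {τ : ℍ} {u : ℂ} (hu : u ∉ latt τ) (k : ℤ) :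
    u - k * τ ∉ latt (natMul n τ) := by
  intro h
  apply hu
  have := latt_natMul_subset n τ h
  rw [sub_eq_add_neg, add_mem_latt_iff τ ((neg_mem_latt_iff τ).mpr (int_mul_mem_latt k τ))] at this
  exact this

lemma offDiagonal_cons {N : ℕ} {z : Fin N → ℂ} {τ : ℍ} {v : ℂ} :
    OffDiagonal (Fin.cons v z : Fin (N + 1) → ℂ) τ ↔
      (∀ j, v - z j ∉ latt τ) ∧ OffDiagonal z τ := by
  constructor
  · refine fun h ↦ ⟨fun j ↦ by simpa using h 0 j.succ (Fin.succ_ne_zero j).symm, fun i j hij ↦ ?_⟩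
    simpa using h i.succ j.succ (by simpa using hij)
  · rintro ⟨h1, h2⟩ i j hij
    induction i using Fin.cases with
    | zero =>
      induction j using Fin.cases with
      | zero => exact absurd rfl hij
      | succ j => simpa using h1 j
    | succ i =>
      induction j using Fin.cases with
      | zero =>
        have := h1 i
        rw [← neg_mem_latt_iff, neg_sub] at this
        simpa using this
      | succ j => simpa using h2 i j (by simpa using hij)

/-! ### Laurent expansions with coefficients in the ring -/

/-- A family of functions of `u` with a pole of order at most `M` at the origin whose Laurent
coefficients lie in the ring, the coefficient of `u^k` having weight at most `w + k`. -/
def HasLaurent (𝒪 : Set (ℍ → ℂ)) (n : ℕ) [NeZero n] {N : ℕ} (M : ℕ) (w : ℤ)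
    (g : (Fin N → ℂ) → ℍ → ℂ → ℂ) : Prop :=
  -- The coefficients are elements of the ring chosen before the point (z, τ); only φ depends on it.
  -- As a derivative, `d m` is m! times the coefficient of u^(m − M).
  ∃ d : ℕ → (Fin N → ℂ) → ℍ → ℂ, (∀ m : ℕ, d m ∈ zRing 𝒪 n N (w - M + m)) ∧
    ∀ z τ, OffDiagonal z τ → ∃ φ : ℂ → ℂ, AnalyticAt ℂ φ 0 ∧
      (∀ m, iteratedDeriv m φ 0 = d m z τ) ∧ ∀ᶠ u in 𝓝[≠] 0, g z τ u = (u ^ M)⁻¹ * φ u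

section Laurent

variable {𝒪 : Set (ℍ → ℂ)} {n : ℕ} [NeZero n] {N : ℕ}

lemma HasLaurent.congr {M : ℕ} {w : ℤ} {g g' : (Fin N → ℂ) → ℍ → ℂ → ℂ}
    (hg : HasLaurent 𝒪 n M w g)
    (h : ∀ z τ, OffDiagonal z τ → ∀ᶠ u in 𝓝[≠] 0, g' z τ u = g z τ u) :
    HasLaurent 𝒪 n M w g' := by
  obtain ⟨d, h1, h2⟩ := hg
  refine ⟨d, h1, fun z τ hz ↦ ?_⟩
  obtain ⟨φ, hφ, h3, h4⟩ := h2 z τ hz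
  refine ⟨φ, hφ, h3, ?_⟩
  filter_upwards [h4, h z τ hz] with u hu hu'
  rw [hu', hu]

lemma HasLaurent.mono {M : ℕ} {w w' : ℤ} {g : (Fin N → ℂ) → ℍ → ℂ → ℂ}
    (hg : HasLaurent 𝒪 n M w g) (hw : w ≤ w') : HasLaurent 𝒪 n M w' g := by
  obtain ⟨d, h1, h2⟩ := hg
  exact ⟨d, fun m ↦ zRing_mono (by omega) (h1 m), h2⟩

lemma HasLaurent.mul {M M' : ℕ} {w w' : ℤ} {g g' : (Fin N → ℂ) → ℍ → ℂ → ℂ}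
    (hg : HasLaurent 𝒪 n M w g) (hg' : HasLaurent 𝒪 n M' w' g') :
    HasLaurent 𝒪 n (M + M') (w + w') fun z τ u ↦ g z τ u * g' z τ u := by
  obtain ⟨d, h1, h2⟩ := hg
  obtain ⟨d', h1', h2'⟩ := hg'
  refine ⟨fun m ↦ ∑ i ∈ Finset.range (m + 1), (m.choose i : ℂ) • (d i * d' (m - i)),
    fun m ↦ Submodule.sum_mem _ fun i hi ↦ Submodule.smul_mem _ _ ?_, fun z τ hz ↦ ?_⟩
  · have him : i ≤ m := by simpa [Nat.lt_succ_iff] using hi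
    refine zRing_mono ?_ (mul_mem_zRing (h1 i) (h1' (m - i)))
    push_cast [Nat.cast_sub him]
    omega
  · obtain ⟨φ, hφ, h3, h4⟩ := h2 z τ hz
    obtain ⟨φ', hφ', h3', h4'⟩ := h2' z τ hz
    refine ⟨φ * φ', hφ.mul hφ', fun m ↦ ?_, ?_⟩
    · rw [iteratedDeriv_mul hφ.contDiffAt hφ'.contDiffAt]
      simp only [h3, h3', Finset.sum_apply, Pi.smul_apply, Pi.mul_apply, smul_eq_mul, mul_assoc]
    · filter_upwards [h4, h4'] with u hu hu'
      rw [hu, hu', pow_add, mul_inv, Pi.mul_apply]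
      ring

/-- Writing 1 as u^{-M}·u^M allows the declared pole order to be raised, so that expansions of
different orders can be added. -/
lemma hasLaurent_one (M : ℕ) : HasLaurent 𝒪 n M 0 (fun _ _ _ ↦ 1 :
    (Fin N → ℂ) → ℍ → ℂ → ℂ) := by
  refine ⟨fun m _ _ ↦ if m = M then (M.factorial : ℂ) else 0, fun m ↦ ?_, fun z τ _ ↦
    ⟨fun u ↦ u ^ M, by fun_prop, fun m ↦ by
      rw [iteratedDeriv_fun_pow_zero]; push_cast; rfl, ?_⟩⟩
  · by_cases hm : m = M
    · simp only [hm, if_true]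
      exact zRing_mono (by omega) (const_mem_zRing _)
    · simp only [hm, if_false]
      exact Submodule.zero_mem _
  · filter_upwards [self_mem_nhdsWithin] with u hu
    rw [inv_mul_cancel₀ (pow_ne_zero _ hu)]

lemma HasLaurent.raise {M M' : ℕ} {w : ℤ} {g : (Fin N → ℂ) → ℍ → ℂ → ℂ}
    (hg : HasLaurent 𝒪 n M w g) (h : M ≤ M') : HasLaurent 𝒪 n M' w g := by
  have := hg.mul (hasLaurent_one (M' - M))
  rw [Nat.add_sub_cancel' h, add_zero] at this
  simpa using this

lemma HasLaurent.add {M M' : ℕ} {w : ℤ} {g g' : (Fin N → ℂ) → ℍ → ℂ → ℂ}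
    (hg : HasLaurent 𝒪 n M w g) (hg' : HasLaurent 𝒪 n M' w g') :
    HasLaurent 𝒪 n (max M M') w fun z τ u ↦ g z τ u + g' z τ u := by
  obtain ⟨d, h1, h2⟩ := hg.raise (le_max_left M M')
  obtain ⟨d', h1', h2'⟩ := hg'.raise (le_max_right M M')
  refine ⟨fun m ↦ d m + d' m, fun m ↦ Submodule.add_mem _ (h1 m) (h1' m), fun z τ hz ↦ ?_⟩
  obtain ⟨φ, hφ, h3, h4⟩ := h2 z τ hz
  obtain ⟨φ', hφ', h3', h4'⟩ := h2' z τ hz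
  refine ⟨φ + φ', hφ.add hφ', fun m ↦ ?_, ?_⟩
  · rw [iteratedDeriv_add hφ.contDiffAt hφ'.contDiffAt, h3, h3']
    rfl
  · filter_upwards [h4, h4'] with u hu hu'
    rw [hu, hu', Pi.add_apply]
    ring

/-- A function that does not depend on `u`. -/
lemma hasLaurent_const {w : ℤ} {a : (Fin N → ℂ) → ℍ → ℂ} (ha : a ∈ zRing 𝒪 n N w) :
    HasLaurent 𝒪 n 0 w fun z τ _ ↦ a z τ := by
  refine ⟨fun m ↦ if m = 0 then a else 0, fun m ↦ ?_, fun z τ _ ↦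
    ⟨fun _ ↦ a z τ, analyticAt_const, fun m ↦ ?_, by simp⟩⟩
  · dsimp only
    split_ifs with h
    · exact zRing_mono (by omega) ha
    · exact Submodule.zero_mem _
  · rw [iteratedDeriv_fun_const']
    by_cases h : m = 0 <;> simp [h]

lemma hasLaurent_inv_pow (M : ℕ) : HasLaurent 𝒪 n M M (fun _ _ u ↦ (u ^ M)⁻¹ :
    (Fin N → ℂ) → ℍ → ℂ → ℂ) := by
  refine ⟨fun m ↦ if m = 0 then 1 else 0, fun m ↦ ?_, fun z τ _ ↦
    ⟨fun _ ↦ 1, analyticAt_const, fun m ↦ ?_, by simp⟩⟩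
  · dsimp only
    split_ifs with h
    · exact zRing_mono (by omega) one_mem_zRing
    · exact Submodule.zero_mem _
  · rw [iteratedDeriv_fun_const']
    by_cases h : m = 0 <;> simp [h]

lemma iteratedDeriv_inv' (s : ℕ) (u : ℂ) :
    iteratedDeriv s (fun u : ℂ ↦ u⁻¹) u = (-1) ^ s * s.factorial * (u ^ (s + 1))⁻¹ := by
  rw [iteratedDeriv_eq_iterate, show (fun u : ℂ ↦ u⁻¹) = Inv.inv from rfl]
  simp only [iter_deriv_inv']
  rw [show (-1 - s : ℤ) = -((s + 1 : ℕ) : ℤ) by push_cast; ring, zpow_neg, zpow_natCast]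

/-- The principal part of `Z^{(s)}` at the origin. -/
lemma zder_eventuallyEq (s : ℕ) (T : ℍ) : zder s T =ᶠ[𝓝[≠] 0] fun u ↦
    (-1) ^ s * s.factorial * (u ^ (s + 1))⁻¹ + iteratedDeriv s (zreg T) u := by
  have hz : ∀ᶠ u in 𝓝[≠] (0 : ℂ), AnalyticAt ℂ (zreg T) u :=
    nhdsWithin_le_nhds (analyticAt_zreg T).eventually_analyticAt
  filter_upwards [eventually_notMem_latt T 0, hz] with u hu hz
  have hu0 : u ≠ 0 := fun h ↦ hu (h ▸ zero_mem_latt T)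
  have h1 : zfun T =ᶠ[𝓝 u] fun u ↦ u⁻¹ + zreg T u := by
    filter_upwards [(isOpen_compl_latt T).mem_nhds hu] with v hv using zfun_eq_inv_add_zreg T hv
  have h2 : AnalyticAt ℂ (fun u : ℂ ↦ u⁻¹) u := analyticAt_inv hu0
  rw [zder, h1.iteratedDeriv_eq s, ← iteratedDeriv_inv']
  exact iteratedDeriv_add h2.contDiffAt hz.contDiffAt

lemma HasLaurent.const_mul {M : ℕ} {w : ℤ} {g : (Fin N → ℂ) → ℍ → ℂ → ℂ}
    (hg : HasLaurent 𝒪 n M w g) (c : ℂ) : HasLaurent 𝒪 n M w fun z τ u ↦ c * g z τ u := by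
  have := (hasLaurent_const (const_mem_zRing c)).mul hg
  rwa [zero_add, zero_add] at this

/-- The principal part is a constant times u^{-(s+1)}, of order equal to the weight. The derivatives
of the regular part at 0 are the quasi-modular forms `zregder`. -/
lemma hasLaurent_zder (h𝒪 : IsFormClass 𝒪) (s : ℕ) : HasLaurent 𝒪 n (s + 1) (s + 1)
    (fun _ τ u ↦ zder s (natMul n τ) u : (Fin N → ℂ) → ℍ → ℂ → ℂ) := by
  have h1 : HasLaurent 𝒪 n 0 (s + 1)
      (fun _ τ u ↦ iteratedDeriv s (zreg (natMul n τ)) u : (Fin N → ℂ) → ℍ → ℂ → ℂ) := by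
    refine ⟨fun m _ τ ↦ zregder (m + s) (natMul n τ), fun m ↦ ?_, fun z τ _ ↦
      ⟨_, analyticAt_iteratedDeriv (analyticAt_zreg (natMul n τ)) s, fun m ↦ ?_, by simp⟩⟩
    · have := mem_zRing_of_mem_QModLE (N := N) (zregder_mem_QModLE n h𝒪 (m + s))
      exact zRing_mono (by push_cast; omega) this
    · rw [iteratedDeriv_iteratedDeriv]
      rfl
  have h2 := ((hasLaurent_inv_pow (𝒪 := 𝒪) (n := n) (N := N) (s + 1)).const_mul
    ((-1) ^ s * s.factorial))
  have h3 := (h2.mono (w' := s + 1) (by push_cast; rfl)).add h1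
  rw [max_eq_left (Nat.zero_le _)] at h3
  exact h3.congr fun z τ _ ↦ zder_eventuallyEq s _

lemma hasLaurent_zder_of_notMem {s : ℕ} {p : (Fin N → ℂ) → ℍ → ℂ}
    (hp : ∀ z τ, OffDiagonal z τ → p z τ ∉ latt (natMul n τ))
    (hmem : ∀ m : ℕ, (fun z τ ↦ zder (m + s) (natMul n τ) (p z τ)) ∈ zRing 𝒪 n N (m + s + 1)) :
    HasLaurent 𝒪 n 0 (s + 1) fun z τ u ↦ zder s (natMul n τ) (u + p z τ) := by
  refine ⟨fun m z τ ↦ zder (m + s) (natMul n τ) (p z τ), fun m ↦ ?_, fun z τ hz ↦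
    ⟨fun u ↦ zder s (natMul n τ) (u + p z τ), ?_, fun m ↦ ?_, by simp⟩⟩
  · exact zRing_mono (by push_cast; omega) (hmem m)
  · exact AnalyticAt.fun_comp_of_eq (analyticAt_zder s (hp z τ hz)) (by fun_prop) (by simp)
  · have := congrFun (iteratedDeriv_comp_add_const (f := zder s (natMul n τ)) (n := m)
      (s := p z τ)) 0
    rw [this, iteratedDeriv_zder, zero_add]

/-- If j ≠ j', the function is regular at u = 0 and its derivatives there are generators. If j = j'
and n does not divide k, it is regular with derivatives Z^{(m+s)}(kτ; nτ), which are quasi-modular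
up to constants. If j = j' and n divides k, quasi-periodicity moves the pole to the origin, at the
cost of a constant when s = 0. -/
lemma hasLaurent_zder_add (h𝒪 : IsFormClass 𝒪) (s : ℕ) (j j' : Fin N) (k : ℤ) :
    ∃ M, HasLaurent 𝒪 n M (s + 1) fun z τ u ↦
      zder s (natMul n τ) (u + (z j - z j' + k * τ)) := by
  by_cases hj : j = j'
  · subst hj
    simp only [sub_self, zero_add]
    by_cases hk : (n : ℤ) ∣ k
    · obtain ⟨q, rfl⟩ := hk
      have h1 := hasLaurent_const (𝒪 := 𝒪) (n := n) (N := N)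
        (const_mem_zRing (-(if s = 0 then 2 * Real.pi * I * q else 0)))
      refine ⟨_, ((hasLaurent_zder h𝒪 s).add (h1.mono (by omega))).congr fun z τ _ ↦ ?_⟩
      filter_upwards [eventually_notMem_latt (natMul n τ) 0] with u hu
      rw [← sub_eq_add_neg, ← zder_add_int_mul s _ hu, natMul_coe]
      push_cast
      ring_nf
    · refine ⟨0, hasLaurent_zder_of_notMem (fun z τ _ ↦ mul_notMem_latt hk τ) fun m ↦ ?_⟩
      have := mem_zRing_of_mem_QModLE (N := N) (zder_mem_QModLE h𝒪 (m + s) hk)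
      exact zRing_mono (by push_cast; omega) this
  · refine ⟨0, hasLaurent_zder_of_notMem (fun z τ hz ↦ ?_) fun m ↦ ?_⟩
    · have := sub_int_mul_notMem (n := n) (hz j j' hj) (-k)
      convert this using 1
      push_cast
      ring_nf
    · have := (ZGen.z (𝒪 := 𝒪) (n := n) j j' hj (m + s) (-k)).mem
      have h : (fun (z : Fin N → ℂ) τ ↦ zder (m + s) (natMul n τ) (z j - z j' + k * τ)) =
          fun z τ ↦ zder (m + s) (natMul n τ) (z j - z j' - (-k : ℤ) * τ) := by
        funext z τ
        congr 1
        push_cast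
        ring
      rw [h]
      exact_mod_cast this

/-- The elements of the ring in `N + 1` variables have Laurent expansions in the first variable,
at the points `z_j + kτ`, with coefficients in the ring in the other variables. -/
theorem exists_hasLaurent (h𝒪 : IsFormClass 𝒪) (j : Fin N) (k : ℤ) {w : ℤ}
    {f : (Fin (N + 1) → ℂ) → ℍ → ℂ} (hf : f ∈ zRing 𝒪 n (N + 1) w) :
    ∃ M, HasLaurent 𝒪 n M w fun z τ u ↦ f (Fin.cons (u + (z j + k * τ)) z) τ := by
  refine zRing_induction (P := fun w f ↦ ∃ M, HasLaurent 𝒪 n M w fun z τ u ↦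
    f (Fin.cons (u + (z j + k * τ)) z) τ) ?_ ?_ ?_ ?_ ?_ ?_ hf
  · exact ⟨0, hasLaurent_const one_mem_zRing⟩
  · exact fun w ↦ ⟨0, hasLaurent_const (Submodule.zero_mem _)⟩
  · rintro w f g ⟨M, hf⟩ ⟨M', hg⟩
    exact ⟨_, hf.add hg⟩
  · rintro w c f ⟨M, hf⟩
    exact ⟨M, hf.const_mul c⟩
  · rintro a b f hab ⟨M, hf⟩
    exact ⟨M, hf.mono hab⟩
  · rintro a g hg b f ⟨M, hf⟩
    suffices h : ∃ M', HasLaurent 𝒪 n M' a fun z τ u ↦ g (Fin.cons (u + (z j + k * τ)) z) τ by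
      obtain ⟨M', h⟩ := h
      exact ⟨_, h.mul hf⟩
    cases hg with
    | qmod w h hh => exact ⟨0, hasLaurent_const (ZGen.qmod a h hh).mem⟩
    | z i i' hii s l =>
      induction i using Fin.cases with
      | zero =>
        induction i' using Fin.cases with
        | zero => exact absurd rfl hii
        | succ i' =>
          obtain ⟨M', h⟩ := hasLaurent_zder_add (n := n) h𝒪 s j i' (k - l)
          refine ⟨M', h.congr fun z τ _ ↦ .of_forall fun u ↦ ?_⟩
          simp only [Fin.cons_zero, Fin.cons_succ]
          push_cast
          ring_nf
      | succ i =>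
        induction i' using Fin.cases with
        | zero =>
          obtain ⟨M', h⟩ := hasLaurent_zder_add (n := n) h𝒪 s j i (k + l)
          refine ⟨M', (h.const_mul ((-1) ^ (s + 1))).congr fun z τ _ ↦ .of_forall fun u ↦ ?_⟩
          simp only [Fin.cons_zero, Fin.cons_succ]
          -- The first variable enters with a minus sign here, and parity restores the argument u +
          -- (…) of the expansion.
          rw [← zder_neg]
          push_cast
          ring_nf
        | succ i' =>
          have hmem := (ZGen.z (𝒪 := 𝒪) (n := n) i i' (by simpa using hii) s l).mem
          refine ⟨0, (hasLaurent_const hmem).congr fun z τ _ ↦ .of_forall fun u ↦ ?_⟩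
          simp only [Fin.cons_succ]

end Laurent

/-! ### Shifting the contour of integration -/

/-- A function of period one that extends holomorphically to a closed horizontal strip has the same
integral over the two boundary lines. -/
lemma integral_eq_of_removable {G : ℂ → ℂ} (hper : ∀ v, G (v + 1) = G v) {a b : ℂ}
    (hab : a.im ≤ b.im)
    (hG : ∀ v : ℂ, a.im ≤ v.im → v.im ≤ b.im → ∃ ψ, AnalyticAt ℂ ψ v ∧ G =ᶠ[𝓝[≠] v] ψ)
    (hca : ∀ v : ℂ, v.im = a.im → ContinuousAt G v)
    (hcb : ∀ v : ℂ, v.im = b.im → ContinuousAt G v) :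
    ∫ x in (0 : ℝ)..1, G (x + a) = ∫ x in (0 : ℝ)..1, G (x + b) := by
  -- Taking limits fills the removable singularities: `E` is differentiable at every point of the
  -- closed strip, and equals `G` wherever `G` is continuous, in particular on the two boundary
  -- lines.
  let E : ℂ → ℂ := fun v ↦ limUnder (𝓝[≠] v) G
  have hE : ∀ {v L}, Tendsto G (𝓝[≠] v) (𝓝 L) → E v = L := fun h ↦ h.limUnder_eq
  have hd : ∀ v : ℂ, a.im ≤ v.im → v.im ≤ b.im → DifferentiableAt ℂ E v ∧
      Tendsto G (𝓝[≠] v) (𝓝 (E v)) := by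
    intro v h1 h2
    obtain ⟨ψ, hψ, hGψ⟩ := hG v h1 h2
    have hlim : Tendsto G (𝓝[≠] v) (𝓝 (ψ v)) :=
      (hψ.continuousAt.tendsto.mono_left nhdsWithin_le_nhds).congr' hGψ.symm
    refine ⟨hψ.differentiableAt.congr_of_eventuallyEq ?_, by rwa [hE hlim]⟩
    have h4 := hψ.eventually_continuousAt
    have hGψ := eventually_nhdsWithin_iff.mp hGψ
    filter_upwards [hGψ.eventually_nhds, h4] with w hw hc
    by_cases hwv : w = v
    · rw [hwv, hE hlim]
    · refine hE ((hc.tendsto.mono_left nhdsWithin_le_nhds).congr' ?_)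
      refine nhdsWithin_le_nhds ?_
      filter_upwards [hw, isOpen_ne.mem_nhds hwv] with x hx hxv using (hx hxv).symm
  have hEper : ∀ v : ℂ, a.im ≤ v.im → v.im ≤ b.im → E (v + 1) = E v := by
    intro v h1 h2
    refine hE ?_
    have h3 := (hd v h1 h2).2
    have h4 : Tendsto (fun w : ℂ ↦ w - 1) (𝓝[≠] (v + 1)) (𝓝[≠] v) := by
      refine tendsto_nhdsWithin_of_tendsto_nhds_of_eventually_within _ ?_ ?_
      · have : Tendsto (fun w : ℂ ↦ w - 1) (𝓝 (v + 1)) (𝓝 (v + 1 - 1)) :=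
          (continuous_id.sub continuous_const).continuousAt
        rw [add_sub_cancel_right] at this
        exact this.mono_left nhdsWithin_le_nhds
      · filter_upwards [self_mem_nhdsWithin] with w hw h
        exact hw (by rw [← show w - 1 = v from h]; simp)
    refine (h3.comp h4).congr fun w ↦ ?_
    simp only [Function.comp]
    rw [← hper (w - 1), sub_add_cancel]
  have hEc : ∀ {v : ℂ}, ContinuousAt G v → E v = G v := fun h ↦
    hE (h.tendsto.mono_left nhdsWithin_le_nhds)
  have hrect := integral_boundary_rect_eq_zero_of_differentiableOn E (a.im * I) (1 + b.im * I)
    (fun v hv ↦ by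
      have him := hv.2
      simp only [mul_im, ofReal_re, I_im, mul_one, ofReal_im, I_re, mul_zero, add_zero, add_im,
        one_im, zero_add, Set.uIcc_of_le hab] at him
      exact (hd v him.1 him.2).1.differentiableWithinAt)
  -- The vertical sides of the rectangle cancel by periodicity.
  have hv : ∫ y in a.im..b.im, E (1 + y * I) = ∫ y in a.im..b.im, E (0 + y * I) := by
    refine intervalIntegral.integral_congr fun y hy ↦ ?_
    rw [Set.uIcc_of_le hab] at hy
    rw [zero_add, add_comm, hEper _ (by simpa using hy.1) (by simpa using hy.2)]
  simp only [mul_re, ofReal_re, I_re, mul_zero, ofReal_im, I_im, mul_one, sub_self, add_re, one_re,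
    add_zero, mul_im, add_im, one_im, zero_add, ofReal_zero, ofReal_one] at hrect
  simp only [zero_add] at hv
  rw [hv, add_sub_cancel_right, sub_eq_zero] at hrect
  -- The rectangle lies over [0, 1]; periodicity removes the real part of the base point `c`.
  have hline : ∀ c : ℂ, (∀ v : ℂ, v.im = c.im → ContinuousAt G v) →
      ∫ x in (0 : ℝ)..1, G (x + c) = ∫ x in (0 : ℝ)..1, E (x + c.im * I) := by
    intro c hc
    have hp : Function.Periodic (fun x : ℝ ↦ G (x + c.im * I)) 1 := fun x ↦ by
      simp only
      rw [← hper (x + c.im * I)]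
      congr 1
      push_cast
      ring
    have h1 := hp.intervalIntegral_add_eq c.re 0
    rw [zero_add] at h1
    have h2 : ∫ x in (0 : ℝ)..1, E (x + c.im * I) = ∫ x in (0 : ℝ)..1, G (x + c.im * I) :=
      intervalIntegral.integral_congr fun x _ ↦ hEc (hc _ (by simp))
    have h3 := intervalIntegral.integral_comp_add_right (a := 0) (b := 1)
      (fun x : ℝ ↦ G (x + c.im * I)) c.re
    rw [h2, ← h1, add_comm c.re 1, ← zero_add c.re, ← add_assoc, add_zero, ← h3]
    refine intervalIntegral.integral_congr fun x _ ↦ congrArg G ?_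
    push_cast
    rw [add_assoc, re_add_im]
  rw [hline a hca, hline b hcb, hrect]

/-- Subtracting derivatives of `Z` removes the principal part of a Laurent expansion. -/
lemma exists_analytic_sub_principalPart {φ : ℂ → ℂ} (hφ : AnalyticAt ℂ φ 0) (M : ℕ) (T : ℍ) :
    ∃ ψ, AnalyticAt ℂ ψ 0 ∧ ∀ᶠ u in 𝓝[≠] 0, (u ^ (M + 1))⁻¹ * φ u -
      ∑ m ∈ Finset.range (M + 1), iteratedDeriv m φ 0 / m.factorial *
        ((-1) ^ (M - m) / (M - m).factorial * zder (M - m) T u) = ψ u := by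
  obtain ⟨F, hF, hφF⟩ := hφ.exists_eq_sum_add_pow_mul (M + 1)
  refine ⟨fun u ↦ F u - ∑ m ∈ Finset.range (M + 1), iteratedDeriv m φ 0 / m.factorial *
    ((-1) ^ (M - m) / (M - m).factorial * iteratedDeriv (M - m) (zreg T) u), ?_, ?_⟩
  · refine hF.sub (Finset.analyticAt_fun_sum _ fun m _ ↦ ?_)
    exact analyticAt_const.mul (analyticAt_const.mul
      (analyticAt_iteratedDeriv (analyticAt_zreg T) _))
  · have h : ∀ᶠ u in 𝓝[≠] (0 : ℂ), ∀ m ∈ Finset.range (M + 1), zder (M - m) T u =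
        (-1) ^ (M - m) * (M - m).factorial * (u ^ (M - m + 1))⁻¹ +
          iteratedDeriv (M - m) (zreg T) u :=
      (Finset.eventually_all _).mpr fun m _ ↦ zder_eventuallyEq (M - m) T
    filter_upwards [h, self_mem_nhdsWithin] with u hu hu0
    have hu0' : u ≠ 0 := hu0
    suffices hsum : (u ^ (M + 1))⁻¹ *
          ∑ m ∈ Finset.range (M + 1), u ^ m / m.factorial * iteratedDeriv m φ 0 -
        ∑ m ∈ Finset.range (M + 1), iteratedDeriv m φ 0 / m.factorial *
          ((-1) ^ (M - m) / (M - m).factorial * zder (M - m) T u) =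
        -∑ m ∈ Finset.range (M + 1), iteratedDeriv m φ 0 / m.factorial *
          ((-1) ^ (M - m) / (M - m).factorial * iteratedDeriv (M - m) (zreg T) u) by
      simp only [smul_eq_mul] at hφF
      rw [hφF u, mul_add, inv_mul_cancel_left₀ (pow_ne_zero _ hu0')]
      linear_combination hsum
    rw [Finset.mul_sum, ← Finset.sum_sub_distrib, ← Finset.sum_neg_distrib]
    refine Finset.sum_congr rfl fun m hm ↦ ?_
    have hm' : m ≤ M := by simpa [Nat.lt_succ_iff] using hm
    have h1 : u ^ (M + 1) = u ^ (M - m + 1) * u ^ m := by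
      rw [← pow_add]
      congr 1
      omega
    have h2 : ((-1 : ℂ) ^ (M - m)) * (-1) ^ (M - m) = 1 := by rw [← mul_pow]; simp
    have h3 : ((M - m).factorial : ℂ) ≠ 0 := by exact_mod_cast (M - m).factorial_ne_zero
    rw [hu m hm, h1]
    field_simp
    linear_combination (-iteratedDeriv m φ 0 * (M - m).factorial / m.factorial) * h2

/-! ### Elements of the ring as functions of the first variable -/

section FirstVariable

variable {𝒪 : Set (ℍ → ℂ)} {n : ℕ} [NeZero n] {N : ℕ}

lemma analyticAt_zRing_cons {w : ℤ} {f : (Fin (N + 1) → ℂ) → ℍ → ℂ}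
    (hf : f ∈ zRing 𝒪 n (N + 1) w) {z : Fin N → ℂ} {τ : ℍ} {v : ℂ}
    (hv : OffDiagonal (Fin.cons v z : Fin (N + 1) → ℂ) τ) :
    AnalyticAt ℂ (fun v ↦ f (Fin.cons v z) τ) v := by
  refine zRing_induction (P := fun _ f ↦ AnalyticAt ℂ (fun v ↦ f (Fin.cons v z) τ) v)
    analyticAt_const (fun _ ↦ analyticAt_const) (fun _ f g hf hg ↦ hf.add hg)
    (fun _ c f hf ↦ analyticAt_const.mul hf) (fun _ _ _ _ h ↦ h) (fun a g hg b f hf ↦ ?_) hf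
  refine AnalyticAt.mul ?_ hf
  cases hg with
  | qmod => exact analyticAt_const
  | z i j hij s k =>
    have h1 := sub_int_mul_notMem (n := n) (hv i j hij) k
    refine AnalyticAt.fun_comp_of_eq (f := fun v ↦ (Fin.cons v z : Fin (N + 1) → ℂ) i -
      (Fin.cons v z : Fin (N + 1) → ℂ) j - k * τ) (analyticAt_zder s h1) ?_ rfl
    have h2 : ∀ i, AnalyticAt ℂ (fun v ↦ (Fin.cons v z : Fin (N + 1) → ℂ) i) v := fun i ↦ by
      induction i using Fin.cases with
      | zero => exact analyticAt_id
      | succ i => exact analyticAt_const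
    exact ((h2 i).sub (h2 j)).sub analyticAt_const

lemma zRing_cons_add_one {w : ℤ} {f : (Fin (N + 1) → ℂ) → ℍ → ℂ}
    (hf : f ∈ zRing 𝒪 n (N + 1) w) (z : Fin N → ℂ) (τ : ℍ) (v : ℂ) :
    f (Fin.cons (v + 1) z) τ = f (Fin.cons v z) τ := by
  refine zRing_induction (P := fun _ f ↦ f (Fin.cons (v + 1) z) τ = f (Fin.cons v z) τ)
    rfl (fun _ ↦ rfl) (fun _ f g hf hg ↦ congrArg₂ (· + ·) hf hg)
    (fun _ c f hf ↦ congrArg (c * ·) hf) (fun _ _ _ _ h ↦ h) (fun a g hg b f hf ↦ ?_) hf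
  refine congrArg₂ (· * ·) ?_ hf
  cases hg with
  | qmod => rfl
  | z i j hij s k =>
    induction i using Fin.cases with
    | zero =>
      induction j using Fin.cases with
      | zero => exact absurd rfl hij
      | succ j =>
        simp only [Fin.cons_zero, Fin.cons_succ]
        rw [← zder_add_int s _ (v - z j - k * τ) 1]
        congr 1
        push_cast
        ring
    | succ i =>
      induction j using Fin.cases with
      | zero =>
        simp only [Fin.cons_zero, Fin.cons_succ]
        rw [← zder_add_int s _ (z i - v - k * τ) (-1)]
        congr 1
        push_cast
        ring
      | succ j => rfl

/-! ### Integration against the first variable: residues -/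

/-- The difference of the integrals of `Z^{(s)}` over two lines that differ by a period. -/
lemma integral_zder_sub (s : ℕ) {T : ℍ} {v : ℂ} (hv : ∀ x : ℝ, x + v ∉ latt T) :
    (∫ x in (0 : ℝ)..1, zder s T (x + v)) - ∫ x in (0 : ℝ)..1, zder s T (x + v + T) =
      if s = 0 then 2 * Real.pi * I else 0 := by
  have hc : Continuous fun x : ℝ ↦ zder s T (x + v) := continuous_iff_continuousAt.mpr fun x ↦
    ContinuousAt.comp (g := zder s T) (analyticAt_zder s (hv x)).continuousAt (by fun_prop)
  have h : ∀ x : ℝ, zder s T (x + v + T) = zder s T (x + v) -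
      if s = 0 then 2 * Real.pi * I else 0 := fun x ↦ by
    simpa using zder_add_int_mul s T (hv x) 1
  simp only [h]
  rw [intervalIntegral.integral_sub (hc.intervalIntegrable _ _) (by simp)]
  simp

/-- The difference of the integrals of an element of the ring over two lines that differ by the
period `nτ` is a sum of residues, hence an element of the ring in the remaining variables. -/
theorem exists_integral_sub_eq (h𝒪 : IsFormClass 𝒪) {w : ℤ} {f : (Fin (N + 1) → ℂ) → ℍ → ℂ}
    (hf : f ∈ zRing 𝒪 n (N + 1) (w + 1)) (κ : Fin N → ℤ) :
    ∃ r ∈ zRing 𝒪 n N w, ∀ (τ : ℍ) (z : Fin N → ℂ) (v : ℂ), OffDiagonal z τ →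
      (∀ j, κ j * τ.im < (v - z j).im ∧ (v - z j).im < (κ j + 1) * τ.im) →
      (∫ x in (0 : ℝ)..1, f (Fin.cons (x + v) z) τ) -
        ∫ x in (0 : ℝ)..1, f (Fin.cons (x + v + natMul n τ) z) τ = r z τ := by
  -- The lower line runs between the heights of z_j + κ_jτ and z_j + (κ_j + 1)τ, so modulo integers
  -- the possible poles in a strip of height n Im τ are z_j + mτ with κ_j + 1 ≤ m ≤ κ_j + n.
  let kk : Fin N × Fin n → ℤ := fun p ↦ κ p.1 + 1 + (p.2 : ℕ)
  have hL : ∀ p : Fin N × Fin n, ∃ M, HasLaurent 𝒪 n (M + 1) (w + 1)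
      fun z τ u ↦ f (Fin.cons (u + (z p.1 + kk p * τ)) z) τ := fun p ↦ by
    obtain ⟨M, hM⟩ := exists_hasLaurent h𝒪 p.1 (kk p) hf
    -- With order M + 1 ≥ 1 the residue is always d_M / M!, of weight (w + 1) − (M + 1) + M = w.
    exact ⟨M, hM.raise (Nat.le_succ M)⟩
  choose M d hd hexp using hL
  refine ⟨∑ p, (2 * Real.pi * I / (M p).factorial : ℂ) • d p (M p), Submodule.sum_mem _ fun p _ ↦
    Submodule.smul_mem _ _ (zRing_mono (by push_cast; omega) (hd p (M p))),
    fun τ z v hz hv ↦ ?_⟩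
  set T := natMul n τ with hT
  have hτ := τ.im_pos
  let pole : Fin N × Fin n → ℂ := fun p ↦ z p.1 + kk p * τ
  let coef : Fin N × Fin n → ℕ → ℂ := fun p m ↦
    d p m z τ / m.factorial * ((-1) ^ (M p - m) / (M p - m).factorial)
  -- `H p` matches the principal part at `pole p`, which modulo integers is its only pole in the
  -- strip, Z being taken for ℤ + ℤnτ. Once these are subtracted the two integrals agree, and among
  -- the terms of `H p` only that with m = M p, a multiple of Z itself, has different integrals over
  -- the two lines.
  let H : Fin N × Fin n → ℂ → ℂ := fun p v ↦
    ∑ m ∈ Finset.range (M p + 1), coef p m * zder (M p - m) T (v - pole p)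
  -- analyticity of the pieces
  have hoff : ∀ {v : ℂ}, (∀ j, v - z j ∉ latt τ) → ∀ p, v - pole p ∉ latt T := by
    intro v hv p
    have := sub_int_mul_notMem (n := n) (hv p.1) (kk p)
    rwa [sub_sub] at this
  have hHan : ∀ p v, v - pole p ∉ latt T → AnalyticAt ℂ (H p) v := fun p v hv ↦
    Finset.analyticAt_fun_sum _ fun m _ ↦ analyticAt_const.mul
      (AnalyticAt.fun_comp_of_eq (analyticAt_zder (M p - m) hv) (by fun_prop) rfl)
  have hfan : ∀ {v : ℂ}, (∀ j, v - z j ∉ latt τ) →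
      AnalyticAt ℂ (fun v ↦ f (Fin.cons v z) τ) v := fun hv ↦
    analyticAt_zRing_cons hf (offDiagonal_cons.mpr ⟨hv, hz⟩)
  have hHsum : ∀ {v : ℂ}, (∀ j, v - z j ∉ latt τ) → AnalyticAt ℂ (fun v ↦ ∑ p, H p v) v :=
    fun hv ↦ Finset.analyticAt_fun_sum _ fun p _ ↦ hHan p _ (hoff hv p)
  -- the boundary lines avoid the poles
  have hbot : ∀ {v' : ℂ}, v'.im = v.im → ∀ j, v' - z j ∉ latt τ := by
    intro v' hv' j
    refine notMem_latt_of_im (κ j) ?_ ?_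
    · rw [sub_im, hv', ← sub_im]; exact (hv j).1
    · rw [sub_im, hv', ← sub_im]; exact (hv j).2
  have hTτ : (T : ℂ) ∈ latt τ := latt_natMul_subset n τ (self_mem_latt T)
  have htop : ∀ {v' : ℂ}, v'.im = (v + T).im → ∀ j, v' - z j ∉ latt τ := by
    intro v' hv' j
    have h1 := hbot (v' := v' - T) (by rw [sub_im, hv', add_im]; ring) j
    rw [sub_right_comm, sub_eq_add_neg, add_mem_latt_iff τ ((neg_mem_latt_iff τ).mpr hTτ)] at h1
    exact h1
  have hTim : (v + T).im = v.im + n * τ.im := by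
    rw [add_im]
    congr 1
    exact natMul_im n τ
  -- the integral of the difference
  have hG : ∫ x in (0 : ℝ)..1, (f (Fin.cons (x + v) z) τ - ∑ p, H p (x + v)) =
      ∫ x in (0 : ℝ)..1, (f (Fin.cons (x + (v + T)) z) τ - ∑ p, H p (x + (v + T))) := by
    refine integral_eq_of_removable (G := fun v ↦ f (Fin.cons v z) τ - ∑ p, H p v) ?_ ?_ ?_ ?_ ?_
    · intro v
      rw [zRing_cons_add_one hf]
      congr 1
      refine Finset.sum_congr rfl fun p _ ↦ Finset.sum_congr rfl fun m _ ↦ ?_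
      rw [← zder_add_int _ T (v - pole p) 1]
      congr 2
      push_cast
      ring
    · rw [hTim]
      have := mul_nonneg (Nat.cast_nonneg (α := ℝ) n) hτ.le
      linarith
    · intro v' hv1 hv2
      by_cases hreg : ∀ j, v' - z j ∉ latt τ
      · exact ⟨_, (hfan hreg).sub (hHsum hreg), EventuallyEq.rfl⟩
      push Not at hreg
      obtain ⟨j, m, l, hml⟩ := hreg
      have hv'eq : v' = z j + m * τ + l := by linear_combination hml
      have him : v'.im = (z j).im + m * τ.im := by rw [hv'eq]; simp
      rw [hTim, him] at hv2
      rw [him] at hv1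
      obtain ⟨hj1, hj2⟩ := hv j
      rw [sub_im] at hj1 hj2
      have hm1 : κ j < m := by
        have : (κ j : ℝ) * τ.im < m * τ.im := by linarith
        exact_mod_cast lt_of_mul_lt_mul_right this hτ.le
      have hm2 : m < κ j + 1 + n := by
        have : (m : ℝ) * τ.im < (κ j + 1 + n) * τ.im := by linarith
        exact_mod_cast lt_of_mul_lt_mul_right this hτ.le
      obtain ⟨i, hi⟩ := Int.eq_ofNat_of_zero_le (show 0 ≤ m - (κ j + 1) by omega)
      let p : Fin N × Fin n := (j, ⟨i, by omega⟩)
      have hkp : kk p = m := by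
        simp only [kk, p]
        omega
      have hpole : v' = pole p + l := by rw [hv'eq]; simp only [pole, hkp, p]
      obtain ⟨φ, hφ, hφd, hφe⟩ := hexp p z τ hz
      obtain ⟨ψ, hψ, hψe⟩ := exists_analytic_sub_principalPart hφ (M p) T
      have hother : ∀ p' ∈ Finset.univ.erase p, AnalyticAt ℂ (H p') v' := by
        intro p' hp'
        refine hHan p' v' ?_
        have hne := Finset.ne_of_mem_erase hp'
        rw [hpole, add_sub_right_comm, add_mem_latt_iff T ⟨0, l, by simp⟩]
        -- Two poles over the same z_j differ by kτ with 0 < |k| < n, hence not by an element of ℤ +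
        -- ℤnτ; poles over different coordinates are separated because z is off the diagonals.
        by_cases hjj : p'.1 = j
        · have h1 : ¬ (n : ℤ) ∣ kk p - kk p' := by
            intro hdvd
            have hlt1 := p'.2.isLt
            have hlt2 := p.2.isLt
            have h2 : kk p - kk p' = (p.2 : ℕ) - (p'.2 : ℕ) := by
              simp only [kk, hjj, p]
              ring
            rw [h2] at hdvd
            have h3 := Int.eq_zero_of_abs_lt_dvd hdvd (by rw [abs_lt]; omega)
            apply hne
            exact Prod.ext hjj (Fin.ext (by omega))
          have h2 := mul_notMem_latt h1 τ
          have h5 : pole p - pole p' = ((kk p - kk p' : ℤ) : ℂ) * τ := by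
            simp only [pole, hjj, p]
            push_cast
            ring
          rwa [h5]
        · have h1 := sub_int_mul_notMem (n := n) (hz j p'.1 (Ne.symm hjj)) (kk p' - kk p)
          have h5 : pole p - pole p' = z j - z p'.1 - ((kk p' - kk p : ℤ) : ℂ) * τ := by
            simp only [pole, p]
            push_cast
            ring
          rwa [h5]
      refine ⟨fun v ↦ ψ (v - v') - ∑ p' ∈ Finset.univ.erase p, H p' v, ?_, ?_⟩
      · exact (AnalyticAt.fun_comp_of_eq (g := ψ) (f := fun v ↦ v - v') hψ (by fun_prop)
          (sub_self v')).sub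
          (Finset.analyticAt_fun_sum _ hother)
      · have hshift : Tendsto (fun v ↦ v - v') (𝓝[≠] v') (𝓝[≠] 0) := by
          refine tendsto_nhdsWithin_of_tendsto_nhds_of_eventually_within _ ?_ ?_
          · have : Tendsto (fun w : ℂ ↦ w - v') (𝓝 v') (𝓝 (v' - v')) :=
              (continuous_id.sub continuous_const).continuousAt
            rw [sub_self] at this
            exact this.mono_left nhdsWithin_le_nhds
          · filter_upwards [self_mem_nhdsWithin] with x hx using sub_ne_zero.mpr hx
        filter_upwards [hshift.eventually hφe, hshift.eventually hψe] with x hx1 hx2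
        have hfx : f (Fin.cons x z) τ = ((x - v') ^ (M p + 1))⁻¹ * φ (x - v') := by
          rw [← hx1]
          have hper : ∀ l : ℤ, ∀ v, f (Fin.cons (v + l) z) τ = f (Fin.cons v z) τ := by
            intro l v
            have : Function.Periodic (fun v ↦ f (Fin.cons v z) τ) 1 :=
              zRing_cons_add_one hf z τ
            simpa using this.int_mul l v
          change f (Fin.cons x z) τ = f (Fin.cons (x - v' + pole p) z) τ
          rw [← hper l (x - v' + pole p), hpole]
          congr 2
          ring
        have hHx : H p x = ∑ m ∈ Finset.range (M p + 1), iteratedDeriv m φ 0 / m.factorial *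
            ((-1) ^ (M p - m) / (M p - m).factorial * zder (M p - m) T (x - v')) := by
          refine Finset.sum_congr rfl fun m _ ↦ ?_
          rw [hφd, ← zder_add_int _ T (x - v') l]
          simp only [coef]
          rw [mul_assoc, hpole]
          congr 3
          ring_nf
        rw [← Finset.add_sum_erase _ _ (Finset.mem_univ p), hfx, hHx, ← hx2]
        ring
    · exact fun v' hv' ↦ ((hfan (hbot hv')).sub (hHsum (hbot hv'))).continuousAt
    · exact fun v' hv' ↦ ((hfan (htop hv')).sub (hHsum (htop hv'))).continuousAt
  -- splitting the integrals
  have hline : ∀ {g : ℂ → ℂ} {c : ℂ}, (∀ v', v'.im = c.im → AnalyticAt ℂ g v') →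
      IntervalIntegrable (fun x : ℝ ↦ g (x + c)) MeasureTheory.volume 0 1 := fun {g c} hg ↦ by
    refine Continuous.intervalIntegrable (continuous_iff_continuousAt.mpr fun x ↦ ?_) _ _
    exact ContinuousAt.comp (g := g) (hg _ (by simp)).continuousAt (by fun_prop)
  have hres : ∀ p, (∫ x in (0 : ℝ)..1, H p (x + v)) - ∫ x in (0 : ℝ)..1, H p (x + (v + T)) =
      2 * Real.pi * I / (M p).factorial * d p (M p) z τ := by
    intro p
    have hz1 : ∀ m, IntervalIntegrable (fun x : ℝ ↦ coef p m * zder (M p - m) T (x + v - pole p))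
        MeasureTheory.volume 0 1 := fun m ↦
      hline (g := fun v ↦ coef p m * zder (M p - m) T (v - pole p)) fun v' hv' ↦
        analyticAt_const.mul (AnalyticAt.fun_comp_of_eq (analyticAt_zder _ (hoff (hbot hv') p))
          (by fun_prop) rfl)
    have hz2 : ∀ m, IntervalIntegrable
        (fun x : ℝ ↦ coef p m * zder (M p - m) T (x + (v + T) - pole p))
        MeasureTheory.volume 0 1 := fun m ↦
      hline (g := fun v ↦ coef p m * zder (M p - m) T (v - pole p)) fun v' hv' ↦
        analyticAt_const.mul (AnalyticAt.fun_comp_of_eq (analyticAt_zder _ (hoff (htop hv') p))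
          (by fun_prop) rfl)
    simp only [H]
    rw [intervalIntegral.integral_finsetSum fun m _ ↦ hz1 m,
      intervalIntegral.integral_finsetSum fun m _ ↦ hz2 m, ← Finset.sum_sub_distrib]
    have hterm : ∀ m, (∫ x in (0 : ℝ)..1, coef p m * zder (M p - m) T (x + v - pole p)) -
        ∫ x in (0 : ℝ)..1, coef p m * zder (M p - m) T (x + (v + T) - pole p) =
        coef p m * if M p - m = 0 then 2 * Real.pi * I else 0 := by
      intro m
      rw [intervalIntegral.integral_const_mul, intervalIntegral.integral_const_mul, ← mul_sub,
        ← integral_zder_sub (M p - m) (T := T) (v := v - pole p)]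
      · congr 3
        · funext x
          ring_nf
        · funext x
          ring_nf
      · intro x
        rw [← add_sub_assoc]
        exact hoff (hbot (by simp)) p
    simp only [hterm]
    rw [Finset.sum_eq_single_of_mem (M p) (by simp)]
    · simp only [coef, Nat.sub_self, pow_zero, Nat.factorial_zero, Nat.cast_one, if_true]
      ring
    · intro m hm hmM
      rw [if_neg, mul_zero]
      have := Finset.mem_range.mp hm
      omega
  rw [intervalIntegral.integral_sub (hline fun v' hv' ↦ hfan (hbot hv'))
      (hline (g := fun v ↦ ∑ p, H p v) fun v' hv' ↦ hHsum (hbot hv')),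
    intervalIntegral.integral_sub (hline (g := fun v ↦ f (Fin.cons v z) τ)
      fun v' hv' ↦ hfan (htop hv'))
      (hline (g := fun v ↦ ∑ p, H p v) fun v' hv' ↦ hHsum (htop hv')),
    intervalIntegral.integral_finsetSum fun p _ ↦ hline fun v' hv' ↦ hHan p v' (hoff (hbot hv') p),
    intervalIntegral.integral_finsetSum fun p _ ↦ hline fun v' hv' ↦
      hHan p v' (hoff (htop hv') p)] at hG
  have hfinal : ∑ p, ((∫ x in (0 : ℝ)..1, H p (x + v)) - ∫ x in (0 : ℝ)..1, H p (x + (v + T))) =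
      (∑ p, (2 * Real.pi * I / (M p).factorial : ℂ) • d p (M p)) z τ := by
    simp only [hres, Finset.sum_apply, Pi.smul_apply, smul_eq_mul]
  rw [← hfinal, Finset.sum_sub_distrib]
  simp only [add_assoc]
  linear_combination hG

end FirstVariable

/-! ### Antidifferences in the first variable -/

section Antidifference

variable {𝒪 : Set (ℍ → ℂ)} {n : ℕ} [NeZero n] {N : ℕ}

/-- Invariance under translation of the first variable by `nτ`, off the diagonals. -/
def IsElliptic (n : ℕ) [NeZero n] (e : (Fin (N + 1) → ℂ) → ℍ → ℂ) : Prop :=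
  ∀ (z : Fin N → ℂ) (v : ℂ) (τ : ℍ), OffDiagonal (Fin.cons v z : Fin (N + 1) → ℂ) τ →
    e (Fin.cons (v + natMul n τ) z) τ = e (Fin.cons v z) τ

lemma IsElliptic.mul {e e' : (Fin (N + 1) → ℂ) → ℍ → ℂ} (h : IsElliptic n e)
    (h' : IsElliptic n e') : IsElliptic n (e * e') := fun z v τ hz ↦
  congrArg₂ (· * ·) (h z v τ hz) (h' z v τ hz)

/-- A generator changes by a constant under translation of the first variable by `nτ`; the constant
vanishes unless the weight is one. -/
lemma ZGen.exists_cons_add {a : ℤ} {g : (Fin (N + 1) → ℂ) → ℍ → ℂ} (hg : ZGen 𝒪 n (N + 1) a g) :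
    ∃ c : ℂ, (c ≠ 0 → a = 1) ∧ ∀ (z : Fin N → ℂ) (v : ℂ) (τ : ℍ),
      OffDiagonal (Fin.cons v z : Fin (N + 1) → ℂ) τ →
        g (Fin.cons (v + natMul n τ) z) τ = g (Fin.cons v z) τ + c := by
  cases hg with
  | qmod => exact ⟨0, by simp, fun _ _ _ _ ↦ by simp⟩
  | z i j hij s k =>
    have hs : ∀ c : ℂ, (if s = 0 then c else 0) ≠ 0 → (s + 1 : ℤ) = 1 := fun c hc ↦ by
      by_contra h
      exact hc (if_neg (by omega))
    induction i using Fin.cases with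
    | zero =>
      induction j using Fin.cases with
      | zero => exact absurd rfl hij
      | succ j =>
        refine ⟨-if s = 0 then 2 * Real.pi * I else 0, fun h ↦ hs _ (neg_ne_zero.mp h),
          fun z v τ hz ↦ ?_⟩
        have h1 := sub_int_mul_notMem (n := n) ((offDiagonal_cons.mp hz).1 j) k
        have h2 := zder_add_int_mul s (natMul n τ) h1 1
        simp only [Fin.cons_zero, Fin.cons_succ]
        rw [Int.cast_one, one_mul, mul_one] at h2
        rw [← sub_eq_add_neg, ← h2]
        congr 1
        ring
    | succ i =>
      induction j using Fin.cases with
      | zero =>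
        refine ⟨if s = 0 then 2 * Real.pi * I else 0, hs _, fun z v τ hz ↦ ?_⟩
        have h0 := hz i.succ 0 (Fin.succ_ne_zero i)
        simp only [Fin.cons_zero, Fin.cons_succ] at h0 ⊢
        have h2 := zder_add_int_mul s (natMul n τ) (sub_int_mul_notMem (n := n) h0 k) (-1)
        rw [Int.cast_neg, Int.cast_one, neg_one_mul, mul_neg_one] at h2
        rw [show z i - (v + natMul n τ) - k * τ = z i - v - k * τ + -(natMul n τ : ℂ) by ring, h2]
        split_ifs <;> ring
      | succ j => exact ⟨0, by simp, fun _ _ _ _ ↦ by simp⟩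

variable (n N) in
/-- The generator `Z(z_0 - z_1; nτ)`. -/
def zBase : (Fin (N + 2) → ℂ) → ℍ → ℂ :=
  fun z τ ↦ zder 0 (natMul n τ) (z 0 - z 1 - (0 : ℤ) * τ)

lemma zBase_mem : zBase n N ∈ zRing 𝒪 n (N + 2) 1 := by
  have := (ZGen.z (𝒪 := 𝒪) (n := n) (0 : Fin (N + 2)) 1 (by simp) 0 0).mem
  rwa [Nat.cast_zero, zero_add] at this

lemma zBase_cons_add (z : Fin (N + 1) → ℂ) (v : ℂ) (τ : ℍ)
    (hz : OffDiagonal (Fin.cons v z : Fin (N + 2) → ℂ) τ) :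
    zBase n N (Fin.cons (v + natMul n τ) z) τ =
      zBase n N (Fin.cons v z) τ - 2 * Real.pi * I := by
  have h1 := sub_int_mul_notMem (n := n) ((offDiagonal_cons.mp hz).1 0) 0
  have h2 := zder_add_int_mul 0 (natMul n τ) h1 1
  rw [Int.cast_one, one_mul, mul_one, if_pos rfl] at h2
  change zder 0 (natMul n τ) (v + natMul n τ - z 0 - (0 : ℤ) * τ) =
    zder 0 (natMul n τ) (v - z 0 - (0 : ℤ) * τ) - _
  rw [← h2]
  congr 1
  ring

/-- Every element of the ring is a polynomial in `Z(z_0 - z_1; nτ)` with elliptic coefficients. -/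
lemma mem_span_zBase_pow_mul {w : ℤ} {f : (Fin (N + 2) → ℂ) → ℍ → ℂ}
    (hf : f ∈ zRing 𝒪 n (N + 2) w) :
    f ∈ Submodule.span ℂ {f | ∃ (k : ℕ) (a : ℤ) (e : (Fin (N + 2) → ℂ) → ℍ → ℂ),
      e ∈ zRing 𝒪 n (N + 2) a ∧ IsElliptic n e ∧ k + a ≤ w ∧ f = zBase n N ^ k * e} := by
  refine zRing_induction (P := fun w f ↦ f ∈ Submodule.span ℂ {f | ∃ (k : ℕ) (a : ℤ)
    (e : (Fin (N + 2) → ℂ) → ℍ → ℂ), e ∈ zRing 𝒪 n (N + 2) a ∧ IsElliptic n e ∧ k + a ≤ w ∧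
      f = zBase n N ^ k * e}) ?_ (fun _ ↦ Submodule.zero_mem _)
    (fun _ _ _ ↦ Submodule.add_mem _) (fun _ c _ ↦ Submodule.smul_mem _ c) ?_ ?_ hf
  · exact Submodule.subset_span ⟨0, 0, 1, one_mem_zRing, fun _ _ _ _ ↦ rfl, by simp, by simp⟩
  · intro a b f hab hf
    refine Submodule.span_mono ?_ hf
    rintro _ ⟨k, c, e, h1, h2, h3, rfl⟩
    exact ⟨k, c, e, h1, h2, h3.trans hab, rfl⟩
  · intro a g hg b f hf
    obtain ⟨c, hc, hgc⟩ := hg.exists_cons_add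
    have hpi : (2 * Real.pi * I : ℂ) ≠ 0 := by simp [Real.pi_ne_zero]
    -- Z changes by −2πi, so subtracting c'Z cancels the translation constant of `g`. A nonzero
    -- constant forces weight 1, the weight of Z, so the remainder keeps the weight of `g`.
    let c' : ℂ := -c / (2 * Real.pi * I)
    let e' := g - c' • zBase n N
    have he' : e' ∈ zRing 𝒪 n (N + 2) a := by
      refine Submodule.sub_mem _ hg.mem ?_
      by_cases h : c = 0
      · simp [c', h]
      · rw [hc h]
        exact Submodule.smul_mem _ _ zBase_mem
    have hell : IsElliptic n e' := by
      intro z v τ hz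
      simp only [e', Pi.sub_apply, Pi.smul_apply, smul_eq_mul]
      rw [hgc z v τ hz, zBase_cons_add z v τ hz, mul_sub, div_mul_cancel₀ _ hpi]
      ring
    have hge : g = c' • zBase n N + e' := by simp [e']
    induction hf using Submodule.span_induction with
    | mem f hf =>
      obtain ⟨k, d, e, h1, h2, h3, rfl⟩ := hf
      have h : g * (zBase n N ^ k * e) =
          c' • (zBase n N ^ (k + 1) * e) + zBase n N ^ k * (e' * e) := by
        rw [hge, add_mul, smul_mul_assoc]
        ring_nf
      rw [h]
      refine Submodule.add_mem _ ?_ (Submodule.subset_span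
        ⟨k, a + d, _, mul_mem_zRing he' h1, hell.mul h2, by omega, rfl⟩)
      by_cases hc0 : c = 0
      · simp [c', hc0]
      · have := hc hc0
        exact Submodule.smul_mem _ _ (Submodule.subset_span
          ⟨k + 1, d, e, h1, h2, by push_cast; omega, rfl⟩)
    | zero => simp
    | add f₁ f₂ _ _ h₁ h₂ =>
      rw [mul_add]
      exact Submodule.add_mem _ h₁ h₂
    | smul c f _ h =>
      rw [mul_smul_comm]
      exact Submodule.smul_mem _ c h

/-- With c = 2πi, Z^{k+1}e − (Z − c)^{k+1}e is (k + 1)c·Z^k e plus multiples of Z^i e with i < k.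
These have antidifferences by induction, so dividing by (k + 1)c gives one for Z^k e. -/
lemma exists_antidifference_zBase_pow_mul {a : ℤ} {e : (Fin (N + 2) → ℂ) → ℍ → ℂ}
    (he : e ∈ zRing 𝒪 n (N + 2) a) (hell : IsElliptic n e) (k : ℕ) :
    ∃ g ∈ zRing 𝒪 n (N + 2) (k + a + 1), ∀ (z : Fin (N + 1) → ℂ) (v : ℂ) (τ : ℍ),
      OffDiagonal (Fin.cons v z : Fin (N + 2) → ℂ) τ → (zBase n N ^ k * e) (Fin.cons v z) τ =
        g (Fin.cons v z) τ - g (Fin.cons (v + natMul n τ) z) τ := by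
  induction k using Nat.strong_induction_on with
  | _ k ih =>
    choose! G hG hGd using ih
    have hpi : (2 * Real.pi * I : ℂ) ≠ 0 := by simp [Real.pi_ne_zero]
    generalize hc : (2 * Real.pi * I : ℂ) = c at hpi
    refine ⟨((k + 1) * c)⁻¹ • (zBase n N ^ (k + 1) * e +
      ∑ i ∈ Finset.range k, ((-c) ^ (k + 1 - i) * ((k + 1).choose i : ℂ)) • G i), ?_,
      fun z v τ hz ↦ ?_⟩
    · refine Submodule.smul_mem _ _ (Submodule.add_mem _ ?_ (Submodule.sum_mem _ fun i hi ↦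
        Submodule.smul_mem _ _ ?_))
      · have := mul_mem_zRing (pow_mem_zRing (zBase_mem (𝒪 := 𝒪) (n := n) (N := N)) (k + 1)) he
        exact zRing_mono (by push_cast; omega) this
      · have hi := Finset.mem_range.mp hi
        exact zRing_mono (by omega) (hG i hi)
    · have h1 : ∀ i ∈ Finset.range k, (-c) ^ (k + 1 - i) * ((k + 1).choose i : ℂ) *
          (zBase n N ^ i * e) (Fin.cons v z) τ =
          (-c) ^ (k + 1 - i) * ((k + 1).choose i : ℂ) * G i (Fin.cons v z) τ -
          (-c) ^ (k + 1 - i) * ((k + 1).choose i : ℂ) * G i (Fin.cons (v + natMul n τ) z) τ :=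
        fun i hi ↦ by rw [hGd i (Finset.mem_range.mp hi) z v τ hz, mul_sub]
      have h2 := Finset.sum_congr rfl h1
      rw [Finset.sum_sub_distrib] at h2
      simp only [Pi.mul_apply, Pi.pow_apply, Pi.smul_apply, Pi.add_apply, Finset.sum_apply,
        smul_eq_mul] at h2 ⊢
      rw [hell z v τ hz, zBase_cons_add z v τ hz, hc]
      generalize zBase n N (Fin.cons v z) τ = Z at h2 ⊢
      generalize e (Fin.cons v z) τ = E at h2 ⊢
      have h3 := add_pow Z (-c) (k + 1)
      rw [Finset.sum_range_succ, Finset.sum_range_succ] at h3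
      simp only [Nat.choose_self, Nat.sub_self, Nat.choose_succ_self_right, pow_zero,
        Nat.add_sub_cancel_left, pow_one, Nat.cast_one, mul_one] at h3
      have h4 : ∑ i ∈ Finset.range k, (-c) ^ (k + 1 - i) * ((k + 1).choose i : ℂ) * (Z ^ i * E) =
          (∑ i ∈ Finset.range k, Z ^ i * (-c) ^ (k + 1 - i) * ((k + 1).choose i : ℂ)) * E := by
        rw [Finset.sum_mul]
        exact Finset.sum_congr rfl fun i _ ↦ by ring
      have hk : ((k : ℂ) + 1) ≠ 0 := by exact_mod_cast Nat.succ_ne_zero k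
      rw [← mul_sub, eq_inv_mul_iff_mul_eq₀ (mul_ne_zero hk hpi)]
      rw [h4] at h2
      push_cast at h3
      rw [← sub_eq_add_neg] at h3
      linear_combination h2 + E * h3

/-- Every element of the ring is the difference of an element of the ring and of its translate in
the first variable. -/
theorem exists_antidifference {w : ℤ} {f : (Fin (N + 2) → ℂ) → ℍ → ℂ}
    (hf : f ∈ zRing 𝒪 n (N + 2) w) :
    ∃ g ∈ zRing 𝒪 n (N + 2) (w + 1), ∀ (z : Fin (N + 1) → ℂ) (v : ℂ) (τ : ℍ),
      OffDiagonal (Fin.cons v z : Fin (N + 2) → ℂ) τ → f (Fin.cons v z) τ =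
        g (Fin.cons v z) τ - g (Fin.cons (v + natMul n τ) z) τ := by
  have hf' := mem_span_zBase_pow_mul hf
  clear hf
  induction hf' using Submodule.span_induction with
  | mem f hf =>
    obtain ⟨k, a, e, h1, h2, h3, rfl⟩ := hf
    obtain ⟨g, hg, hgd⟩ := exists_antidifference_zBase_pow_mul h1 h2 k
    exact ⟨g, zRing_mono (by omega) hg, hgd⟩
  | zero => exact ⟨0, Submodule.zero_mem _, fun _ _ _ _ ↦ by simp⟩
  | add f₁ f₂ _ _ h₁ h₂ =>
    obtain ⟨g₁, hg₁, hd₁⟩ := h₁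
    obtain ⟨g₂, hg₂, hd₂⟩ := h₂
    refine ⟨g₁ + g₂, Submodule.add_mem _ hg₁ hg₂, fun z v τ hz ↦ ?_⟩
    simp only [Pi.add_apply]
    rw [hd₁ z v τ hz, hd₂ z v τ hz]
    ring
  | smul c f _ h =>
    obtain ⟨g, hg, hd⟩ := h
    refine ⟨c • g, Submodule.smul_mem _ c hg, fun z v τ hz ↦ ?_⟩
    simp only [Pi.smul_apply, smul_eq_mul]
    rw [hd z v τ hz, mul_sub]

end Antidifference

/-! ### Integrals over tori -/

section TorusIntegrals

variable {𝒪 : Set (ℍ → ℂ)} {n : ℕ} [NeZero n] {N : ℕ}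

/-- A generator involving Z needs two distinct indices, so only quasi-modular generators occur. -/
lemma exists_QModLE_of_subsingleton [Subsingleton (Fin N)] (h𝒪 : IsFormClass 𝒪) {w : ℤ}
    {f : (Fin N → ℂ) → ℍ → ℂ} (hf : f ∈ zRing 𝒪 n N w) :
    ∃ F ∈ QModLE 𝒪 (CongruenceSubgroup.Gamma1 n) w, ∀ z τ, f z τ = F τ := by
  refine zRing_induction (P := fun w f ↦ ∃ F ∈ QModLE 𝒪 (CongruenceSubgroup.Gamma1 n) w,
    ∀ z τ, f z τ = F τ) ⟨_, const_mem_QModLE h𝒪 1, fun _ _ ↦ rfl⟩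
    (fun _ ↦ ⟨0, Submodule.zero_mem _, fun _ _ ↦ rfl⟩) ?_ ?_ ?_ ?_ hf
  · rintro w f g ⟨F, hF, hf⟩ ⟨G, hG, hg⟩
    exact ⟨F + G, Submodule.add_mem _ hF hG, fun z τ ↦ congrArg₂ (· + ·) (hf z τ) (hg z τ)⟩
  · rintro w c f ⟨F, hF, hf⟩
    exact ⟨c • F, Submodule.smul_mem _ c hF, fun z τ ↦ congrArg (c * ·) (hf z τ)⟩
  · rintro a b f hab ⟨F, hF, hf⟩
    exact ⟨F, QModLE.mono hab hF, hf⟩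
  · rintro a g hg b f ⟨F, hF, hf⟩
    cases hg with
    | qmod w h hh =>
      exact ⟨h * F, mul_mem_QModLE h𝒪 hh.mem_QModLE hF, fun z τ ↦ congrArg (h τ * ·) (hf z τ)⟩
    | z i j hij => exact absurd (Subsingleton.elim i j) hij

lemma continuous_zRing {w : ℤ} {f : (Fin N → ℂ) → ℍ → ℂ} (hf : f ∈ zRing 𝒪 n N w) {τ : ℍ}
    {X : Type*} [TopologicalSpace X] {p : X → Fin N → ℂ} (hp : Continuous p)
    (hoff : ∀ x, OffDiagonal (p x) τ) : Continuous fun x ↦ f (p x) τ := by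
  refine zRing_induction (P := fun _ f ↦ Continuous fun x ↦ f (p x) τ)
    continuous_const (fun _ ↦ continuous_const) (fun _ f g hf hg ↦ hf.add hg)
    (fun _ c f hf ↦ continuous_const.mul hf) (fun _ _ _ _ h ↦ h) (fun a g hg b f hf ↦ ?_) hf
  refine Continuous.mul ?_ hf
  cases hg with
  | qmod => exact continuous_const
  | z i j hij s k =>
    refine continuous_iff_continuousAt.mpr fun x ↦ ?_
    exact ContinuousAt.comp (g := zder s (natMul n τ)) (f := fun x ↦ p x i - p x j - k * τ)
      (analyticAt_zder s (sub_int_mul_notMem (n := n) (hoff x i j hij) k)).continuousAt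
      (by fun_prop)

lemma offDiagonal_of_heights {τ : ℍ} {c : Fin N → ℂ}
    (hc : ∀ i j, i ≠ j → ∃ k : ℤ, k * τ.im < (c i - c j).im ∧ (c i - c j).im < (k + 1) * τ.im)
    (x : Fin N → ℝ) : OffDiagonal (fun i ↦ x i + c i) τ := by
  intro i j hij
  obtain ⟨k, h1, h2⟩ := hc i j hij
  rw [sub_im] at h1 h2
  exact notMem_latt_of_im k (by simpa using h1) (by simpa using h2)

/-- Fubini's theorem on the unit cube, the first variable being integrated first. -/
lemma setIntegral_Icc_cons {g : (Fin (N + 1) → ℝ) → ℂ} (hg : Continuous g) :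
    ∫ x in Set.Icc (0 : Fin (N + 1) → ℝ) 1, g x =
      ∫ y in Set.Icc (0 : Fin N → ℝ) 1, ∫ t in (0 : ℝ)..1, g (Fin.cons t y) := by
  have he := (MeasureTheory.volume_preserving_piFinSuccAbove (fun _ : Fin (N + 1) ↦ ℝ) 0).symm
  have h1 : ∀ p : ℝ × (Fin N → ℝ),
      (MeasurableEquiv.piFinSuccAbove (fun _ : Fin (N + 1) ↦ ℝ) 0).symm p = Fin.cons p.1 p.2 :=
    fun p ↦ Fin.insertNth_zero' p.1 p.2
  rw [← he.setIntegral_preimage_emb (MeasurableEquiv.measurableEmbedding _)]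
  have h2 : (MeasurableEquiv.piFinSuccAbove (fun _ : Fin (N + 1) ↦ ℝ) 0).symm ⁻¹'
      Set.Icc (0 : Fin (N + 1) → ℝ) 1 = Set.Icc (0 : ℝ) 1 ×ˢ Set.Icc (0 : Fin N → ℝ) 1 := by
    ext p
    rw [Set.mem_preimage, h1]
    simp only [Set.mem_Icc, Set.mem_prod, Pi.le_def, Fin.forall_fin_succ, Fin.cons_zero,
      Fin.cons_succ, Pi.zero_apply, Pi.one_apply]
    tauto
  rw [h2]
  simp only [h1]
  rw [MeasureTheory.Measure.volume_eq_prod, ← MeasureTheory.setIntegral_prod_swap]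
  have hcont : Continuous fun p : (Fin N → ℝ) × ℝ ↦ g (Fin.cons p.2 p.1) :=
    hg.comp (Continuous.finCons (A := fun _ : Fin (N + 1) ↦ ℝ) continuous_snd continuous_fst)
  simp only [Prod.fst_swap, Prod.snd_swap]
  rw [MeasureTheory.setIntegral_prod _
    (hcont.continuousOn.integrableOn_compact (isCompact_Icc.prod isCompact_Icc))]
  refine MeasureTheory.setIntegral_congr_fun measurableSet_Icc fun y _ ↦ ?_
  rw [intervalIntegral.integral_of_le zero_le_one, MeasureTheory.integral_Icc_eq_integral_Ioc]

/-- The integral of an element of the ring over the tori whose heights lie in a fixed alcove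
is quasi-modular. -/
theorem exists_integral_eq (h𝒪 : IsFormClass 𝒪) (κ : Fin N → Fin N → ℤ) {w : ℤ}
    {f : (Fin N → ℂ) → ℍ → ℂ} (hf : f ∈ zRing 𝒪 n N w) :
    ∃ F ∈ QModLE 𝒪 (CongruenceSubgroup.Gamma1 n) w, ∀ (τ : ℍ) (c : Fin N → ℂ),
      (∀ i j, i ≠ j → κ i j * τ.im < (c i - c j).im ∧ (c i - c j).im < (κ i j + 1) * τ.im) →
        ∫ x in Set.Icc (0 : Fin N → ℝ) 1, f (fun i ↦ x i + c i) τ = F τ := by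
  have hbase : ∀ {N : ℕ} [Subsingleton (Fin N)] {w : ℤ} {f : (Fin N → ℂ) → ℍ → ℂ},
      f ∈ zRing 𝒪 n N w → ∃ F ∈ QModLE 𝒪 (CongruenceSubgroup.Gamma1 n) w,
        ∀ (τ : ℍ) (c : Fin N → ℂ),
          ∫ x in Set.Icc (0 : Fin N → ℝ) 1, f (fun i ↦ x i + c i) τ = F τ := by
    intro N _ w f hf
    obtain ⟨F, hF, hfF⟩ := exists_QModLE_of_subsingleton h𝒪 hf
    refine ⟨F, hF, fun τ c ↦ ?_⟩
    simp only [hfF, MeasureTheory.setIntegral_const, MeasureTheory.Measure.real]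
    rw [Real.volume_Icc_pi_toReal zero_le_one]
    simp
  induction N generalizing w with
  | zero =>
    obtain ⟨F, hF, h⟩ := hbase hf
    exact ⟨F, hF, fun τ c _ ↦ h τ c⟩
  | succ N ih =>
    -- One variable is treated apart: there is no z_0 − z_1 from which to build an antidifference,
    -- but the integrand is constant and the cube has volume one.
    cases N with
    | zero =>
      have : Subsingleton (Fin (0 + 1)) := inferInstanceAs (Subsingleton (Fin 1))
      obtain ⟨F, hF, h⟩ := hbase hf
      exact ⟨F, hF, fun τ c _ ↦ h τ c⟩
    | succ N =>
      obtain ⟨g, hg, hfg⟩ := exists_antidifference hf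
      -- The weight bound rises to w + 1 for `g` and returns to w for the sum of residues `r`, so
      -- the induction closes with the same w.
      obtain ⟨r, hr, hgr⟩ := exists_integral_sub_eq h𝒪 hg fun j ↦ κ 0 j.succ
      obtain ⟨F, hF, hrF⟩ := ih (fun i j ↦ κ i.succ j.succ) hr
      refine ⟨F, hF, fun τ c hc ↦ ?_⟩
      have hoff := offDiagonal_of_heights fun i j hij ↦ ⟨κ i j, hc i j hij⟩
      rw [setIntegral_Icc_cons (continuous_zRing hf (by fun_prop) hoff),
        ← hrF τ (fun j ↦ c j.succ) fun i j hij ↦ hc i.succ j.succ (by simpa using hij)]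
      refine MeasureTheory.setIntegral_congr_fun measurableSet_Icc fun y _ ↦ ?_
      have hcons : ∀ t : ℝ, (fun i ↦ ((Fin.cons t y : Fin (N + 2) → ℝ) i : ℂ) + c i) =
          (Fin.cons (t + c 0) fun j ↦ y j + c j.succ : Fin (N + 2) → ℂ) := fun t ↦ by
        funext i
        induction i using Fin.cases <;> rfl
      have hoff' : ∀ t : ℝ, OffDiagonal
          (Fin.cons (t + c 0) fun j ↦ y j + c j.succ : Fin (N + 2) → ℂ) τ := fun t ↦ by
        rw [← hcons]
        exact hoff _
      have hT : (natMul n τ : ℂ) ∈ latt τ := latt_natMul_subset n τ (self_mem_latt _)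
      have hoffT : ∀ t : ℝ, OffDiagonal
          (Fin.cons (t + c 0 + natMul n τ) fun j ↦ y j + c j.succ : Fin (N + 2) → ℂ) τ := by
        intro t
        obtain ⟨h1, h2⟩ := offDiagonal_cons.mp (hoff' t)
        refine offDiagonal_cons.mpr ⟨fun j ↦ ?_, h2⟩
        rw [add_sub_right_comm, add_mem_latt_iff τ hT]
        exact h1 j
      simp only [hcons]
      rw [← hgr τ _ (c 0) (offDiagonal_cons.mp (hoff' 0)).2 fun j ↦ by
        simpa using hc 0 j.succ (Fin.succ_ne_zero j).symm, ← intervalIntegral.integral_sub]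
      · exact intervalIntegral.integral_congr fun t _ ↦ hfg _ _ τ (hoff' t)
      · exact (continuous_zRing hg (by fun_prop) hoff').intervalIntegrable _ _
      · exact (continuous_zRing hg (by fun_prop) hoffT).intervalIntegrable _ _

end TorusIntegrals

/-! ### Reduction to the ring generated by `Z` -/

section Reduction

variable {𝒪 : Set (ℍ → ℂ)} {n : ℕ} [NeZero n] {N : ℕ}

/-- Agreement off the diagonals suffices, since the tori avoid them; at the poles the values of the
generators are mere conventions. -/
lemma exists_mem_zRing_of_gradedPiece {gen : ℤ → ((Fin N → ℂ) → ℍ → ℂ) → Prop}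
    (hgen : ∀ a g, gen a g → ∃ g' ∈ zRing 𝒪 n N a, ∀ z τ, OffDiagonal z τ → g z τ = g' z τ)
    {w : ℤ} {f : (Fin N → ℂ) → ℍ → ℂ} (hf : f ∈ gradedPiece gen w) :
    ∃ f' ∈ zRing 𝒪 n N w, ∀ z τ, OffDiagonal z τ → f z τ = f' z τ := by
  induction hf using Submodule.span_induction with
  | mem f hf =>
    obtain ⟨l, h1, rfl, rfl⟩ := hf
    induction l with
    | nil => exact ⟨1, one_mem_zRing, fun _ _ _ ↦ rfl⟩
    | cons x l ih =>
      obtain ⟨f', hf', h⟩ := ih fun y hy ↦ h1 y (by simp [hy])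
      obtain ⟨g', hg', h'⟩ := hgen _ _ (h1 x (by simp))
      simp only [List.map_cons, List.sum_cons, List.prod_cons]
      exact ⟨g' * f', mul_mem_zRing hg' hf',
        fun z τ hz ↦ congrArg₂ (· * ·) (h' z τ hz) (h z τ hz)⟩
  | zero => exact ⟨0, Submodule.zero_mem _, fun _ _ _ ↦ rfl⟩
  | add f₁ f₂ _ _ h₁ h₂ =>
    obtain ⟨g₁, hg₁, h₁⟩ := h₁
    obtain ⟨g₂, hg₂, h₂⟩ := h₂
    exact ⟨g₁ + g₂, Submodule.add_mem _ hg₁ hg₂,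
      fun z τ hz ↦ congrArg₂ (· + ·) (h₁ z τ hz) (h₂ z τ hz)⟩
  | smul c f _ h =>
    obtain ⟨g, hg, h⟩ := h
    exact ⟨c • g, Submodule.smul_mem _ c hg, fun z τ hz ↦ congrArg (c * ·) (h z τ hz)⟩

lemma gradedPiece_invariant {gen : ℤ → ((Fin N → ℂ) → ℍ → ℂ) → Prop} {z z' : Fin N → ℂ} {τ : ℍ}
    (hgen : ∀ a g, gen a g → g z τ = g z' τ)
    {w : ℤ} {f : (Fin N → ℂ) → ℍ → ℂ} (hf : f ∈ gradedPiece gen w) : f z τ = f z' τ := by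
  induction hf using Submodule.span_induction with
  | mem f hf =>
    obtain ⟨l, h1, -, rfl⟩ := hf
    induction l with
    | nil => rfl
    | cons x l ih =>
      simp only [List.map_cons, List.prod_cons]
      exact congrArg₂ (· * ·) (hgen _ _ (h1 x (by simp))) (ih fun y hy ↦ h1 y (by simp [hy]))
  | zero => rfl
  | add f₁ f₂ _ _ h₁ h₂ => exact congrArg₂ (· + ·) h₁ h₂
  | smul c f _ h => exact congrArg (c * ·) h

lemma exists_wp_mem_zRing (h𝒪 : IsFormClass 𝒪) {i j : Fin N} (hij : i ≠ j) (s : ℕ) (k : ℤ) :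
    ∃ g ∈ zRing 𝒪 n N (s + 2), ∀ z τ, OffDiagonal z τ →
      wp s (z i - z j - k * τ) (natMul n τ) = g z τ := by
  refine ⟨(-1 : ℂ) • (fun z τ ↦ zder (s + 1) (natMul n τ) (z i - z j - k * τ)) +
    if s = 0 then (fun _ τ ↦ zregder 1 (natMul n τ) : (Fin N → ℂ) → ℍ → ℂ) else 0, Submodule.add_mem _
      (Submodule.smul_mem _ _ ?_) ?_, fun z τ hz ↦ ?_⟩
  · exact zRing_mono (by push_cast; omega) (ZGen.z i j hij (s + 1) k).mem
  · split_ifs with hs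
    · exact zRing_mono (by push_cast; omega) (mem_zRing_of_mem_QModLE (zregder_mem_QModLE n h𝒪 1))
    · exact Submodule.zero_mem _
  · rw [wp_eq s _ (sub_int_mul_notMem (hz i j hij) k)]
    split_ifs <;> simp

lemma wp_add_int_mul (s : ℕ) (u : ℂ) (τ : ℍ) (m : ℤ) : wp s (u + m * τ) τ = wp s u τ := by
  have h : (fun v ↦ (periodPair τ).weierstrassP (v + m * τ)) = (periodPair τ).weierstrassP := by
    funext v
    have := (periodPair τ).weierstrassP_add_coe v
      ⟨m * τ, (PeriodPair.mem_lattice).mpr ⟨0, m, by simp [periodPair]⟩⟩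
    exact this
  have h1 := congrFun (iteratedDeriv_comp_add_const (f := (periodPair τ).weierstrassP) (n := s)
    (s := m * τ)) u
  rw [h] at h1
  exact h1.symm

theorem exists_mem_zRing_of_mem_gamma1Ring (h𝒪 : IsFormClass 𝒪) {w : ℤ}
    {f : (Fin N → ℂ) → ℍ → ℂ} (hf : f ∈ gamma1Ring 𝒪 n N w) :
    ∃ f' ∈ zRing 𝒪 n N w, ∀ z τ, OffDiagonal z τ → f z τ = f' z τ := by
  refine exists_mem_zRing_of_gradedPiece (fun a g hg ↦ ?_) hf
  cases hg with
  | qmod w h hh => exact ⟨_, (ZGen.qmod a h hh).mem, fun _ _ _ ↦ rfl⟩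
  | wp i j hij s k => exact exists_wp_mem_zRing h𝒪 hij s k

theorem exists_mem_zRing_of_mem_levelOneRing (h𝒪 : IsFormClass 𝒪) {w : ℤ}
    {f : (Fin N → ℂ) → ℍ → ℂ} (hf : f ∈ levelOneRing N w) :
    ∃ f' ∈ zRing 𝒪 1 N w, ∀ z τ, OffDiagonal z τ → f z τ = f' z τ := by
  refine exists_mem_zRing_of_gradedPiece (fun a g hg ↦ ?_) hf
  cases hg with
  | G2 => exact ⟨_, (ZGen.qmod 2 _ (isQuasiModular_G2 h𝒪 _)).mem, fun _ _ _ ↦ rfl⟩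
  | G4 => exact ⟨_, (ZGen.qmod 4 _ (isQuasiModular_G h𝒪 2 (by simp))).mem, fun _ _ _ ↦ rfl⟩
  | G6 => exact ⟨_, (ZGen.qmod 6 _ (isQuasiModular_G h𝒪 4 (by simp))).mem, fun _ _ _ ↦ rfl⟩
  | wp i j hij s =>
    obtain ⟨g, hg, h⟩ := exists_wp_mem_zRing (n := 1) h𝒪 hij s 0
    refine ⟨g, hg, fun z τ hz ↦ ?_⟩
    rw [← h z τ hz, natMul_one, Int.cast_zero, zero_mul, sub_zero]

lemma gamma1Ring_add_int_mul {w : ℤ} {f : (Fin N → ℂ) → ℍ → ℂ} (hf : f ∈ gamma1Ring 𝒪 n N w)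
    (z : Fin N → ℂ) (m : Fin N → ℤ) (τ : ℍ) :
    f (fun i ↦ z i + m i * natMul n τ) τ = f z τ := by
  refine gradedPiece_invariant (fun a g hg ↦ ?_) hf
  cases hg with
  | qmod => rfl
  | wp i j hij s k =>
    dsimp only
    rw [← wp_add_int_mul s (z i - z j - k * τ) _ (m i - m j)]
    congr 1
    push_cast
    ring

lemma levelOneRing_add_int_mul {w : ℤ} {f : (Fin N → ℂ) → ℍ → ℂ} (hf : f ∈ levelOneRing N w)
    (z : Fin N → ℂ) (m : Fin N → ℤ) (τ : ℍ) :
    f (fun i ↦ z i + m i * natMul 1 τ) τ = f z τ := by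
  refine gradedPiece_invariant (fun a g hg ↦ ?_) hf
  cases hg with
  | wp i j hij s =>
    dsimp only
    rw [natMul_one, ← wp_add_int_mul s (z i - z j) _ (m i - m j)]
    congr 1
    push_cast
    ring
  | _ => rfl

end Reduction

/-! ### Periods over the chambers -/

section Chambers

variable {n N : ℕ}

/-- The points the differences of whose coordinates lie in the open unit intervals with left
end points `κ`. -/
def alcove (κ : Fin N → Fin N → ℤ) : Set (Fin N → ℝ) :=
  {a | ∀ i j, i ≠ j → (κ i j : ℝ) < a i - a j ∧ a i - a j < κ i j + 1}

lemma isOpen_alcove (κ : Fin N → Fin N → ℤ) : IsOpen (alcove κ) := by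
  simp only [alcove, Set.ofPred_forall, Set.ofPred_and]
  refine isOpen_iInter_of_finite fun i ↦ isOpen_iInter_of_finite fun j ↦
    isOpen_iInter_of_finite fun _ ↦ IsOpen.inter ?_ ?_
  · exact isOpen_lt (by fun_prop) (by fun_prop)
  · exact isOpen_lt (by fun_prop) (by fun_prop)

lemma mem_alcove_of_lift {β : DiagonalComplement n N} {a : Fin N → ℝ}
    (ha : ∀ i, β.1 i = (a i : AddCircle (n : ℝ))) :
    a ∈ alcove fun i j ↦ ⌊a i - a j⌋ := by
  refine fun i j hij ↦ ⟨lt_of_le_of_ne (Int.floor_le _) fun h ↦ ?_, Int.lt_floor_add_one _⟩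
  apply β.2 i j hij ⌊a i - a j⌋
  rw [ha, ha, ← AddCircle.coe_sub, h]

lemma alcove_heights {κ : Fin N → Fin N → ℤ} {a : Fin N → ℝ} (ha : a ∈ alcove κ) (τ : ℍ)
    {c : Fin N → ℂ} (hc : ∀ i, (c i).im = a i * τ.im) (i j : Fin N) (hij : i ≠ j) :
    κ i j * τ.im < (c i - c j).im ∧ (c i - c j).im < (κ i j + 1) * τ.im := by
  obtain ⟨h1, h2⟩ := ha i j hij
  rw [sub_im, hc, hc, ← sub_mul]
  exact ⟨mul_lt_mul_of_pos_right h1 τ.im_pos, mul_lt_mul_of_pos_right h2 τ.im_pos⟩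

lemma exists_lift (β : DiagonalComplement n N) :
    ∃ a : Fin N → ℝ, ∀ i, β.1 i = (a i : AddCircle (n : ℝ)) := by
  choose a ha using fun i ↦ QuotientAddGroup.mk_surjective (β.1 i)
  exact ⟨a, fun i ↦ (ha i).symm⟩

/-- Points near `β` have lifts near a given lift of `β`. -/
lemma eventually_exists_lift_mem {β : DiagonalComplement n N} {a : Fin N → ℝ}
    (ha : ∀ i, β.1 i = (a i : AddCircle (n : ℝ))) {V : Set (Fin N → ℝ)} (hV : V ∈ 𝓝 a) :
    ∀ᶠ β' in 𝓝 β, ∃ a' ∈ V, ∀ i, β'.1 i = (a' i : AddCircle (n : ℝ)) := by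
  have hopen : IsOpenMap (Pi.map fun (_ : Fin N) (x : ℝ) ↦ (x : AddCircle (n : ℝ))) :=
    IsOpenMap.piMap (fun _ ↦ QuotientAddGroup.isOpenMap_coe)
      (.of_forall fun _ ↦ QuotientAddGroup.mk_surjective)
  have h1 := hopen.image_mem_nhds hV
  rw [show Pi.map (fun (_ : Fin N) (x : ℝ) ↦ (x : AddCircle (n : ℝ))) a = β.1 from
    funext fun i ↦ (ha i).symm] at h1
  filter_upwards [continuous_subtype_val.continuousAt.preimage_mem_nhds h1] with β' ⟨a', ha', h⟩
  exact ⟨a', ha', fun i ↦ (congrFun h i).symm⟩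

/-- If the integrals over the tori in each alcove are given by a function in the class `Q` and `f`
is elliptic, then the periods over each chamber are given by a function in `Q`. -/
theorem exists_isPeriodFunction [NeZero n] {Q : Set (ℍ → ℂ)} {f : (Fin N → ℂ) → ℍ → ℂ}
    (hell : ∀ (z : Fin N → ℂ) (m : Fin N → ℤ) (τ : ℍ),
      f (fun i ↦ z i + m i * natMul n τ) τ = f z τ)
    (hint : ∀ κ : Fin N → Fin N → ℤ, ∃ F ∈ Q, ∀ (τ : ℍ) (c : Fin N → ℂ),
      (∀ i j, i ≠ j → κ i j * τ.im < (c i - c j).im ∧ (c i - c j).im < (κ i j + 1) * τ.im) →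
        MeasureTheory.IntegrableOn (fun x : Fin N → ℝ ↦ f (fun i ↦ x i + c i) τ) (Set.Icc 0 1) ∧
        ∫ x in Set.Icc (0 : Fin N → ℝ) 1, f (fun i ↦ x i + c i) τ = F τ)
    (S : ConnectedComponents (DiagonalComplement n N)) :
    ∃ F ∈ Q, IsPeriodFunction f S F := by
  choose F hF hFint using hint
  obtain ⟨β₀, rfl⟩ := ConnectedComponents.surjective_coe S
  choose lift hlift using exists_lift (n := n) (N := N)
  let κ : (Fin N → ℝ) → Fin N → Fin N → ℤ := fun a i j ↦ ⌊a i - a j⌋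
  -- The label and its representative β₀ do not depend on τ, so one function serves all τ.
  refine ⟨F (κ (lift β₀)), hF _, fun τ α ⟨β, hβ, hα⟩ ↦ ?_⟩
  -- two lifts of a point have the same period
  have hwell : ∀ (β : DiagonalComplement n N) (a a' : Fin N → ℝ) (κ₁ κ₂ : Fin N → Fin N → ℤ),
      (∀ i, β.1 i = (a i : AddCircle (n : ℝ))) → (∀ i, β.1 i = (a' i : AddCircle (n : ℝ))) →
      a ∈ alcove κ₁ → a' ∈ alcove κ₂ → F κ₁ τ = F κ₂ τ := by
    intro β a a' κ₁ κ₂ ha ha' hκ₁ hκ₂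
    have hm : ∀ i, ∃ m : ℤ, m • (n : ℝ) = a' i - a i := fun i ↦ by
      rw [← AddCircle.coe_eq_zero_iff, AddCircle.coe_sub, ← ha, ← ha', sub_self]
    choose m hm using hm
    -- With base points a_iτ instead of i·a_i Im τ, two lifts differ exactly by m_i·nτ, and
    -- ellipticity identifies the integrands pointwise.
    have h1 := (hFint κ₂ τ (fun i ↦ a' i * τ) (alcove_heights hκ₂ τ fun i ↦ by simp)).2
    have h2 := (hFint κ₁ τ (fun i ↦ a i * τ) (alcove_heights hκ₁ τ fun i ↦ by simp)).2
    rw [← h1, ← h2]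
    refine MeasureTheory.setIntegral_congr_fun measurableSet_Icc fun x _ ↦ ?_
    rw [← hell _ m τ]
    congr 1
    funext i
    have : ((a' i : ℝ) : ℂ) = a i + m i * n := by
      have := hm i
      rw [zsmul_eq_mul] at this
      rw [show a' i = a i + m i * n by linarith]
      push_cast
      rfl
    rw [this, natMul_coe]
    ring
  -- The chosen lift and its κ may jump from point to point, but the value `F κ τ` does not depend
  -- on the lift, and nearby points have lifts in the same open alcove. Local constancy then gives
  -- constancy on the connected component.
  have hloc : IsLocallyConstant fun β ↦ F (κ (lift β)) τ := by
    rw [IsLocallyConstant.iff_eventually_eq]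
    intro β
    have h0 := mem_alcove_of_lift (hlift β)
    filter_upwards [eventually_exists_lift_mem (hlift β) ((isOpen_alcove _).mem_nhds h0)]
      with β' ⟨a', ha', h⟩
    exact hwell β' _ _ _ _ (hlift β') h (mem_alcove_of_lift (hlift β')) ha'
  have hα' := mem_alcove_of_lift hα
  obtain ⟨h1, h2⟩ := hFint (κ fun i ↦ α i / τ.im) τ (fun i ↦ α i * I)
    (alcove_heights hα' τ fun i ↦ by simp [τ.im_ne_zero])
  refine ⟨h1, h2.trans ?_⟩
  rw [hwell β _ _ _ _ hα (hlift β) hα' (mem_alcove_of_lift (hlift β))]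
  have h3 := ConnectedComponents.coe_eq_coe.mp hβ
  exact hloc.apply_eq_of_isPreconnected isPreconnected_connectedComponent
    (h3 ▸ mem_connectedComponent) mem_connectedComponent

/-- The version for functions that agree with an element of the ring off the diagonals. -/
theorem exists_isPeriodFunction_of_zRing [NeZero n] {𝒪 : Set (ℍ → ℂ)} (h𝒪 : IsFormClass 𝒪) {w : ℤ}
    {f f' : (Fin N → ℂ) → ℍ → ℂ} (hf' : f' ∈ zRing 𝒪 n N w)
    (hff' : ∀ z τ, OffDiagonal z τ → f z τ = f' z τ)
    (hell : ∀ (z : Fin N → ℂ) (m : Fin N → ℤ) (τ : ℍ),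
      f (fun i ↦ z i + m i * natMul n τ) τ = f z τ)
    (S : ConnectedComponents (DiagonalComplement n N)) :
    ∃ F ∈ QModLE 𝒪 (CongruenceSubgroup.Gamma1 n) w, IsPeriodFunction f S F := by
  refine exists_isPeriodFunction (Q := QModLE 𝒪 (CongruenceSubgroup.Gamma1 n) w) hell
    (fun κ ↦ ?_) S
  obtain ⟨F, hF, h⟩ := exists_integral_eq h𝒪 κ hf'
  refine ⟨F, hF, fun τ c hc ↦ ?_⟩
  have hoff := offDiagonal_of_heights fun i j hij ↦ ⟨κ i j, hc i j hij⟩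
  rw [← h τ c hc, funext fun x ↦ hff' _ τ (hoff x)]
  exact ⟨(continuous_zRing hf' (by fun_prop) hoff).continuousOn.integrableOn_compact isCompact_Icc,
    rfl⟩

end Chambers

end QuasiJacobi

end

theorem mainTheorem4 (𝒪 : Set (ℍ → ℂ))
    (h𝒪 : 𝒪 = QuasiJacobi.holomorphicFunctions ∨ 𝒪 = QuasiJacobi.moderateHolomorphicFunctions) :
    (∀ (N : ℕ) (w : ℤ), ∀ f ∈ QuasiJacobi.levelOneRing N w,
      ∀ S : ConnectedComponents (QuasiJacobi.DiagonalComplement 1 N),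
        ∃ F ∈ QuasiJacobi.QModLE 𝒪 (⊤ : Subgroup SL(2, ℤ)) w,
          QuasiJacobi.IsPeriodFunction f S F) ∧
    (∀ (n : ℕ) [NeZero n] (N : ℕ) (w : ℤ), ∀ f ∈ QuasiJacobi.gamma1Ring 𝒪 n N w,
      ∀ S : ConnectedComponents (QuasiJacobi.DiagonalComplement n N),
        ∃ F ∈ QuasiJacobi.QModLE 𝒪 (CongruenceSubgroup.Gamma1 n) w,
          QuasiJacobi.IsPeriodFunction f S F) := by
  refine ⟨fun N w f hf S ↦ ?_, fun n _ N w f hf S ↦ ?_⟩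
  · obtain ⟨f', hf', hff'⟩ := QuasiJacobi.exists_mem_zRing_of_mem_levelOneRing h𝒪 hf
    rw [← QuasiJacobi.gamma1_one]
    exact QuasiJacobi.exists_isPeriodFunction_of_zRing h𝒪 hf' hff'
      (QuasiJacobi.levelOneRing_add_int_mul hf) S
  · obtain ⟨f', hf', hff'⟩ := QuasiJacobi.exists_mem_zRing_of_mem_gamma1Ring h𝒪 hf
    exact QuasiJacobi.exists_isPeriodFunction_of_zRing h𝒪 hf' hff'
      (QuasiJacobi.gamma1Ring_add_int_mul hf) S
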